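/- Let $a:\mathbb Z\to\mathbb R$ be symmetric ($a(k)=a(-k)$), of bounded support, with $\omega^2(\lambda)=\sum_{k}a(k)e^{ik\lambda}>0$ for all $\lambda\in\mathbb R$, and suppose that $a(k)\neq0$ for some $k\ne0$ (equivalently, $\omega$ is not constant). Let $n\in\mathbb Z$ and let $f(t)$, $t\ge0$, be a real-valued stochastic process such that (A1) $f$ is a centered second-order (wide-sense) stationary process with continuous covariance function; (A2) there is an open set $U\supseteq\{x\in\mathbb R:\ x^2=\omega^2(\lambda)\text{ for some }\lambda\in\mathbb R\}$ with $\mu(U)=0$, where $\mu$ is the spectral measure of $f$; and assume in addition that $f$ is strictly stationary. Consider the infinite system $$\dot q_j=p_j,\qquad \dot p_j=-\sum_{k}a(k-j)q_k+f(t)\,\delta_{j,n},\qquad j\in\mathbb Z,\ t\ge0.\tag{1}$$ A solution of (1) is a family of processes $q_j,p_j$ that are continuously differentiable in mean square and satisfy these equations almost surely, for all $j$ and all $t\ge0$. Put $L=\ell_2(\mathbb Z)\times\ell_2(\mathbb Z)$. Then there is a solution $\eta(t)=(q^\infty(t),p^\infty(t))$ of (1) with $P(\eta(t)\in L)=1$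 for all $t\ge0$, each component of which satisfies (A1), and with $Dq^\infty_k(0)\le c_1r^{|n-k|}$, $Dp^\infty_k(0)\le c_2r^{|n-k|}$ for all $k$, with constants $c_1,c_2>0$ and $0<r<1$, such that the following holds. For every non-random $\psi(0)=(q(0),p(0))\in L$ the system (1) has a solution $\psi(t)=(q(t),p(t))$ with this initial condition, with $P(\psi(t)\in L)=1$ for all $t\ge0$, and with $$\sup_{0\le t\le T}\ \sup_{j}\ E\big(q_j(t)^2+p_j(t)^2\big)<\infty\quad\text{for all } T>0;$$ and for every such solution $\psi$ each component of $\psi(t)-\eta(t)$ is stochastically equivalent to a process whose trajectories are almost surely infinitely differentiable and converge to $0$ as $t\to+\infty$, and each component of $\psi(t)$ converges in distribution to the corresponding component of $\eta(0)$: for all $k\in\mathbb Z$ $$q_k(t)\xrightarrow{d}q_k^\infty(0),\qquad p_k(t)\xrightarrow{d}p_k^\infty(0)\qquad (t\to\infty).$$ -/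

import Mathlib

open MeasureTheory ProbabilityTheory Filter Topology Set
open scoped NNReal

noncomputable section

/-- The spectral function `ω²(l) = ∑ₖ a(k) e^{ikl}` of the interaction `a : ℤ → ℝ`. For a symmetric
`a` of bounded support the sum is finite and real, so that taking the real part changes nothing. -/
def omegaSq (a : ℤ → ℝ) (l : ℝ) : ℝ :=
  (∑' k : ℤ, (a k : ℂ) * Complex.exp (Complex.I * (k : ℂ) * (l : ℂ))).re

/-- The standing conditions on the interaction: symmetry, bounded support, positivity of `ω²`. -/
structure IsInteraction (a : ℤ → ℝ) : Prop where
  symm : ∀ k, a (-k) = a k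
  bounded_support : ∃ K : ℕ, ∀ k : ℤ, (K : ℤ) < |k| → a k = 0
  pos : ∀ l : ℝ, 0 < omegaSq a l

variable {Ω : Type*} [MeasurableSpace Ω]

/-- Condition A1: `X(t)`, `t ≥ 0`, is a real-valued centered second-order (wide-sense) stationary
process with continuous covariance function. -/
structure IsCenteredStationary (P : Measure Ω) (X : ℝ → Ω → ℝ) : Prop where
  memLp : ∀ t, 0 ≤ t → MemLp (X t) 2 P
  centered : ∀ t, 0 ≤ t → ∫ w, X t w ∂P = 0
  cov : ∃ B : ℝ → ℝ, Continuous B ∧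
    ∀ s t, 0 ≤ s → 0 ≤ t → cov[X s, X t; P] = B (s - t)

/-- `m` is the spectral measure of the wide-sense stationary process `X`:
`cov (X(t+s), X(t)) = ∫ e^{isx} m(dx)`. Since the covariance is real and even, prescribing it for
`s ≥ 0` is enough. -/
structure IsSpectralMeasure (P : Measure Ω) (X : ℝ → Ω → ℝ) (m : Measure ℝ) : Prop where
  finite : IsFiniteMeasure m
  cov : ∀ s t, 0 ≤ s → 0 ≤ t →
    ((cov[X (t + s), X t; P] : ℝ) : ℂ) =
      ∫ x : ℝ, Complex.exp (Complex.I * (s : ℂ) * (x : ℂ)) ∂m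

/-- Condition A2: the spectral measure of `f` does not charge some open set containing
`{x : x² ∈ E}`, where `E` is the range of `ω²`. -/
def SpectrumIsolated (a : ℤ → ℝ) (P : Measure Ω) (f : ℝ → Ω → ℝ) : Prop :=
  ∃ m : Measure ℝ, IsSpectralMeasure P f m ∧
    ∃ U : Set ℝ, IsOpen U ∧ {x : ℝ | x ^ 2 ∈ Set.range (omegaSq a)} ⊆ U ∧ m U = 0

/-- `X(t)`, `t ≥ 0`, is strictly stationary: its finite-dimensional distributions are invariant
under time shifts. -/
def IsStrictlyStationary (P : Measure Ω) (X : ℝ → Ω → ℝ) : Prop :=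
  ∀ (m : ℕ) (τ : Fin m → ℝ), (∀ i, 0 ≤ τ i) → ∀ h, 0 ≤ h →
    IdentDistrib (fun w i => X (τ i + h) w) (fun w i => X (τ i) w) P P

/-- `X` is a second-order process on `[0, ∞)`, continuously differentiable in mean square, with
mean-square derivative `X'` (one-sided at `0`). -/
structure HasContMSDeriv (P : Measure Ω) (X X' : ℝ → Ω → ℝ) : Prop where
  memLp : ∀ t, 0 ≤ t → MemLp (X t) 2 P
  memLp' : ∀ t, 0 ≤ t → MemLp (X' t) 2 P
  hasDeriv : ∀ t, 0 ≤ t →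
    Tendsto (fun s => eLpNorm (fun w => (X s w - X t w) / (s - t) - X' t w) 2 P)
      (𝓝[Ici 0 \ {t}] t) (𝓝 0)
  continuous' : ∀ t, 0 ≤ t →
    Tendsto (fun s => eLpNorm (fun w => X' s w - X' t w) 2 P) (𝓝[Ici 0] t) (𝓝 0)

/-- The processes `(q, p)` solve `q̈_j = -∑ₖ a(k-j) q_k + f(t) δ_{j,n}` on `[0, ∞)`: they are
continuously differentiable in mean square and for all `j` and `t ≥ 0` the equations `q̇_j = p_j`,
`ṗ_j = -∑ₖ a(k-j) q_k + f(t) δ_{j,n}` hold almost surely. -/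
def IsSolution (a : ℤ → ℝ) (n : ℤ) (P : Measure Ω) (f : ℝ → Ω → ℝ)
    (q p : ℤ → ℝ → Ω → ℝ) : Prop :=
  ∃ q' p' : ℤ → ℝ → Ω → ℝ,
    (∀ j, HasContMSDeriv P (q j) (q' j)) ∧ (∀ j, HasContMSDeriv P (p j) (p' j)) ∧
    ∀ j t, 0 ≤ t →
      (∀ᵐ w ∂P, q' j t w = p j t w) ∧
      (∀ᵐ w ∂P, p' j t w =
        -(∑' k : ℤ, a (k - j) * q k t w) + f t w * (if j = n then 1 else 0))

/-- `P((q(t), p(t)) ∈ L) = 1` for all `t ≥ 0`, where `L = ℓ²(ℤ) × ℓ²(ℤ)`. -/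
def StaysInL (P : Measure Ω) (q p : ℤ → ℝ → Ω → ℝ) : Prop :=
  ∀ t, 0 ≤ t → ∀ᵐ w ∂P, Memℓp (fun j => q j t w) 2 ∧ Memℓp (fun j => p j t w) 2

/-- The second moments of all components are bounded on bounded time intervals, uniformly in the
number of the particle. -/
def HasLocallyBoundedMoments (P : Measure Ω) (q p : ℤ → ℝ → Ω → ℝ) : Prop :=
  ∀ T : ℝ, ∃ C : ℝ, ∀ t, 0 ≤ t → t ≤ T → ∀ j,
    ∫ w, (q j t w) ^ 2 ∂P ≤ C ∧ ∫ w, (p j t w) ^ 2 ∂P ≤ C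

/-- `ψ = (q, p)` is the motion of the system with the (non-random) initial condition `(q₀, p₀)`. -/
structure IsMotion (a : ℤ → ℝ) (n : ℤ) (P : Measure Ω) (f : ℝ → Ω → ℝ)
    (q₀ p₀ : ℤ → ℝ) (q p : ℤ → ℝ → Ω → ℝ) : Prop where
  isSolution : IsSolution a n P f q p
  staysInL : StaysInL P q p
  moments : HasLocallyBoundedMoments P q p
  initial : ∀ j, (∀ᵐ w ∂P, q j 0 w = q₀ j) ∧ (∀ᵐ w ∂P, p j 0 w = p₀ j)

/-- `η = (q, p)` is a stationary motion of the system: a solution with values in `L`, each of whose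
components is a centered second-order stationary process with continuous covariance, and whose
variances decay exponentially away from the particle `n`. -/
structure IsStationaryMotion (a : ℤ → ℝ) (n : ℤ) (P : Measure Ω) (f : ℝ → Ω → ℝ)
    (q p : ℤ → ℝ → Ω → ℝ) : Prop where
  isSolution : IsSolution a n P f q p
  staysInL : StaysInL P q p
  stationary : ∀ k, IsCenteredStationary P (q k) ∧ IsCenteredStationary P (p k)
  decay : ∃ c₁ c₂ r : ℝ, 0 < c₁ ∧ 0 < c₂ ∧ 0 < r ∧ r < 1 ∧
    ∀ k : ℤ, Var[q k 0; P] ≤ c₁ * r ^ (n - k).natAbs ∧ Var[p k 0; P] ≤ c₂ * r ^ (n - k).natAbs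

/-- The process `X(t)`, `t ≥ 0`, has (up to stochastic equivalence) almost surely infinitely
differentiable trajectories converging to zero as `t → ∞`. -/
def VanishesSmoothly (P : Measure Ω) (X : ℝ → Ω → ℝ) : Prop :=
  ∃ Y : ℝ → Ω → ℝ, (∀ t, 0 ≤ t → ∀ᵐ w ∂P, X t w = Y t w) ∧
    ∀ᵐ w ∂P, ContDiffOn ℝ ((⊤ : ℕ∞) : WithTop ℕ∞) (fun t => Y t w) (Ici 0) ∧
      Tendsto (fun t => Y t w) atTop (𝓝 0)

end

noncomputable section

/-! Mean-square calculus is calculus in the Hilbert space `L²(P)`, so the system becomes a linear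
equation for sequences with entries in `L²(P)`. The homogeneous equation has a bounded generator on
`ℓ²(ℤ; L²(P))²`, and a Picard-type estimate gives uniqueness among componentwise solutions bounded
uniformly over the particles (`eq_zero_of_homogeneous`). Hence every motion is a fixed stationary
solution `η` plus the homogeneous flow started at `ψ(0) - η(0)`. It remains to construct `η` and to
show that the homogeneous part dies out at each particle.

Construction of `η`. Formally `q_j(t)` is the output of a filter with transfer function `G_{j-n}(x)
= (2π)⁻¹ ∫ cos((j-n)λ) / (ω²(λ) - x²) dλ`, the resolvent kernel of the coupling operator. By (A2)
the spectral measure `m` lives at a positive distance from the resonant frequencies, so `(1 + x²)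
G_k(x)` is bounded, with exponential decay in `k`: subtracting polynomials in `ω²`, which have
finite-range kernels, leaves a geometrically small remainder (`exists_latticeResolvent_le`). As `f`
is given only for `t ≥ 0`, the spectral representation is replaced by an isometry from the closed
real span of the characters `e^{isx}`, `s ≥ 0`, in `L²(m)` into `L²(P)`; it exists because the Gram
matrices agree. That `G_k` lies in this span follows by letting the damping `ε` tend to zero in
`∫₀^∞ e^{-εs} ω⁻¹ sin(ωs) e^{isx} ds = (ω² + (ε - ix)²)⁻¹` and averaging over `λ`
(`resolvent_mem_futureSpan`, `latticeResolvent_mem_futureSpan`). The same approximation by finite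
combinations of values of `f` transfers strict stationarity: the components of `η` have time
invariant laws.

Decay. The homogeneous flow acts path by path on `ℓ²(ℤ)²` (`ae_flow_eq`), and its matrix entries are
Fourier integrals such as `(2π)⁻¹ ∫ cos(kλ) cos(tω(λ)) dλ`. Since `ω` is analytic and not constant,
`ω' ≠ 0` almost everywhere, and a Riemann–Lebesgue argument sends each entry to zero. Parseval
bounds the rows in `ℓ²` uniformly in `t`, so the decay extends to all `ℓ²` data
(`tendsto_flow_zero`). Convergence in distribution is then Slutsky's theorem. -/

/-- The finite-range coupling `(Aq)_j = ∑_{d ∈ s} a(d) q_{j+d}`, for vectors with entries in an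
arbitrary real vector space. -/
def couple {H : Type*} [AddCommGroup H] [Module ℝ H] (a : ℤ → ℝ) (s : Finset ℤ) (q : ℤ → H)
    (j : ℤ) : H :=
  ∑ d ∈ s, a d • q (j + d)

theorem Memℓp.comp_add_int {H : Type*} [NormedAddCommGroup H] {q : ℤ → H} (hq : Memℓp q 2) (d : ℤ) :
    Memℓp (fun j => q (j + d)) 2 := by
  have h2 : 0 < (2 : ENNReal).toReal := by norm_num
  rw [memℓp_gen_iff h2] at hq ⊢
  exact ((Equiv.addRight d).summable_iff (f := fun i => ‖q i‖ ^ (2 : ENNReal).toReal)).2 hq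

/-! ### The homogeneous flow on `ℓ²(ℤ; H)²` as the exponential of a bounded generator. -/

section Generator

variable {H : Type*} [NormedAddCommGroup H] [NormedSpace ℝ H]

variable (H) in
/-- The bilateral shift by `d` on `ℓ²(ℤ; H)`. -/
def lpShift (d : ℤ) : lp (fun _ : ℤ => H) 2 →L[ℝ] lp (fun _ : ℤ => H) 2 :=
  LinearMap.mkContinuous
    { toFun := fun q => ⟨fun j => q (j + d), (lp.memℓp q).comp_add_int d⟩
      map_add' := fun _ _ => rfl
      map_smul' := fun _ _ => rfl } 1 (fun q => by
        have h2 : 0 < (2 : ENNReal).toReal := by norm_num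
        rw [one_mul]
        refine le_of_eq ?_
        rw [lp.norm_eq_tsum_rpow h2, lp.norm_eq_tsum_rpow h2]
        congr 1
        exact (Equiv.addRight d).tsum_eq (fun i => ‖q i‖ ^ (2 : ENNReal).toReal))

@[simp]
theorem lpShift_apply (d : ℤ) (q : lp (fun _ : ℤ => H) 2) (j : ℤ) :
    lpShift H d q j = q (j + d) := rfl

/-- The `j`-th coordinate on `ℓ²(ℤ; H)`. -/
def lpCoord (j : ℤ) : lp (fun _ : ℤ => H) 2 →L[ℝ] H :=
  LinearMap.mkContinuous
    { toFun := fun q => q j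
      map_add' := fun _ _ => rfl
      map_smul' := fun _ _ => rfl } 1 (fun q => by
        rw [one_mul]; exact lp.norm_apply_le_norm (by norm_num) q j)

@[simp]
theorem lpCoord_apply (j : ℤ) (q : lp (fun _ : ℤ => H) 2) : lpCoord j q = q j := rfl

variable (H) in
/-- The phase space `ℓ²(ℤ; H) × ℓ²(ℤ; H)`. -/
abbrev Phase := lp (fun _ : ℤ => H) 2 × lp (fun _ : ℤ => H) 2

variable (H) in
/-- The generator `(q, p) ↦ (p, -Aq)` of the homogeneous motion. -/
def generator (a : ℤ → ℝ) (s : Finset ℤ) : Phase H →L[ℝ] Phase H :=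
  (ContinuousLinearMap.snd ℝ (lp (fun _ : ℤ => H) 2) (lp (fun _ : ℤ => H) 2)).prod
    (-((∑ d ∈ s, a d • lpShift H d).comp
      (ContinuousLinearMap.fst ℝ (lp (fun _ : ℤ => H) 2) (lp (fun _ : ℤ => H) 2))))

theorem generator_fst (a : ℤ → ℝ) (s : Finset ℤ) (x : Phase H) (j : ℤ) :
    (generator H a s x).1 j = x.2 j := rfl

theorem generator_snd (a : ℤ → ℝ) (s : Finset ℤ) (x : Phase H) (j : ℤ) :
    (generator H a s x).2 j = -couple a s (fun i => x.1 i) j := by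
  simp only [generator, couple, ContinuousLinearMap.prod_apply, neg_apply,
    ContinuousLinearMap.comp_apply, ContinuousLinearMap.coe_fst', ← lpCoord_apply,
    map_neg, sum_apply, map_sum, smul_apply, map_smul]
  simp

/-- The position of the `j`-th particle. -/
def posCoord (j : ℤ) : Phase H →L[ℝ] H :=
  (lpCoord j).comp (ContinuousLinearMap.fst ℝ (lp (fun _ : ℤ => H) 2) (lp (fun _ : ℤ => H) 2))

/-- The momentum of the `j`-th particle. -/
def momCoord (j : ℤ) : Phase H →L[ℝ] H :=
  (lpCoord j).comp (ContinuousLinearMap.snd ℝ (lp (fun _ : ℤ => H) 2) (lp (fun _ : ℤ => H) 2))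

/-- The homogeneous motion started from `x`. -/
def flow (a : ℤ → ℝ) (s : Finset ℤ) (x : Phase H) (t : ℝ) : Phase H :=
  NormedSpace.exp (t • generator H a s) x

theorem flow_zero (a : ℤ → ℝ) (s : Finset ℤ) (x : Phase H) : flow a s x 0 = x := by
  simp [flow]

variable [CompleteSpace H]

theorem hasDerivAt_flow (a : ℤ → ℝ) (s : Finset ℤ) (x : Phase H) (t : ℝ) :
    HasDerivAt (flow a s x) (generator H a s (flow a s x t)) t := by
  have h := hasDerivAt_exp_smul_const' (𝕂 := ℝ) (generator H a s) t
  exact ((ContinuousLinearMap.apply ℝ (Phase H) x).hasFDerivAt.comp_hasDerivAt t h)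

theorem hasDerivAt_flow_fst (a : ℤ → ℝ) (s : Finset ℤ) (x : Phase H) (j : ℤ) (t : ℝ) :
    HasDerivAt (fun t => (flow a s x t).1 j) ((flow a s x t).2 j) t :=
  (posCoord (H := H) j).hasFDerivAt.comp_hasDerivAt t
    (hasDerivAt_flow a s x t)

theorem hasDerivAt_flow_snd (a : ℤ → ℝ) (s : Finset ℤ) (x : Phase H) (j : ℤ) (t : ℝ) :
    HasDerivAt (fun t => (flow a s x t).2 j) (-couple a s (fun i => (flow a s x t).1 i) j) t := by
  rw [← generator_snd]
  exact (momCoord (H := H) j).hasFDerivAt.comp_hasDerivAt t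
    (hasDerivAt_flow a s x t)

theorem contDiff_flow (a : ℤ → ℝ) (s : Finset ℤ) (x : Phase H) (n : WithTop ℕ∞) :
    ContDiff ℝ n (flow a s x) := by
  have h1 : ContDiff ℝ n (fun t : ℝ => NormedSpace.exp (t • generator H a s)) :=
    (contDiff_iff_contDiffAt.2 fun A => (NormedSpace.exp_analytic (𝕂 := ℝ) A).contDiffAt).comp
      (contDiff_id.smul contDiff_const)
  exact (ContinuousLinearMap.apply ℝ (Phase H) x).contDiff.comp h1

theorem contDiff_flow_fst (a : ℤ → ℝ) (s : Finset ℤ) (x : Phase H) (j : ℤ) (n : WithTop ℕ∞) :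
    ContDiff ℝ n (fun t => (flow a s x t).1 j) :=
  (posCoord (H := H) j).contDiff.comp (contDiff_flow a s x n)

theorem contDiff_flow_snd (a : ℤ → ℝ) (s : Finset ℤ) (x : Phase H) (j : ℤ) (n : WithTop ℕ∞) :
    ContDiff ℝ n (fun t => (flow a s x t).2 j) :=
  (momCoord (H := H) j).contDiff.comp (contDiff_flow a s x n)

theorem hasSum_flow (a : ℤ → ℝ) (s : Finset ℤ) (x : Phase H) (t : ℝ) :
    HasSum (fun m : ℕ => ((m.factorial : ℝ)⁻¹ * t ^ m) • ((generator H a s) ^ m) x)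
      (flow a s x t) := by
  have h := NormedSpace.exp_series_hasSum_exp' (𝕂 := ℝ) (t • generator H a s)
  have := h.mapL (ContinuousLinearMap.apply ℝ (Phase H) x)
  simpa [flow, smul_pow, smul_smul] using this

end Generator

/-! ### Uniqueness for the infinite system in the class of bounded componentwise solutions. -/

section Uniqueness

variable {H : Type*} [NormedAddCommGroup H] [NormedSpace ℝ H]

theorem norm_couple_le (a : ℤ → ℝ) (s : Finset ℤ) {q : ℤ → H} {C : ℝ} (hq : ∀ j, ‖q j‖ ≤ C)
    (j : ℤ) : ‖couple a s q j‖ ≤ (∑ d ∈ s, |a d|) * C := by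
  rw [Finset.sum_mul]
  refine (norm_sum_le _ _).trans (Finset.sum_le_sum fun d _ => ?_)
  rw [norm_smul, Real.norm_eq_abs]
  exact mul_le_mul_of_nonneg_left (hq _) (abs_nonneg _)

theorem couple_add (a : ℤ → ℝ) (s : Finset ℤ) (q q' : ℤ → H) (j : ℤ) :
    couple a s (fun i => q i + q' i) j = couple a s q j + couple a s q' j := by
  simp [couple, smul_add, Finset.sum_add_distrib]

theorem couple_sub (a : ℤ → ℝ) (s : Finset ℤ) (q q' : ℤ → H) (j : ℤ) :
    couple a s (fun i => q i - q' i) j = couple a s q j - couple a s q' j := by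
  simp [couple, smul_sub, Finset.sum_sub_distrib]

/-- One step of the Picard iteration: integrating a bound of order `t ^ N / N!` raises the order by
one. -/
theorem norm_le_pow_of_hasDerivWithinAt {g g' : ℝ → H} {T A : ℝ} {N : ℕ} (h0 : g 0 = 0)
    (hg : ∀ t, 0 ≤ t → HasDerivWithinAt g (g' t) (Ici 0) t)
    (hb : ∀ t, 0 ≤ t → t ≤ T → ‖g' t‖ ≤ A * t ^ N / N.factorial) {t : ℝ} (ht : 0 ≤ t)
    (htT : t ≤ T) : ‖g t‖ ≤ A * t ^ (N + 1) / (N + 1).factorial := by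
  have key := image_norm_le_of_norm_deriv_right_le_deriv_boundary (a := 0) (b := T)
    (f := g) (f' := g') (B := fun t => A * t ^ (N + 1) / (N + 1).factorial)
    (B' := fun t => A * t ^ N / N.factorial)
    (fun x hx => (hg x hx.1).continuousWithinAt.mono Icc_subset_Ici_self)
    (fun x hx => (hg x hx.1).mono (Ici_subset_Ici.2 hx.1)) (by simp [h0])
    (fun x => by
      have := ((hasDerivAt_pow (N + 1) x).const_mul A).div_const ((N + 1).factorial : ℝ)
      refine this.congr_deriv ?_
      rw [Nat.factorial_succ]
      have : (N.factorial : ℝ) ≠ 0 := by positivity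
      have : (N : ℝ) + 1 ≠ 0 := by positivity
      push_cast [Nat.add_sub_cancel]
      field_simp)
    (fun x hx => hb x hx.1 hx.2.le)
  exact key ⟨ht, htT⟩

/-- A componentwise solution of the homogeneous system with zero initial data that is bounded,
locally uniformly in time and uniformly over the particles, vanishes. -/
theorem eq_zero_of_homogeneous (a : ℤ → ℝ) (s : Finset ℤ) {q p : ℤ → ℝ → H}
    (hq : ∀ j t, 0 ≤ t → HasDerivWithinAt (q j) (p j t) (Ici 0) t)
    (hp : ∀ j t, 0 ≤ t → HasDerivWithinAt (p j) (-couple a s (fun i => q i t) j) (Ici 0) t)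
    (hb : ∀ T, ∃ C, ∀ t, 0 ≤ t → t ≤ T → ∀ j, ‖q j t‖ ≤ C ∧ ‖p j t‖ ≤ C)
    (hq0 : ∀ j, q j 0 = 0) (hp0 : ∀ j, p j 0 = 0) {t : ℝ} (ht : 0 ≤ t) (j : ℤ) :
    q j t = 0 ∧ p j t = 0 := by
  obtain ⟨C, hC⟩ := hb t
  have hC0 : 0 ≤ C := (norm_nonneg _).trans (hC t ht le_rfl 0).1
  -- The summand `1` covers `q̇ = p` and the sum covers `ṗ = -Aq`, so one constant serves both
  -- equations in the induction.
  set K : ℝ := 1 + ∑ d ∈ s, |a d| with hK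
  have hs0 : 0 ≤ ∑ d ∈ s, |a d| := Finset.sum_nonneg fun _ _ => abs_nonneg _
  have hK1 : 1 ≤ K := by linarith
  have claim : ∀ N : ℕ, ∀ τ, 0 ≤ τ → τ ≤ t → ∀ j,
      ‖q j τ‖ ≤ C * K ^ N * τ ^ N / N.factorial ∧ ‖p j τ‖ ≤ C * K ^ N * τ ^ N / N.factorial := by
    intro N
    induction N with
    | zero => intro τ h0 h1 j; simpa using hC τ h0 h1 j
    | succ N ih =>
      intro τ h0 h1 j
      refine ⟨norm_le_pow_of_hasDerivWithinAt (hq0 j) (hq j) ?_ h0 h1,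
        norm_le_pow_of_hasDerivWithinAt (hp0 j) (hp j) ?_ h0 h1⟩
      · intro r hr0 hr1
        refine ((ih r hr0 hr1 j).2).trans ?_
        gcongr
        omega
      · intro r hr0 hr1
        rw [norm_neg]
        refine (norm_couple_le a s (fun i => (ih r hr0 hr1 i).1) j).trans ?_
        have : (∑ d ∈ s, |a d|) * (C * K ^ N * r ^ N / N.factorial)
            ≤ K * (C * K ^ N * r ^ N / N.factorial) := by
          gcongr; linarith
        refine this.trans (le_of_eq ?_)
        ring
  have hlim : Tendsto (fun N : ℕ => C * K ^ N * t ^ N / N.factorial) atTop (𝓝 0) := by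
    have := (FloorSemiring.tendsto_pow_div_factorial_atTop (K * t)).const_mul C
    rw [mul_zero] at this
    refine this.congr fun N => ?_
    rw [mul_pow]; ring
  constructor
  · exact norm_le_zero_iff.1 (ge_of_tendsto' hlim fun N => (claim N t ht le_rfl j).1)
  · exact norm_le_zero_iff.1 (ge_of_tendsto' hlim fun N => (claim N t ht le_rfl j).2)

theorem norm_flow_coord_le [CompleteSpace H] (a : ℤ → ℝ) (s : Finset ℤ) (x : Phase H) (T : ℝ) :
    ∃ C, ∀ t, 0 ≤ t → t ≤ T → ∀ j, ‖(flow a s x t).1 j‖ ≤ C ∧ ‖(flow a s x t).2 j‖ ≤ C := by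
  obtain ⟨C, hC⟩ := (isCompact_Icc (a := (0 : ℝ)) (b := T)).exists_bound_of_continuousOn
    (contDiff_flow a s x 0).continuous.continuousOn
  refine ⟨C, fun t h0 h1 j => ⟨?_, ?_⟩⟩
  · exact (lp.norm_apply_le_norm (by norm_num) _ j).trans
      ((norm_fst_le (flow a s x t)).trans (hC t ⟨h0, h1⟩))
  · exact (lp.norm_apply_le_norm (by norm_num) _ j).trans
      ((norm_snd_le (flow a s x t)).trans (hC t ⟨h0, h1⟩))

/-- A bounded componentwise solution of the homogeneous system with initial data in the phase
space is the motion given by the exponential of the generator. -/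
theorem eq_flow_of_homogeneous [CompleteSpace H] (a : ℤ → ℝ) (s : Finset ℤ) {q p : ℤ → ℝ → H}
    (hq : ∀ j t, 0 ≤ t → HasDerivWithinAt (q j) (p j t) (Ici 0) t)
    (hp : ∀ j t, 0 ≤ t → HasDerivWithinAt (p j) (-couple a s (fun i => q i t) j) (Ici 0) t)
    (hb : ∀ T, ∃ C, ∀ t, 0 ≤ t → t ≤ T → ∀ j, ‖q j t‖ ≤ C ∧ ‖p j t‖ ≤ C) (x : Phase H)
    (hq0 : ∀ j, q j 0 = x.1 j) (hp0 : ∀ j, p j 0 = x.2 j) {t : ℝ} (ht : 0 ≤ t) (j : ℤ) :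
    q j t = (flow a s x t).1 j ∧ p j t = (flow a s x t).2 j := by
  have := eq_zero_of_homogeneous a s (q := fun j t => q j t - (flow a s x t).1 j)
    (p := fun j t => p j t - (flow a s x t).2 j)
    (fun j t ht => (hq j t ht).sub (hasDerivAt_flow_fst a s x j t).hasDerivWithinAt)
    (fun j t ht => by
      rw [couple_sub, neg_sub, ← neg_sub_neg]
      exact (hp j t ht).sub (hasDerivAt_flow_snd a s x j t).hasDerivWithinAt)
    (fun T => by
      obtain ⟨C, hC⟩ := hb T
      obtain ⟨D, hD⟩ := norm_flow_coord_le a s x T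
      refine ⟨C + D, fun t h0 h1 j => ⟨?_, ?_⟩⟩
      · exact (norm_sub_le _ _).trans (add_le_add (hC t h0 h1 j).1 (hD t h0 h1 j).1)
      · exact (norm_sub_le _ _).trans (add_le_add (hC t h0 h1 j).2 (hD t h0 h1 j).2))
    (fun j => by simp [flow_zero, hq0]) (fun j => by simp [flow_zero, hp0]) ht j
  exact ⟨sub_eq_zero.1 this.1, sub_eq_zero.1 this.2⟩

end Uniqueness

/-! ### Mean-square calculus as calculus in `L²(P)`, and passage from `L²`-valued sequences to
paths. -/

section MeanSquare

variable {Ω : Type*} [MeasurableSpace Ω] {P : Measure Ω}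

/-- The class of a function in `L²(μ)`, zero if the function is not square integrable. -/
def toL2 {α E : Type*} [MeasurableSpace α] [NormedAddCommGroup E] (μ : Measure α) (X : α → E) :
    Lp E 2 μ :=
  open Classical in if h : MemLp X 2 μ then h.toLp X else 0

section ToL2

variable {α E : Type*} [MeasurableSpace α] [NormedAddCommGroup E] {μ : Measure α}

theorem coeFn_toL2 {X : α → E} (h : MemLp X 2 μ) : toL2 μ X =ᵐ[μ] X := by
  rw [toL2, dif_pos h]; exact h.coeFn_toLp

theorem toL2_congr {X Y : α → E} (hX : MemLp X 2 μ) (h : X =ᵐ[μ] Y) : toL2 μ X = toL2 μ Y := by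
  have hY : MemLp Y 2 μ := hX.ae_eq h
  exact Lp.ext ((coeFn_toL2 hX).trans (h.trans (coeFn_toL2 hY).symm))

theorem toL2_coeFn (U : Lp E 2 μ) : toL2 μ U = U :=
  Lp.ext (coeFn_toL2 (Lp.memLp U))

theorem toL2_sub {X Y : α → E} (hX : MemLp X 2 μ) (hY : MemLp Y 2 μ) :
    toL2 μ (fun x => X x - Y x) = toL2 μ X - toL2 μ Y := by
  refine Lp.ext ?_
  filter_upwards [coeFn_toL2 (hX.sub hY), coeFn_toL2 hX, coeFn_toL2 hY,
    Lp.coeFn_sub (toL2 μ X) (toL2 μ Y)] with x h1 h2 h3 h4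
  rw [h4, Pi.sub_apply, h2, h3]
  exact h1

theorem toL2_const_smul [NormedSpace ℝ E] {X : α → E} (hX : MemLp X 2 μ) (c : ℝ) :
    toL2 μ (fun x => c • X x) = c • toL2 μ X := by
  refine Lp.ext ?_
  filter_upwards [coeFn_toL2 (hX.const_smul c), coeFn_toL2 hX,
    Lp.coeFn_smul c (toL2 μ X)] with x h1 h2 h3
  rw [h3, Pi.smul_apply, h2]
  exact h1

end ToL2

theorem norm_toL2_sq {X : Ω → ℝ} (h : MemLp X 2 P) : ‖toL2 P X‖ ^ 2 = ∫ w, X w ^ 2 ∂P := by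
  rw [← real_inner_self_eq_norm_sq, L2.inner_def]
  refine integral_congr_ae ?_
  filter_upwards [coeFn_toL2 h] with w hw
  simp [hw, sq]

theorem integral_coeFn_sq (U : Lp ℝ 2 P) :
    ∫ w, U w ^ 2 ∂P = ‖U‖ ^ 2 := by
  rw [← norm_toL2_sq (Lp.memLp U), toL2_coeFn]

theorem norm_toL2_const [IsProbabilityMeasure P]
    (c : ℝ) : ‖toL2 P fun _ => c‖ ^ 2 = ‖c‖ ^ 2 := by
  rw [norm_toL2_sq (memLp_const c)]
  simp

theorem enorm_eq_eLpNorm {X : Ω → ℝ} {U : Lp ℝ 2 P} (h : U =ᵐ[P] X) :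
    ‖U‖ₑ = eLpNorm X 2 P := by
  rw [Lp.enorm_def, eLpNorm_congr_ae h]

theorem HasContMSDeriv.hasDerivWithinAt {X X' : ℝ → Ω → ℝ} (h : HasContMSDeriv P X X') {t : ℝ}
    (ht : 0 ≤ t) :
    HasDerivWithinAt (fun t => toL2 P (X t)) (toL2 P (X' t)) (Ici 0) t := by
  rw [hasDerivWithinAt_iff_tendsto_slope, tendsto_iff_norm_sub_tendsto_zero]
  have h1 := h.hasDeriv t ht
  have h2 := (ENNReal.tendsto_toReal ENNReal.zero_ne_top).comp h1
  refine h2.congr' ?_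
  filter_upwards [self_mem_nhdsWithin] with s hs
  have hs0 : 0 ≤ s := hs.1
  simp only [Function.comp_apply]
  rw [← enorm_eq_eLpNorm (U := slope (fun t => toL2 P (X t)) t s - toL2 P (X' t)), toReal_enorm]
  · rw [slope_def_module]
    filter_upwards [Lp.coeFn_sub ((s - t)⁻¹ • (toL2 P (X s) - toL2 P (X t))) (toL2 P (X' t)),
      Lp.coeFn_smul (s - t)⁻¹ (toL2 P (X s) - toL2 P (X t)),
      Lp.coeFn_sub (toL2 P (X s)) (toL2 P (X t)), coeFn_toL2 (h.memLp s hs0),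
      coeFn_toL2 (h.memLp t ht), coeFn_toL2 (h.memLp' t ht)] with w h1 h2 h3 h4 h5 h6
    rw [h1, Pi.sub_apply, h2, Pi.smul_apply, h3, Pi.sub_apply, h4, h5, h6, smul_eq_mul]
    ring

theorem hasContMSDeriv_of_hasDerivWithinAt {U U' : ℝ → Lp ℝ 2 P}
    (h : ∀ t, 0 ≤ t → HasDerivWithinAt U (U' t) (Ici 0) t) (hc : ContinuousOn U' (Ici 0)) :
    HasContMSDeriv P (fun t => U t) (fun t => U' t) where
  memLp t _ := Lp.memLp _
  memLp' t _ := Lp.memLp _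
  hasDeriv t ht := by
    have h1 := hasDerivWithinAt_iff_tendsto_slope.1 (h t ht)
    have h2 := tendsto_iff_edist_tendsto_0.1 h1
    refine h2.congr fun s => ?_
    rw [edist_eq_enorm_sub]
    refine enorm_eq_eLpNorm ?_
    rw [slope_def_module]
    filter_upwards [Lp.coeFn_sub ((s - t)⁻¹ • (U s - U t)) (U' t),
      Lp.coeFn_smul (s - t)⁻¹ (U s - U t), Lp.coeFn_sub (U s) (U t)] with w h1 h2 h3
    rw [h1, Pi.sub_apply, h2, Pi.smul_apply, h3, Pi.sub_apply, smul_eq_mul]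
    ring
  continuous' t ht := by
    have h2 := tendsto_iff_edist_tendsto_0.1 (hc t ht)
    refine h2.congr fun s => ?_
    rw [edist_eq_enorm_sub]
    exact enorm_eq_eLpNorm (Lp.coeFn_sub _ _)

theorem coeFn_couple (a : ℤ → ℝ) (s : Finset ℤ) (U : ℤ → Lp ℝ 2 P) (j : ℤ) :
    ((couple a s U j : Lp ℝ 2 P) : Ω → ℝ) =ᵐ[P] fun w => couple a s (fun i => U i w) j := by
  have h1 := Lp.coeFn_finsetSum s (fun d => a d • U (j + d))
  have h2 : ∀ᵐ w ∂P, ∀ d : ℤ, (a d • U (j + d) : Lp ℝ 2 P) w = a d * U (j + d) w := by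
    rw [ae_all_iff]
    intro d
    filter_upwards [Lp.coeFn_smul (a d) (U (j + d))] with w hw
    rw [hw]; rfl
  filter_upwards [h1, h2] with w h1 h2
  rw [couple, h1, couple, Finset.sum_apply]
  exact Finset.sum_congr rfl fun d _ => h2 d

theorem tsum_eq_couple {a : ℤ → ℝ} {s : Finset ℤ} (hs : ∀ k, k ∉ s → a k = 0) (q : ℤ → ℝ)
    (j : ℤ) : ∑' k : ℤ, a (k - j) * q k = couple a s q j := by
  rw [← (Equiv.addLeft j).tsum_eq, tsum_eq_sum (s := s)]
  · simp [couple]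
  · intro d hd; simp [hs d hd]

theorem memℓp_two_iff {H : Type*} [NormedAddCommGroup H] {q : ℤ → H} :
    Memℓp q 2 ↔ Summable fun j => ‖q j‖ ^ 2 := by
  rw [memℓp_gen_iff (by norm_num)]
  simp

theorem summable_norm_sq (x : lp (fun _ : ℤ => Lp ℝ 2 P) 2) : Summable fun j => ‖x j‖ ^ 2 :=
  memℓp_two_iff.1 (lp.memℓp x)

/-- By Tonelli the expectation of `∑ |U_j|²` is `∑ ‖U_j‖²`, so the random sum is almost surely
finite. -/
theorem ae_memℓp {U : ℤ → Lp ℝ 2 P} (hU : Summable fun j => ‖U j‖ ^ 2) :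
    ∀ᵐ w ∂P, Memℓp (fun j => (U j : Ω → ℝ) w) 2 := by
  have h1 : ∫⁻ w, ∑' j, ‖(U j : Ω → ℝ) w‖ₑ ^ 2 ∂P ≠ ⊤ := by
    rw [lintegral_tsum fun j => ((Lp.aestronglyMeasurable (U j)).enorm.pow_const 2)]
    have : ∀ j, ∫⁻ w, ‖(U j : Ω → ℝ) w‖ₑ ^ 2 ∂P = ENNReal.ofReal (‖U j‖ ^ 2) := by
      intro j
      have := eLpNorm_nnreal_pow_eq_lintegral (f := (U j : Ω → ℝ)) (μ := P) (p := 2) (by norm_num)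
      rw [ENNReal.ofReal_pow (norm_nonneg _), ofReal_norm, Lp.enorm_def]
      simpa using this.symm
    simp_rw [this]
    exact hU.tsum_ofReal_ne_top
  have h2 := ae_lt_top' (AEMeasurable.tsum fun j =>
    ((Lp.aestronglyMeasurable (U j)).enorm.pow_const 2)) h1
  filter_upwards [h2] with w hw
  rw [memℓp_two_iff]
  have := ENNReal.summable_toReal hw.ne
  simpa using this

/-- Both modes of convergence imply convergence in measure, whose limit is unique up to null sets.
-/
theorem aestronglyMeasurable_eq_of_tendsto {S : ℕ → Lp ℝ 2 P} {U : Lp ℝ 2 P}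
    (h : Tendsto S atTop (𝓝 U)) {y : Ω → ℝ} [IsFiniteMeasure P]
    (hy : ∀ᵐ w ∂P, Tendsto (fun N => S N w) atTop (𝓝 (y w))) : U =ᵐ[P] y := by
  have h1 : TendstoInMeasure P (fun N => (S N : Ω → ℝ)) atTop U := tendstoInMeasure_of_tendsto_Lp h
  have h2 : TendstoInMeasure P (fun N => (S N : Ω → ℝ)) atTop y :=
    tendstoInMeasure_of_tendsto_ae (fun N => Lp.aestronglyMeasurable _) hy
  exact tendstoInMeasure_ae_unique h1 h2

/-- The value at `w` of a vector with square summable `L²`-entries. -/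
def pathPoint (x : lp (fun _ : ℤ => Lp ℝ 2 P) 2) (w : Ω) : lp (fun _ : ℤ => ℝ) 2 :=
  open Classical in
  if h : Memℓp (fun j => (x j : Ω → ℝ) w) 2 then ⟨fun j => (x j : Ω → ℝ) w, h⟩ else 0

theorem ae_pathPoint (x : lp (fun _ : ℤ => Lp ℝ 2 P) 2) :
    ∀ᵐ w ∂P, ∀ j, pathPoint x w j = (x j : Ω → ℝ) w := by
  filter_upwards [ae_memℓp (summable_norm_sq x)] with w hw j
  rw [pathPoint, dif_pos hw]

/-- The generator forms finite sums of entries, which may be evaluated at `w` off a null set; there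
are only countably many entries, so one null set suffices for each power. -/
theorem ae_generator_pow (a : ℤ → ℝ) (s : Finset ℤ) (x : Phase (Lp ℝ 2 P)) (m : ℕ) :
    ∀ᵐ w ∂P, ∀ j,
      ((generator (Lp ℝ 2 P) a s ^ m) x).1 j w
        = ((generator ℝ a s ^ m) (pathPoint x.1 w, pathPoint x.2 w)).1 j ∧
      ((generator (Lp ℝ 2 P) a s ^ m) x).2 j w
        = ((generator ℝ a s ^ m) (pathPoint x.1 w, pathPoint x.2 w)).2 j := by
  induction m with
  | zero =>
    filter_upwards [ae_pathPoint x.1, ae_pathPoint x.2] with w h1 h2 j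
    exact ⟨(h1 j).symm, (h2 j).symm⟩
  | succ m ih =>
    have hc : ∀ᵐ w ∂P, ∀ j, (couple a s (fun i => ((generator (Lp ℝ 2 P) a s ^ m) x).1 i) j) w
        = couple a s (fun i => (((generator (Lp ℝ 2 P) a s ^ m) x).1 i : Ω → ℝ) w) j :=
      ae_all_iff.2 fun j => coeFn_couple a s _ j
    have hn : ∀ᵐ w ∂P, ∀ j,
        (-(couple a s (fun i => ((generator (Lp ℝ 2 P) a s ^ m) x).1 i) j) : Lp ℝ 2 P) w = - (couple a s (fun i => ((generator (Lp ℝ 2 P) a s ^ m) x).1 i) j) w :=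
      ae_all_iff.2 fun j => Lp.coeFn_neg _
    filter_upwards [ih, hc, hn] with w ih hc hn j
    rw [pow_succ', pow_succ', mul_apply_eq_comp, mul_apply_eq_comp,
      generator_fst, generator_fst]
    refine ⟨(ih j).2, ?_⟩
    have e1 := generator_snd a s ((generator (Lp ℝ 2 P) a s ^ m) x) j
    have e2 := generator_snd a s ((generator ℝ a s ^ m) (pathPoint x.1 w, pathPoint x.2 w)) j
    rw [e1, e2, hn j, hc j]
    congr 2
    exact funext fun i => (ih i).1

/-- The motion in `ℓ²(ℤ; L²(P))²` is given, path by path, by the motion in `ℓ²(ℤ)²`. -/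
theorem ae_flow_eq [IsFiniteMeasure P] (a : ℤ → ℝ) (s : Finset ℤ) (x : Phase (Lp ℝ 2 P)) (t : ℝ)
    (j : ℤ) :
    (∀ᵐ w ∂P, (flow a s x t).1 j w
      = (flow a s (pathPoint x.1 w, pathPoint x.2 w) t).1 j) ∧
    ∀ᵐ w ∂P, (flow a s x t).2 j w
      = (flow a s (pathPoint x.1 w, pathPoint x.2 w) t).2 j := by
  have key : ∀ (c : Phase (Lp ℝ 2 P) →L[ℝ] Lp ℝ 2 P) (c' : Phase ℝ →L[ℝ] ℝ),
      (∀ m : ℕ, ∀ᵐ w ∂P, c ((generator (Lp ℝ 2 P) a s ^ m) x) w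
        = c' ((generator ℝ a s ^ m) (pathPoint x.1 w, pathPoint x.2 w))) →
      ∀ᵐ w ∂P, c (flow a s x t) w
        = c' (flow a s (pathPoint x.1 w, pathPoint x.2 w) t) := by
    intro c c' h
    -- The partial sums of the exponential series converge in `L²(P)` to the left side and, for
    -- almost every `w`, to the right side.
    refine aestronglyMeasurable_eq_of_tendsto
      ((hasSum_flow a s x t).mapL c).tendsto_sum_nat ?_
    have h1 : ∀ᵐ w ∂P, ∀ m : ℕ,
        c (((m.factorial : ℝ)⁻¹ * t ^ m) • (generator (Lp ℝ 2 P) a s ^ m) x) w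
        = c' (((m.factorial : ℝ)⁻¹ * t ^ m) •
            (generator ℝ a s ^ m) (pathPoint x.1 w, pathPoint x.2 w)) := by
      rw [ae_all_iff]
      intro m
      filter_upwards [h m, Lp.coeFn_smul ((m.factorial : ℝ)⁻¹ * t ^ m)
        (c ((generator (Lp ℝ 2 P) a s ^ m) x))] with w h1 h2
      rw [map_smul, h2, Pi.smul_apply, h1, map_smul]
    have h2 : ∀ᵐ w ∂P, ∀ N : ℕ, (∑ m ∈ Finset.range N,
        c (((m.factorial : ℝ)⁻¹ * t ^ m) • (generator (Lp ℝ 2 P) a s ^ m) x) : Lp ℝ 2 P) w =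
        ∑ m ∈ Finset.range N,
          (c (((m.factorial : ℝ)⁻¹ * t ^ m) • (generator (Lp ℝ 2 P) a s ^ m) x) : Lp ℝ 2 P) w := by
      rw [ae_all_iff]
      intro N
      filter_upwards [Lp.coeFn_finsetSum (Finset.range N)
        (fun m => c (((m.factorial : ℝ)⁻¹ * t ^ m) • (generator (Lp ℝ 2 P) a s ^ m) x))] with w hw
      rw [hw, Finset.sum_apply]
    filter_upwards [h1, h2] with w h1 h2
    refine (((hasSum_flow a s (pathPoint x.1 w, pathPoint x.2 w) t).mapL c').tendsto_sum_nat).congr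
      fun N => ?_
    rw [h2]
    exact Finset.sum_congr rfl fun m _ => (h1 m).symm
  constructor
  · refine key (posCoord j) (posCoord j) fun m => ?_
    filter_upwards [ae_generator_pow a s x m] with w hw
    exact (hw j).1
  · refine key (momCoord j) (momCoord j) fun m => ?_
    filter_upwards [ae_generator_pow a s x m] with w hw
    exact (hw j).2

end MeanSquare

/-! ### The spectral function `ω²` and lattice kernels of functions of the coupling operator. -/

section SpectralFunction

variable {a : ℤ → ℝ} {s : Finset ℤ}

theorem omegaSq_eq_sum (hs : ∀ k, k ∉ s → a k = 0) (l : ℝ) :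
    omegaSq a l = ∑ d ∈ s, a d * Real.cos (d * l) := by
  rw [omegaSq, tsum_eq_sum (s := s) fun k hk => by simp [hs k hk], Complex.re_sum]
  refine Finset.sum_congr rfl fun d _ => ?_
  have : Complex.I * (d : ℂ) * (l : ℂ) = ((d * l : ℝ) : ℂ) * Complex.I := by push_cast; ring
  rw [this, Complex.re_ofReal_mul, Complex.exp_ofReal_mul_I_re]

/-- The sum changes sign under `d ↦ -d`; it is the imaginary part of the Fourier series of the
symmetric `a`. -/
theorem sum_mul_sin_eq_zero (hsymm : ∀ k, a (-k) = a k) (hs : ∀ k, k ∉ s → a k = 0) (l : ℝ) :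
    ∑ d ∈ s, a d * Real.sin (d * l) = 0 := by
  have h1 : ∑' d : ℤ, a d * Real.sin (d * l) = ∑ d ∈ s, a d * Real.sin (d * l) :=
    tsum_eq_sum fun k hk => by simp [hs k hk]
  have h2 : ∑' d : ℤ, a d * Real.sin (d * l) = -∑' d : ℤ, a d * Real.sin (d * l) := by
    conv_lhs => rw [← (Equiv.neg ℤ).tsum_eq]
    rw [← tsum_neg]
    congr 1
    ext d
    simp [hsymm, Real.sin_neg]
  rw [← h1]; linarith

theorem contDiff_omegaSq (hs : ∀ k, k ∉ s → a k = 0) {n : WithTop ℕ∞} :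
    ContDiff ℝ n (omegaSq a) := by
  have : omegaSq a = fun l => ∑ d ∈ s, a d * Real.cos (d * l) := funext (omegaSq_eq_sum hs)
  rw [this]
  exact ContDiff.sum fun d _ => contDiff_const.mul (Real.contDiff_cos.comp
    (contDiff_const.mul contDiff_id))

theorem continuous_omegaSq (hs : ∀ k, k ∉ s → a k = 0) : Continuous (omegaSq a) :=
  (contDiff_omegaSq hs (n := 0)).continuous

theorem omegaSq_periodic (hs : ∀ k, k ∉ s → a k = 0) :
    Function.Periodic (omegaSq a) (2 * Real.pi) := by
  intro l
  rw [omegaSq_eq_sum hs, omegaSq_eq_sum hs]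
  refine Finset.sum_congr rfl fun d _ => ?_
  rw [mul_add, Real.cos_add_int_mul_two_pi]

theorem isCompact_range_omegaSq (hs : ∀ k, k ∉ s → a k = 0) :
    IsCompact (range (omegaSq a)) :=
  (omegaSq_periodic hs).compact_of_continuous Real.two_pi_pos.ne' (continuous_omegaSq hs)

theorem range_omegaSq_eq_Icc (hs : ∀ k, k ∉ s → a k = 0) (hpos : ∀ l, 0 < omegaSq a l) :
    ∃ m M : ℝ, 0 < m ∧ m ≤ M ∧ range (omegaSq a) = Icc m M := by
  obtain ⟨m, hm⟩ := (isCompact_range_omegaSq hs).exists_isLeast (range_nonempty _)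
  obtain ⟨M, hM⟩ := (isCompact_range_omegaSq hs).exists_isGreatest (range_nonempty _)
  refine ⟨m, M, ?_, hm.2 hM.1, ?_⟩
  · obtain ⟨l, hl⟩ := hm.1
    rw [← hl]; exact hpos l
  · refine Subset.antisymm (fun x hx => ⟨hm.2 hx, hM.2 hx⟩) ?_
    exact (isPreconnected_range (continuous_omegaSq hs)).Icc_subset hm.1 hM.1

variable (a) in
/-- The lattice kernel `(2π)⁻¹ ∫₀^{2π} cos(kλ) φ(ω²(λ)) dλ` of the function `φ` of the coupling
operator. -/
def funKernel (φ : ℝ → ℝ) (k : ℤ) : ℝ :=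
  (2 * Real.pi)⁻¹ * ∫ l in (0)..(2 * Real.pi), Real.cos (k * l) * φ (omegaSq a l)

theorem continuous_cos_int (k : ℤ) : Continuous fun l : ℝ => Real.cos (k * l) := by fun_prop

theorem funKernel_congr {φ ψ : ℝ → ℝ} (h : ∀ l, φ (omegaSq a l) = ψ (omegaSq a l)) :
    funKernel a φ = funKernel a ψ := by
  funext k; simp only [funKernel, h]

theorem funKernel_add {φ ψ : ℝ → ℝ} (hφ : Continuous fun l => φ (omegaSq a l))
    (hψ : Continuous fun l => ψ (omegaSq a l)) (k : ℤ) :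
    funKernel a (fun w => φ w + ψ w) k = funKernel a φ k + funKernel a ψ k := by
  simp only [funKernel, mul_add]
  rw [intervalIntegral.integral_add, mul_add]
  · exact ((continuous_cos_int k).mul hφ).intervalIntegrable _ _
  · exact ((continuous_cos_int k).mul hψ).intervalIntegrable _ _

theorem funKernel_const_mul (c : ℝ) (φ : ℝ → ℝ) (k : ℤ) :
    funKernel a (fun w => c * φ w) k = c * funKernel a φ k := by
  simp only [funKernel, mul_left_comm _ c, intervalIntegral.integral_const_mul]

/-- In Fourier variables the coupling operator is multiplication by `ω²`. The addition formula for
the cosine leaves a sine sum, which vanishes by symmetry of `a`. -/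
theorem funKernel_id_mul (hsymm : ∀ k, a (-k) = a k) (hs : ∀ k, k ∉ s → a k = 0) {φ : ℝ → ℝ}
    (hφ : Continuous fun l => φ (omegaSq a l)) (k : ℤ) :
    funKernel a (fun w => w * φ w) k = couple a s (funKernel a φ) k := by
  have key : ∀ l : ℝ, Real.cos (k * l) * (omegaSq a l * φ (omegaSq a l))
      = ∑ d ∈ s, a d * (Real.cos ((k + d : ℤ) * l) * φ (omegaSq a l)) := by
    intro l
    have h1 := omegaSq_eq_sum hs l
    have h2 := sum_mul_sin_eq_zero hsymm hs l
    calc Real.cos (k * l) * (omegaSq a l * φ (omegaSq a l))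
        = (Real.cos (k * l) * (∑ d ∈ s, a d * Real.cos (d * l))
          - Real.sin (k * l) * ∑ d ∈ s, a d * Real.sin (d * l)) * φ (omegaSq a l) := by
          rw [h2, ← h1]; ring
      _ = _ := by
          rw [Finset.mul_sum, Finset.mul_sum, ← Finset.sum_sub_distrib, Finset.sum_mul]
          refine Finset.sum_congr rfl fun d _ => ?_
          rw [Int.cast_add, add_mul, Real.cos_add]; ring
  simp only [funKernel, key]
  rw [intervalIntegral.integral_finsetSum, Finset.mul_sum, couple]
  · refine Finset.sum_congr rfl fun d _ => ?_
    rw [intervalIntegral.integral_const_mul, smul_eq_mul, funKernel]; ring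
  · intro d _
    exact (continuous_const.mul ((continuous_cos_int _).mul hφ)).intervalIntegrable _ _

theorem integral_cos_int (k : ℤ) :
    ∫ l in (0)..(2 * Real.pi), Real.cos (k * l) = if k = 0 then 2 * Real.pi else 0 := by
  split_ifs with h
  · simp [h]
  · have hk : (k : ℝ) ≠ 0 := by exact_mod_cast h
    rw [intervalIntegral.integral_comp_mul_left (fun x => Real.cos x) hk, integral_cos]
    have : Real.sin (k * (2 * Real.pi)) = 0 := by
      have := Real.sin_int_mul_pi (2 * k)
      rw [← this]; push_cast; ring_nf
    simp [this]

theorem funKernel_const (c : ℝ) (k : ℤ) :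
    funKernel a (fun _ => c) k = if k = 0 then c else 0 := by
  rw [funKernel, intervalIntegral.integral_mul_const, integral_cos_int]
  have := Real.two_pi_pos.ne'
  split_ifs
  · field_simp
  · simp

theorem abs_funKernel_le {φ : ℝ → ℝ} {B : ℝ} (hB : ∀ l, |φ (omegaSq a l)| ≤ B) (k : ℤ) :
    |funKernel a φ k| ≤ B := by
  have h := intervalIntegral.norm_integral_le_of_norm_le_const (a := 0) (b := 2 * Real.pi)
    (f := fun l => Real.cos (k * l) * φ (omegaSq a l)) (C := B) (fun l _ => by
      rw [norm_mul, Real.norm_eq_abs, Real.norm_eq_abs]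
      calc |Real.cos (k * l)| * |φ (omegaSq a l)| ≤ 1 * |φ (omegaSq a l)| := by
            gcongr; exact Real.abs_cos_le_one _
        _ ≤ B := by rw [one_mul]; exact hB l)
  rw [funKernel, abs_mul, abs_of_pos (by positivity), ← Real.norm_eq_abs]
  rw [sub_zero, abs_of_pos Real.two_pi_pos] at h
  calc _ ≤ (2 * Real.pi)⁻¹ * (B * (2 * Real.pi)) := by gcongr
    _ = B := by field_simp

/-- Finite range: `(ω² - c) ^ N` is a trigonometric polynomial of degree at most `K * N`, since each
factor enlarges the range by at most `K`. -/
theorem funKernel_sub_pow_eq_zero (hsymm : ∀ k, a (-k) = a k) (hs : ∀ k, k ∉ s → a k = 0)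
    {K : ℕ} (hK : ∀ d ∈ s, |d| ≤ (K : ℤ)) (c : ℝ) (N : ℕ) {k : ℤ} (hk : (K * N : ℤ) < |k|) :
    funKernel a (fun w => (w - c) ^ N) k = 0 := by
  have hW := continuous_omegaSq hs
  induction N generalizing k with
  | zero =>
    simp only [pow_zero]
    rw [funKernel_const, if_neg]
    rintro rfl
    simp at hk
  | succ N ih =>
    have h1 : (fun w : ℝ => (w - c) ^ (N + 1))
        = fun w => w * (w - c) ^ N + (-c) * (w - c) ^ N := by ext w; ring
    rw [h1, funKernel_add (φ := fun w => w * (w - c) ^ N) (ψ := fun w => (-c) * (w - c) ^ N)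
      (by fun_prop) (by fun_prop), funKernel_const_mul,
      funKernel_id_mul hsymm hs (φ := fun w => (w - c) ^ N) (by fun_prop)]
    push_cast at hk
    have hK0 : (0 : ℤ) ≤ K := by positivity
    rw [ih (by nlinarith), mul_zero, add_zero, couple]
    refine Finset.sum_eq_zero fun d hd => ?_
    have := hK d hd
    have h2 : |k| ≤ |k + d| + |d| := by
      have := abs_sub (k + d) d
      simpa using this
    rw [ih (by nlinarith), smul_zero]

/-- The kernel is the real part of the Fourier coefficients of `l ↦ φ (ω²(l))`, so Parseval applies.
The bound sees only the supremum of `φ`, which later makes it uniform in time. -/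
theorem hasSum_sq_funKernel_le {φ : ℝ → ℝ} (hφ : Continuous fun l => φ (omegaSq a l)) {B : ℝ}
    (hB : ∀ l, |φ (omegaSq a l)| ≤ B) (F : Finset ℤ) :
    ∑ k ∈ F, funKernel a φ k ^ 2 ≤ B ^ 2 := by
  set f : ℝ → ℂ := fun l => ((φ (omegaSq a l) : ℝ) : ℂ) with hf
  have hfc : Continuous f := Complex.continuous_ofReal.comp hφ
  have hL2 : MemLp f 2 (volume.restrict (Ioc 0 (2 * Real.pi))) :=
    MemLp.of_bound hfc.aestronglyMeasurable B (Eventually.of_forall fun l => by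
      rw [hf]; simpa using hB l)
  have hsum := hasSum_sq_fourierCoeffOn Real.two_pi_pos hL2
  have hle : ∀ k, funKernel a φ k ^ 2 ≤ ‖fourierCoeffOn Real.two_pi_pos f k‖ ^ 2 := by
    intro k
    have hre : (fourierCoeffOn Real.two_pi_pos f k).re = funKernel a φ k := by
      rw [fourierCoeffOn_eq_integral, funKernel, Complex.smul_re, sub_zero, one_div, smul_eq_mul]
      congr 1
      have hI : IntervalIntegrable (fun x : ℝ => fourier (-k) (x : AddCircle (2 * Real.pi)) • f x)
          volume 0 (2 * Real.pi) := by
        refine Continuous.intervalIntegrable ?_ _ _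
        exact (((fourier (-k)).continuous.comp (AddCircle.continuous_mk' _))).smul hfc
      have := Complex.reCLM.intervalIntegral_comp_comm hI
      rw [sub_zero] at *
      rw [← Complex.reCLM_apply, ← this]
      refine intervalIntegral.integral_congr fun l _ => ?_
      simp only [Complex.reCLM_apply, smul_eq_mul, hf, Complex.re_mul_ofReal]
      congr 1
      rw [fourier_coe_apply]
      have : 2 * (Real.pi : ℂ) * Complex.I * ((-k : ℤ) : ℂ) * (l : ℂ) / ((2 * Real.pi : ℝ) : ℂ)
          = ((-(k * l) : ℝ) : ℂ) * Complex.I := by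
        have : (Real.pi : ℂ) ≠ 0 := by exact_mod_cast Real.pi_ne_zero
        push_cast; field_simp
      rw [this, Complex.exp_ofReal_mul_I_re, Real.cos_neg]
    rw [← hre]
    have := Complex.abs_re_le_norm (fourierCoeffOn Real.two_pi_pos f k)
    rw [← sq_abs]
    gcongr
  refine (Finset.sum_le_sum fun k _ => hle k).trans ?_
  refine (sum_le_hasSum F (fun _ _ => by positivity) hsum).trans ?_
  rw [sub_zero, smul_eq_mul]
  have h := intervalIntegral.norm_integral_le_of_norm_le_const (a := 0) (b := 2 * Real.pi)
    (f := fun l => ‖f l‖ ^ 2) (C := B ^ 2) (fun l _ => by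
      rw [norm_pow, norm_norm]
      gcongr
      rw [hf]; simpa using hB l)
  rw [sub_zero, abs_of_pos Real.two_pi_pos] at h
  calc _ ≤ (2 * Real.pi)⁻¹ * (B ^ 2 * (2 * Real.pi)) := by
        gcongr; exact (Real.le_norm_self _).trans h
    _ = B ^ 2 := by field_simp

/-- Differentiation under the integral sign. Regularity is asked only for `w > 0`, which contains
the range of `ω²`, because the kernels of the flow involve `√w` and its inverse. -/
theorem hasDerivAt_funKernel {φ φ' : ℝ → ℝ → ℝ} (hs : ∀ k, k ∉ s → a k = 0)
    (hpos : ∀ l, 0 < omegaSq a l)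
    (hd : ∀ t w, 0 < w → HasDerivAt (fun t => φ t w) (φ' t w) t)
    (hc : ∀ t, ContinuousOn (φ t) (Ioi 0)) (hc' : ∀ t, ContinuousOn (φ' t) (Ioi 0))
    {B : ℝ} (hB : ∀ t l, |φ' t (omegaSq a l)| ≤ B) (k : ℤ) (t : ℝ) :
    HasDerivAt (fun t => funKernel a (φ t) k) (funKernel a (φ' t) k) t := by
  have hcont : ∀ f : ℝ → ℝ, ContinuousOn f (Ioi 0) →
      Continuous fun l => Real.cos (k * l) * f (omegaSq a l) := fun f hf =>
    (continuous_cos_int k).mul (hf.comp_continuous (continuous_omegaSq hs) hpos)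
  refine HasDerivAt.const_mul _ ?_
  refine (intervalIntegral.hasDerivAt_integral_of_dominated_loc_of_deriv_le
    (F := fun t l => Real.cos (k * l) * φ t (omegaSq a l))
    (F' := fun t l => Real.cos (k * l) * φ' t (omegaSq a l)) (s := univ) (bound := fun _ => B)
    univ_mem (Eventually.of_forall fun t => (hcont _ (hc t)).aestronglyMeasurable)
    ((hcont _ (hc t)).intervalIntegrable _ _) (hcont _ (hc' t)).aestronglyMeasurable
    (Eventually.of_forall fun l _ t _ => ?_) intervalIntegrable_const
    (Eventually.of_forall fun l _ t _ => (hd t _ (hpos l)).const_mul _)).2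
  rw [norm_mul, Real.norm_eq_abs, Real.norm_eq_abs]
  calc |Real.cos (k * l)| * |φ' t (omegaSq a l)| ≤ 1 * |φ' t (omegaSq a l)| := by
        gcongr; exact Real.abs_cos_le_one _
    _ ≤ B := by rw [one_mul]; exact hB t l

/-- The derivative of a trigonometric polynomial is analytic, so it either vanishes identically or
has a null zero set. In the first case `ω²` is constant, against `a k ≠ 0` for some `k ≠ 0`. -/
theorem ae_deriv_omegaSq_ne_zero (hsymm : ∀ k, a (-k) = a k) (hs : ∀ k, k ∉ s → a k = 0)
    (hne : ∃ k : ℤ, k ≠ 0 ∧ a k ≠ 0) : ∀ᵐ l : ℝ, deriv (omegaSq a) l ≠ 0 := by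
  have han : AnalyticOnNhd ℝ (deriv (omegaSq a)) univ :=
    AnalyticOnNhd.deriv ((contDiff_omegaSq hs (n := ⊤)).analyticOnNhd)
  rcases han.eqOn_zero_or_eventually_ne_zero_of_preconnected isPreconnected_univ with h | h
  · exfalso
    obtain ⟨k, hk, hak⟩ := hne
    have hconst : ∀ l, omegaSq a l = omegaSq a 0 := fun l =>
      is_const_of_deriv_eq_zero ((contDiff_omegaSq hs (n := 1)).differentiable (by norm_num))
        (fun x => h (mem_univ x)) l 0
    -- With `φ = 1` this reads off the Fourier coefficient of `ω²` at `k` as `a(-k)`; for a constant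
    -- `ω²` and `k ≠ 0` it is zero.
    have h1 := funKernel_id_mul hsymm hs (φ := fun _ => 1) (by fun_prop) k
    rw [funKernel_congr (ψ := fun _ => omegaSq a 0) (fun l => by rw [mul_one]; exact hconst l),
      funKernel_const, if_neg hk, couple] at h1
    have h2 : ∀ d ∈ s, a d • funKernel a (fun _ => 1) (k + d) = if d = -k then a d else 0 := by
      intro d _
      rw [funKernel_const, smul_eq_mul]
      by_cases hd : d = -k
      · simp [hd]
      · rw [if_neg hd, if_neg (by omega), mul_zero]
    rw [Finset.sum_congr rfl h2, Finset.sum_ite_eq'] at h1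
    split_ifs at h1 with hm
    · exact hak (by rw [← hsymm]; exact h1.symm)
    · exact hak (by rw [← hsymm]; exact hs _ hm)
  · have := ae_restrict_le_codiscreteWithin (μ := (volume : Measure ℝ)) MeasurableSet.univ h
    rwa [Measure.restrict_univ] at this

end SpectralFunction

/-! ### Oscillatory integrals with almost nowhere stationary phase. -/

section Oscillation

/-- A Riemann–Lebesgue lemma: an oscillatory integral with a phase that is almost nowhere
stationary tends to zero. -/
theorem tendsto_integral_oscillating {g ω θ Θ : ℝ → ℝ} {b : ℝ} (hb : 0 ≤ b) (hg : ContDiff ℝ 1 g)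
    (hω : ContDiff ℝ 2 ω) (hne : ∀ᵐ l : ℝ, deriv ω l ≠ 0) (hΘ : ∀ x, HasDerivAt Θ (θ x) x)
    (hθc : Continuous θ) (hθ : ∀ x, |θ x| ≤ 1) (hΘ1 : ∀ x, |Θ x| ≤ 1) :
    Tendsto (fun t : ℝ => ∫ l in (0)..b, g l * θ (t * ω l)) atTop (𝓝 0) := by
  have hω' : ContDiff ℝ 1 (deriv ω) := by
    have : ContDiff ℝ (1 + 1) ω := by norm_num; exact hω
    exact (contDiff_succ_iff_deriv.1 this).2.2
  have hωd : Differentiable ℝ ω := hω.differentiable (by norm_num)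
  have hΘc : Continuous Θ := continuous_iff_continuousAt.2 fun x => (hΘ x).continuousAt
  -- the error made by a regularized division by the derivative of the phase
  have hJ : Tendsto (fun n : ℕ => ∫ l in (0)..b,
      |g l| * ((1 / ((n : ℝ) + 1)) / (deriv ω l ^ 2 + 1 / ((n : ℝ) + 1)))) atTop (𝓝 0) := by
    have hgi : IntervalIntegrable (fun l => |g l|) volume 0 b :=
      hg.continuous.abs.intervalIntegrable _ _
    suffices h : Tendsto (fun n : ℕ => ∫ l in (0)..b,
        |g l| * ((1 / ((n : ℝ) + 1)) / (deriv ω l ^ 2 + 1 / ((n : ℝ) + 1)))) atTop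
        (𝓝 (∫ l in (0)..b, (0 : ℝ))) by simpa using h
    refine intervalIntegral.tendsto_integral_filter_of_dominated_convergence (fun l => |g l|)
      (Eventually.of_forall fun n => ?_) (Eventually.of_forall fun n => ?_)
      hgi ?_
    · refine Continuous.aestronglyMeasurable (hg.continuous.abs.mul
        (continuous_const.div ((hω'.continuous.pow 2).add continuous_const) fun l => ?_))
      positivity
    · refine Eventually.of_forall fun l _ => ?_
      have h1 : (0 : ℝ) < 1 / ((n : ℝ) + 1) := by positivity
      rw [Real.norm_eq_abs, abs_mul, abs_abs]
      refine mul_le_of_le_one_right (abs_nonneg _) ?_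
      rw [abs_of_nonneg (by positivity), div_le_one (by positivity)]
      nlinarith [sq_nonneg (deriv ω l)]
    · filter_upwards [hne] with l hl _
      have h1 : Tendsto (fun n : ℕ => 1 / ((n : ℝ) + 1)) atTop (𝓝 0) :=
        tendsto_one_div_add_atTop_nhds_zero_nat
      have h2 : deriv ω l ^ 2 + 0 ≠ 0 := by simpa using hl
      have := ((h1.div (h1.const_add (deriv ω l ^ 2)) h2).const_mul |g l|)
      simpa using this
  rw [Metric.tendsto_atTop]
  intro η hη
  obtain ⟨n, hn⟩ := (hJ.eventually (gt_mem_nhds (half_pos hη))).exists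
  set ε : ℝ := 1 / ((n : ℝ) + 1) with hε
  have hε0 : 0 < ε := by positivity
  have hden : ∀ l, deriv ω l ^ 2 + ε ≠ 0 := fun l => by positivity
  -- The amplitude splits as `g = u ω' + g ε / (ω'² + ε)`. The first term is integrated by parts and
  -- is `O(1/t)`; the second is small by the choice of `ε`, whatever `t` is.
  set u : ℝ → ℝ := fun l => g l * deriv ω l / (deriv ω l ^ 2 + ε) with hu
  have huC : ContDiff ℝ 1 u := (hg.mul hω').div ((hω'.pow 2).add contDiff_const) hden
  have hud : Differentiable ℝ u := huC.differentiable (by norm_num)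
  have hu'c : Continuous (deriv u) := huC.continuous_deriv (by norm_num)
  set C : ℝ := |u b| + |u 0| + ∫ l in (0)..b, |deriv u l| with hC
  have hC0 : 0 ≤ C := by
    have : 0 ≤ ∫ l in (0)..b, |deriv u l| :=
      intervalIntegral.integral_nonneg hb fun _ _ => abs_nonneg _
    positivity
  have hparts : ∀ t : ℝ, 0 < t → |∫ l in (0)..b, u l * (deriv ω l * θ (t * ω l))| ≤ C / t := by
    intro t ht
    have hv : ∀ l, HasDerivAt (fun l => Θ (t * ω l)) (t * (deriv ω l * θ (t * ω l))) l := by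
      intro l
      have := (hΘ (t * ω l)).comp l (((hωd l).hasDerivAt).const_mul t)
      refine this.congr_deriv ?_
      ring
    have hc : Continuous fun l => t * (deriv ω l * θ (t * ω l)) :=
      continuous_const.mul (hω'.continuous.mul (hθc.comp (continuous_const.mul hω.continuous)))
    have h1 := intervalIntegral.integral_mul_deriv_eq_deriv_mul (a := 0) (b := b)
      (fun l _ => (hud l).hasDerivAt) (fun l _ => hv l) (hu'c.intervalIntegrable _ _)
      (hc.intervalIntegrable _ _)
    have h2 : ∫ l in (0)..b, u l * (t * (deriv ω l * θ (t * ω l)))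
        = t * ∫ l in (0)..b, u l * (deriv ω l * θ (t * ω l)) := by
      rw [← intervalIntegral.integral_const_mul]
      refine intervalIntegral.integral_congr fun l _ => ?_
      ring
    have h3 : |∫ l in (0)..b, deriv u l * Θ (t * ω l)| ≤ ∫ l in (0)..b, |deriv u l| := by
      refine (intervalIntegral.abs_integral_le_integral_abs hb).trans ?_
      refine intervalIntegral.integral_mono_on hb ?_ (hu'c.abs.intervalIntegrable _ _) fun l _ => ?_
      · exact ((hu'c.mul (hΘc.comp (continuous_const.mul hω.continuous))).abs).intervalIntegrable _ _
      · rw [abs_mul]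
        exact mul_le_of_le_one_right (abs_nonneg _) (hΘ1 _)
    have h4 : t * |∫ l in (0)..b, u l * (deriv ω l * θ (t * ω l))| ≤ C := by
      rw [← abs_of_pos ht, ← abs_mul, abs_of_pos ht, ← h2, h1]
      have e1 : |u b * Θ (t * ω b)| ≤ |u b| := by
        rw [abs_mul]; exact mul_le_of_le_one_right (abs_nonneg _) (hΘ1 _)
      have e2 : |u 0 * Θ (t * ω 0)| ≤ |u 0| := by
        rw [abs_mul]; exact mul_le_of_le_one_right (abs_nonneg _) (hΘ1 _)
      exact (abs_sub _ _).trans (add_le_add ((abs_sub _ _).trans (add_le_add e1 e2)) h3)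
    rw [le_div_iff₀ ht, mul_comm]; exact h4
  -- Beyond `2C/η` the bound `C / t` is below `η / 2`; the added `1` makes both `t > 0` and the
  -- inequality strict.
  refine ⟨2 * C / η + 1, fun t ht => ?_⟩
  have ht0 : 0 < t := by
    have : 0 ≤ 2 * C / η := by positivity
    linarith
  rw [dist_zero_right, Real.norm_eq_abs]
  have hsplit : ∫ l in (0)..b, g l * θ (t * ω l)
      = (∫ l in (0)..b, u l * (deriv ω l * θ (t * ω l)))
        + ∫ l in (0)..b, g l * (ε / (deriv ω l ^ 2 + ε)) * θ (t * ω l) := by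
    have hθt : Continuous fun l => θ (t * ω l) := hθc.comp (continuous_const.mul hω.continuous)
    rw [← intervalIntegral.integral_add]
    · refine intervalIntegral.integral_congr fun l _ => ?_
      have := hden l
      simp only [hu]
      field_simp
    · exact (huC.continuous.mul (hω'.continuous.mul hθt)).intervalIntegrable _ _
    · exact ((hg.continuous.mul (continuous_const.div
        ((hω'.continuous.pow 2).add continuous_const) hden)).mul hθt).intervalIntegrable _ _
  have herr : |∫ l in (0)..b, g l * (ε / (deriv ω l ^ 2 + ε)) * θ (t * ω l)|
      ≤ ∫ l in (0)..b, |g l| * (ε / (deriv ω l ^ 2 + ε)) := by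
    have hθt : Continuous fun l => θ (t * ω l) := hθc.comp (continuous_const.mul hω.continuous)
    have hq : Continuous fun l => ε / (deriv ω l ^ 2 + ε) :=
      continuous_const.div ((hω'.continuous.pow 2).add continuous_const) hden
    refine (intervalIntegral.abs_integral_le_integral_abs hb).trans ?_
    refine intervalIntegral.integral_mono_on hb ?_ ?_ fun l _ => ?_
    · exact ((hg.continuous.mul hq).mul hθt).abs.intervalIntegrable _ _
    · exact (hg.continuous.abs.mul hq).intervalIntegrable _ _
    · rw [abs_mul, abs_mul, abs_of_nonneg (a := ε / _) (by positivity)]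
      exact mul_le_of_le_one_right (by positivity) (hθ _)
  have h5 : C / t < η / 2 := by
    rw [div_lt_iff₀ ht0]
    have : 2 * C / η < t := by linarith
    rw [div_lt_iff₀ hη] at this
    linarith
  rw [hsplit]
  exact (abs_add_le _ _).trans_lt (by linarith [hparts t ht0])

end Oscillation

/-! ### From decay of coefficients to decay on all of `ℓ²`. -/

section WeakNull

/-- Functionals on `ℓ²(ℤ)` with uniformly bounded norms tend to zero as soon as their coefficients
do. -/
theorem tendsto_zero_of_coefficients {T : ℝ → lp (fun _ : ℤ => ℝ) 2 →L[ℝ] ℝ} {B : ℝ} (hB0 : 0 ≤ B)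
    (hB : ∀ t, ∀ F : Finset ℤ, ∑ k ∈ F, T t (lp.single 2 k 1) ^ 2 ≤ B ^ 2)
    (h0 : ∀ k, Tendsto (fun t => T t (lp.single 2 k 1)) atTop (𝓝 0))
    (x : lp (fun _ : ℤ => ℝ) 2) : Tendsto (fun t => T t x) atTop (𝓝 0) := by
  have hsum : ∀ y : lp (fun _ : ℤ => ℝ) 2, HasSum (fun k => lp.single 2 k (y k)) y := fun y =>
    lp.hasSum_single (by norm_num) y
  have hcoef : ∀ t (y : lp (fun _ : ℤ => ℝ) 2) k,
      T t (lp.single 2 k (y k)) = y k * T t (lp.single 2 k 1) := by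
    intro t y k
    have : lp.single (E := fun _ : ℤ => ℝ) 2 k (y k) = y k • lp.single 2 k 1 := by
      rw [← lp.single_smul, smul_eq_mul, mul_one]
    rw [this, map_smul, smul_eq_mul]
  -- Cauchy–Schwarz on finite sections: the coefficient bound controls the operator norm uniformly
  -- in `t`, which allows `x` to be replaced by a finitely supported vector.
  have hbound : ∀ t y, |T t y| ≤ B * ‖y‖ := by
    intro t y
    have h1 : Tendsto (fun F : Finset ℤ => |∑ k ∈ F, y k * T t (lp.single 2 k 1)|) atTop
        (𝓝 |T t y|) := by
      have := ((hsum y).mapL (T t))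
      simp only [hcoef] at this
      exact this.abs
    refine le_of_tendsto' h1 fun F => ?_
    have h2 : ∑ k ∈ F, y k ^ 2 ≤ ‖y‖ ^ 2 := by
      have := lp.sum_rpow_le_norm_rpow (p := 2) (by norm_num) y F
      simpa using this
    have h3 := Finset.sum_mul_sq_le_sq_mul_sq F (fun k => y k) fun k => T t (lp.single 2 k 1)
    refine abs_le_of_sq_le_sq ?_ (by positivity)
    calc _ ≤ _ := h3
      _ ≤ ‖y‖ ^ 2 * B ^ 2 := by
        gcongr
        exact hB t F
      _ = (B * ‖y‖) ^ 2 := by ring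
  rw [Metric.tendsto_nhds]
  intro ε hε
  -- `B + 1` instead of `B`, since `B` may be zero.
  have hε' : 0 < ε / (2 * (B + 1)) := by positivity
  obtain ⟨F, hF⟩ := ((Metric.tendsto_nhds.1 (hsum x)) _ hε').exists
  have h1 : Tendsto (fun t => ∑ k ∈ F, T t (lp.single 2 k (x k))) atTop (𝓝 0) := by
    simp only [hcoef]
    have := tendsto_finsetSum F fun k _ => (h0 k).const_mul (x k)
    simpa using this
  filter_upwards [(Metric.tendsto_nhds.1 h1) _ (half_pos hε)] with t ht
  rw [dist_zero_right, Real.norm_eq_abs] at ht ⊢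
  have h2 : T t x = T t (x - ∑ k ∈ F, lp.single 2 k (x k)) + ∑ k ∈ F, T t (lp.single 2 k (x k)) := by
    rw [map_sub, map_sum]; ring
  rw [dist_comm, dist_eq_norm] at hF
  have h3 : |T t (x - ∑ k ∈ F, lp.single 2 k (x k))| ≤ ε / 2 := by
    refine (hbound t _).trans ?_
    calc B * ‖x - ∑ k ∈ F, lp.single 2 k (x k)‖ ≤ (B + 1) * (ε / (2 * (B + 1))) := by
          gcongr; linarith
      _ = ε / 2 := by field_simp
  rw [h2]
  exact (abs_add_le _ _).trans_lt (by linarith)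

end WeakNull

/-! ### Explicit kernels of the homogeneous flow and its pointwise decay. -/

section Decay

variable {a : ℤ → ℝ} {s : Finset ℤ}

/-- The Riemann–Lebesgue lemma for lattice kernels oscillating with the frequency `ω`. -/
theorem tendsto_funKernel_oscillating (hsymm : ∀ k, a (-k) = a k) (hs : ∀ k, k ∉ s → a k = 0)
    (hpos : ∀ l, 0 < omegaSq a l) (hne : ∃ k : ℤ, k ≠ 0 ∧ a k ≠ 0) {h θ Θ : ℝ → ℝ}
    (hh : ContDiffOn ℝ 1 h (Ioi 0)) (hΘ : ∀ x, HasDerivAt Θ (θ x) x)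
    (hθc : Continuous θ) (hθ : ∀ x, |θ x| ≤ 1) (hΘ1 : ∀ x, |Θ x| ≤ 1) (k : ℤ) :
    Tendsto (fun t : ℝ => funKernel a (fun w => h w * θ (t * √w)) k) atTop (𝓝 0) := by
  have hW : ∀ {n : WithTop ℕ∞}, ContDiff ℝ n (omegaSq a) := contDiff_omegaSq hs
  have hω : ContDiff ℝ 2 (fun l => √(omegaSq a l)) := hW.sqrt fun l => (hpos l).ne'
  have hg : ContDiff ℝ 1 (fun l => Real.cos (k * l) * h (omegaSq a l)) := by
    refine (Real.contDiff_cos.comp (contDiff_const.mul contDiff_id)).mul ?_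
    exact hh.comp_contDiff hW hpos
  have hne' : ∀ᵐ l : ℝ, deriv (fun l => √(omegaSq a l)) l ≠ 0 := by
    filter_upwards [ae_deriv_omegaSq_ne_zero hsymm hs hne] with l hl
    rw [deriv_sqrt ((hW (n := 1)).differentiable (by norm_num) l) (hpos l).ne']
    have := Real.sqrt_pos.2 (hpos l)
    exact div_ne_zero hl (by positivity)
  have := (tendsto_integral_oscillating Real.two_pi_pos.le hg hω hne' hΘ hθc hθ hΘ1).const_mul
    (2 * Real.pi)⁻¹
  rw [mul_zero] at this
  refine this.congr fun t => ?_
  simp only [funKernel, mul_assoc]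

theorem hasDerivAt_cos_mul_sqrt (t w : ℝ) :
    HasDerivAt (fun t => Real.cos (t * √w)) (-√w * Real.sin (t * √w)) t := by
  have := ((hasDerivAt_id t).mul_const √w).cos
  refine this.congr_deriv ?_
  simp; ring

theorem hasDerivAt_sin_mul_sqrt (t w : ℝ) :
    HasDerivAt (fun t => Real.sin (t * √w)) (√w * Real.cos (t * √w)) t := by
  have := ((hasDerivAt_id t).mul_const √w).sin
  refine this.congr_deriv ?_
  simp; ring

theorem lp_single_apply_eq (k j : ℤ) (c : ℝ) :
    (lp.single (E := fun _ : ℤ => ℝ) 2 k c) j = if j - k = 0 then c else 0 := by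
  by_cases h : j = k
  · subst h; simp
  · rw [if_neg (by omega), lp.single_apply_ne _ _ _ h]

theorem couple_translate (φ : ℤ → ℝ) (j k : ℤ) :
    couple a s (fun i => φ (i - k)) j = couple a s φ (j - k) := by
  simp only [couple]
  refine Finset.sum_congr rfl fun d _ => ?_
  rw [show j + d - k = j - k + d by ring]

/-- The motion started with a unit displacement of the `k`-th particle. -/
theorem flow_single_pos (hsymm : ∀ k, a (-k) = a k) (hs : ∀ k, k ∉ s → a k = 0)
    (hpos : ∀ l, 0 < omegaSq a l) (k : ℤ) {t : ℝ} (ht : 0 ≤ t) (j : ℤ) :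
    (flow a s ((lp.single 2 k 1, 0) : Phase ℝ) t).1 j
        = funKernel a (fun w => Real.cos (t * √w)) (j - k) ∧
      (flow a s ((lp.single 2 k 1, 0) : Phase ℝ) t).2 j
        = funKernel a (fun w => -√w * Real.sin (t * √w)) (j - k) := by
  obtain ⟨m, M, hm, hmM, hr⟩ := range_omegaSq_eq_Icc hs hpos
  have hWM : ∀ l, omegaSq a l ≤ M := fun l => (hr ▸ mem_range_self l : omegaSq a l ∈ Icc m M).2
  have hWc := continuous_omegaSq hs
  have hb1 : ∀ t l, |-√(omegaSq a l) * Real.sin (t * √(omegaSq a l))| ≤ √M := by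
    intro t l
    rw [abs_mul, abs_neg, abs_of_nonneg (Real.sqrt_nonneg _)]
    exact (mul_le_of_le_one_right (Real.sqrt_nonneg _) (Real.abs_sin_le_one _)).trans
      (Real.sqrt_le_sqrt (hWM l))
  have hb2 : ∀ t l, |-(omegaSq a l * Real.cos (t * √(omegaSq a l)))| ≤ M := by
    intro t l
    rw [abs_neg, abs_mul, abs_of_pos (hpos l)]
    exact (mul_le_of_le_one_right (hpos l).le (Real.abs_cos_le_one _)).trans (hWM l)
  -- The kernels of `cos(t√A)` and of its time derivative. They solve the system and are bounded
  -- over all particles, so uniqueness identifies them with the flow.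
  let q : ℤ → ℝ → ℝ := fun j t => funKernel a (fun w => Real.cos (t * √w)) (j - k)
  let p : ℤ → ℝ → ℝ := fun j t => funKernel a (fun w => -√w * Real.sin (t * √w)) (j - k)
  have hq : ∀ j t, 0 ≤ t → HasDerivWithinAt (q j) (p j t) (Ici 0) t :=
    (fun j t _ => (hasDerivAt_funKernel (φ := fun t w => Real.cos (t * √w))
      (φ' := fun t w => -√w * Real.sin (t * √w)) hs hpos
      (fun t w _ => hasDerivAt_cos_mul_sqrt t w) (fun t => by fun_prop) (fun t => by fun_prop) hb1
      (j - k) t).hasDerivWithinAt)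
  have hp : ∀ j t, 0 ≤ t → HasDerivWithinAt (p j) (-couple a s (fun i => q i t) j) (Ici 0) t :=
    (fun j t _ => by
      simp only [q, p]
      rw [couple_translate, ← funKernel_id_mul hsymm hs (φ := fun w => Real.cos (t * √w))
        (by fun_prop), ← neg_one_mul, ← funKernel_const_mul]
      refine (hasDerivAt_funKernel (φ := fun t w => -√w * Real.sin (t * √w))
        (φ' := fun t w => -1 * (w * Real.cos (t * √w))) hs hpos (fun t w hw => ?_)
        (fun t => by fun_prop) (fun t => by fun_prop)
        (fun t l => by rw [neg_one_mul]; exact hb2 t l) (j - k) t).hasDerivWithinAt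
      refine ((hasDerivAt_sin_mul_sqrt t w).const_mul (-√w)).congr_deriv ?_
      rw [← mul_assoc, neg_mul, Real.mul_self_sqrt hw.le]; ring)
  have hb : ∀ T, ∃ C, ∀ t, 0 ≤ t → t ≤ T → ∀ j, ‖q j t‖ ≤ C ∧ ‖p j t‖ ≤ C :=
    fun T => ⟨1 + √M, fun t _ _ j => ⟨by
      have : |q j t| ≤ 1 := abs_funKernel_le (φ := fun w => Real.cos (t * √w))
        (fun l => Real.abs_cos_le_one _) _
      rw [Real.norm_eq_abs]
      linarith [Real.sqrt_nonneg M], by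
      have : |p j t| ≤ √M := abs_funKernel_le (φ := fun w => -√w * Real.sin (t * √w)) (hb1 t) _
      rw [Real.norm_eq_abs]
      linarith⟩⟩
  have hq0 : ∀ j, q j 0 = ((lp.single 2 k 1, 0) : Phase ℝ).1 j := fun j => by
    simp only [q]; rw [lp_single_apply_eq]; simp [funKernel_const]
  have hp0 : ∀ j, p j 0 = ((lp.single 2 k 1, 0) : Phase ℝ).2 j := fun j => by
    simp only [p]; simp [funKernel_const]
  have key := eq_flow_of_homogeneous a s hq hp hb (lp.single 2 k 1, 0) hq0 hp0 ht j
  exact ⟨key.1.symm, key.2.symm⟩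

/-- The motion started with a unit momentum of the `k`-th particle. -/
theorem flow_single_mom (hsymm : ∀ k, a (-k) = a k) (hs : ∀ k, k ∉ s → a k = 0)
    (hpos : ∀ l, 0 < omegaSq a l) (k : ℤ) {t : ℝ} (ht : 0 ≤ t) (j : ℤ) :
    (flow a s ((0, lp.single 2 k 1) : Phase ℝ) t).1 j
        = funKernel a (fun w => (√w)⁻¹ * Real.sin (t * √w)) (j - k) ∧
      (flow a s ((0, lp.single 2 k 1) : Phase ℝ) t).2 j
        = funKernel a (fun w => Real.cos (t * √w)) (j - k) := by
  obtain ⟨m, M, hm, hmM, hr⟩ := range_omegaSq_eq_Icc hs hpos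
  have hWM : ∀ l, omegaSq a l ≤ M := fun l => (hr ▸ mem_range_self l : omegaSq a l ∈ Icc m M).2
  have hmW : ∀ l, m ≤ omegaSq a l := fun l => (hr ▸ mem_range_self l : omegaSq a l ∈ Icc m M).1
  have hWc := continuous_omegaSq hs
  have hne : ∀ w : ℝ, 0 < w → √w ≠ 0 := fun w hw => (Real.sqrt_pos.2 hw).ne'
  have hb1 : ∀ t l, |-√(omegaSq a l) * Real.sin (t * √(omegaSq a l))| ≤ √M := by
    intro t l
    rw [abs_mul, abs_neg, abs_of_nonneg (Real.sqrt_nonneg _)]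
    exact (mul_le_of_le_one_right (Real.sqrt_nonneg _) (Real.abs_sin_le_one _)).trans
      (Real.sqrt_le_sqrt (hWM l))
  have hb3 : ∀ t l, |(√(omegaSq a l))⁻¹ * Real.sin (t * √(omegaSq a l))| ≤ (√m)⁻¹ := by
    intro t l
    rw [abs_mul, abs_inv, abs_of_nonneg (Real.sqrt_nonneg _)]
    refine (mul_le_of_le_one_right (by positivity) (Real.abs_sin_le_one _)).trans ?_
    exact inv_anti₀ (Real.sqrt_pos.2 hm) (Real.sqrt_le_sqrt (hmW l))
  have hcinv : ContinuousOn (fun w : ℝ => (√w)⁻¹) (Ioi 0) :=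
    Real.continuous_sqrt.continuousOn.inv₀ fun w hw => hne w hw
  have hcS : ∀ t, ContinuousOn (fun w : ℝ => (√w)⁻¹ * Real.sin (t * √w)) (Ioi 0) := fun t =>
    hcinv.mul (by fun_prop)
  -- The kernels of `A^{-1/2} sin(t√A)` and of its time derivative `cos(t√A)`, again identified with
  -- the flow by uniqueness.
  let q : ℤ → ℝ → ℝ := fun j t => funKernel a (fun w => (√w)⁻¹ * Real.sin (t * √w)) (j - k)
  let p : ℤ → ℝ → ℝ := fun j t => funKernel a (fun w => Real.cos (t * √w)) (j - k)
  have hq : ∀ j t, 0 ≤ t → HasDerivWithinAt (q j) (p j t) (Ici 0) t :=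
    (fun j t _ => (hasDerivAt_funKernel (φ := fun t w => (√w)⁻¹ * Real.sin (t * √w))
      (φ' := fun t w => Real.cos (t * √w)) hs hpos
      (fun t w hw => ((hasDerivAt_sin_mul_sqrt t w).const_mul (√w)⁻¹).congr_deriv (by
        have := hne w hw
        field_simp)) hcS (fun t => by fun_prop) (fun t l => Real.abs_cos_le_one _)
      (j - k) t).hasDerivWithinAt)
  have hp : ∀ j t, 0 ≤ t → HasDerivWithinAt (p j) (-couple a s (fun i => q i t) j) (Ici 0) t :=
    (fun j t _ => by
      simp only [q, p]
      rw [couple_translate, ← funKernel_id_mul hsymm hs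
        (φ := fun w => (√w)⁻¹ * Real.sin (t * √w))
        ((hcS t).comp_continuous hWc hpos), ← neg_one_mul, ← funKernel_const_mul,
        funKernel_congr (ψ := fun w => -√w * Real.sin (t * √w))]
      · exact (hasDerivAt_funKernel (φ := fun t w => Real.cos (t * √w))
          (φ' := fun t w => -√w * Real.sin (t * √w)) hs hpos
          (fun t w _ => hasDerivAt_cos_mul_sqrt t w) (fun t => by fun_prop)
          (fun t => by fun_prop) hb1 (j - k) t).hasDerivWithinAt
      · intro l
        have h1 := hne _ (hpos l)
        have h2 := Real.mul_self_sqrt (hpos l).le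
        field_simp
        rw [sq, h2])
  have hb : ∀ T, ∃ C, ∀ t, 0 ≤ t → t ≤ T → ∀ j, ‖q j t‖ ≤ C ∧ ‖p j t‖ ≤ C :=
    fun T => ⟨1 + (√m)⁻¹, fun t _ _ j => ⟨by
      have : |q j t| ≤ (√m)⁻¹ := abs_funKernel_le (φ := fun w => (√w)⁻¹ * Real.sin (t * √w)) (hb3 t) _
      rw [Real.norm_eq_abs]
      linarith, by
      have : |p j t| ≤ 1 := abs_funKernel_le (φ := fun w => Real.cos (t * √w))
        (fun l => Real.abs_cos_le_one _) _
      rw [Real.norm_eq_abs]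
      linarith [inv_nonneg.2 (Real.sqrt_nonneg m)]⟩⟩
  have hq0 : ∀ j, q j 0 = ((0, lp.single 2 k 1) : Phase ℝ).1 j := fun j => by
    simp only [q]; simp [funKernel_const]
  have hp0 : ∀ j, p j 0 = ((0, lp.single 2 k 1) : Phase ℝ).2 j := fun j => by
    simp only [p]; rw [lp_single_apply_eq]; simp [funKernel_const]
  have key := eq_flow_of_homogeneous a s hq hp hb (0, lp.single 2 k 1) hq0 hp0 ht j
  exact ⟨key.1.symm, key.2.symm⟩

/-- Every particle of the homogeneous motion comes to rest at the origin. -/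
theorem tendsto_flow_zero (hsymm : ∀ k, a (-k) = a k) (hs : ∀ k, k ∉ s → a k = 0)
    (hpos : ∀ l, 0 < omegaSq a l) (hne : ∃ k : ℤ, k ≠ 0 ∧ a k ≠ 0) (x : Phase ℝ) (j : ℤ) :
    Tendsto (fun t => (flow a s x t).1 j) atTop (𝓝 0) ∧
      Tendsto (fun t => (flow a s x t).2 j) atTop (𝓝 0) := by
  obtain ⟨m, M, hm, hmM, hr⟩ := range_omegaSq_eq_Icc hs hpos
  have hWM : ∀ l, omegaSq a l ≤ M := fun l => (hr ▸ mem_range_self l : omegaSq a l ∈ Icc m M).2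
  have hmW : ∀ l, m ≤ omegaSq a l := fun l => (hr ▸ mem_range_self l : omegaSq a l ∈ Icc m M).1
  have hWc := continuous_omegaSq hs
  have hne0 : ∀ w : ℝ, 0 < w → √w ≠ 0 := fun w hw => (Real.sqrt_pos.2 hw).ne'
  have hcsqrt : ContDiffOn ℝ 1 (fun w : ℝ => √w) (Ioi 0) := fun w hw =>
    (Real.contDiffAt_sqrt (ne_of_gt hw)).contDiffWithinAt
  -- a functional of the motion whose coefficients are an oscillating lattice kernel
  have key : ∀ (ι : lp (fun _ : ℤ => ℝ) 2 →L[ℝ] Phase ℝ) (c : Phase ℝ →L[ℝ] ℝ) (h θ Θ : ℝ → ℝ)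
      (B : ℝ), 0 ≤ B → ContDiffOn ℝ 1 h (Ioi 0) → (∀ l, |h (omegaSq a l)| ≤ B) →
      (∀ x, HasDerivAt Θ (θ x) x) → Continuous θ → (∀ x, |θ x| ≤ 1) → (∀ x, |Θ x| ≤ 1) →
      (∀ t, 0 ≤ t → ∀ k, c (flow a s (ι (lp.single 2 k 1)) t)
        = funKernel a (fun w => h w * θ (t * √w)) (j - k)) →
      ∀ y, Tendsto (fun t => c (flow a s (ι y) t)) atTop (𝓝 0) := by
    intro ι c h θ Θ B hB0 hh hhB hΘ hθc hθ hΘ1 hflow y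
    -- The kernel formula holds for `t ≥ 0` only. Freezing negative times at `0` makes the `ℓ²`
    -- bound valid for all `t` without affecting the limit.
    set T : ℝ → lp (fun _ : ℤ => ℝ) 2 →L[ℝ] ℝ := fun t =>
      c.comp ((NormedSpace.exp (max t 0 • generator ℝ a s)).comp ι) with hT
    have hTk : ∀ t k, T t (lp.single 2 k 1)
        = funKernel a (fun w => h w * θ (max t 0 * √w)) (j - k) := fun t k =>
      hflow _ (le_max_right _ _) k
    have hlim : Tendsto (fun t => T t y) atTop (𝓝 0) := by
      refine tendsto_zero_of_coefficients hB0 (fun t F => ?_) (fun k => ?_) y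
      · simp only [hTk]
        have hc : Continuous fun l => h (omegaSq a l) * θ (max t 0 * √(omegaSq a l)) :=
          (hh.continuousOn.comp_continuous hWc hpos).mul (by fun_prop)
        have := hasSum_sq_funKernel_le (φ := fun w => h w * θ (max t 0 * √w)) hc (B := B)
          (fun l => by
            rw [abs_mul]
            exact (mul_le_of_le_one_right (abs_nonneg _) (hθ _)).trans (hhB l))
          -- The coefficient at `k` is the kernel at `j - k`, so the sum over `F` is a sum over the
          -- reflected set.
          (F.map (Equiv.subLeft j).toEmbedding)
        simpa using this
      · refine (tendsto_funKernel_oscillating hsymm hs hpos hne hh hΘ hθc hθ hΘ1 (j - k)).congr' ?_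
        filter_upwards [eventually_ge_atTop 0] with t ht
        rw [hTk, max_eq_left ht]
    refine hlim.congr' ?_
    filter_upwards [eventually_ge_atTop 0] with t ht
    simp only [hT, max_eq_left ht]
    rfl
  have hsinΘ : ∀ x, HasDerivAt (fun x => -Real.cos x) (Real.sin x) x := fun x => 
    (Real.hasDerivAt_cos x).fun_neg.congr_deriv (neg_neg _)
  have hcos1 : ∀ x, |-Real.cos x| ≤ 1 := fun x => by rw [abs_neg]; exact Real.abs_cos_le_one x
  have hM : ∀ l, |(-√(omegaSq a l))| ≤ √M := fun l => by
    rw [abs_neg, abs_of_nonneg (Real.sqrt_nonneg _)]; exact Real.sqrt_le_sqrt (hWM l)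
  have hm' : ∀ l, |(√(omegaSq a l))⁻¹| ≤ (√m)⁻¹ := fun l => by
    rw [abs_of_nonneg (by positivity)]
    exact inv_anti₀ (Real.sqrt_pos.2 hm) (Real.sqrt_le_sqrt (hmW l))
  let inl := ContinuousLinearMap.inl ℝ (lp (fun _ : ℤ => ℝ) 2) (lp (fun _ : ℤ => ℝ) 2)
  let inr := ContinuousLinearMap.inr ℝ (lp (fun _ : ℤ => ℝ) 2) (lp (fun _ : ℤ => ℝ) 2)
  have hx : x = inl x.1 + inr x.2 := by simp [inl, inr]
  have hadd : ∀ (c : Phase ℝ →L[ℝ] ℝ) t, c (flow a s x t)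
      = c (flow a s (inl x.1) t) + c (flow a s (inr x.2) t) := by
    intro c t
    conv_lhs => rw [hx]
    rw [flow, map_add, map_add]
    rfl
  -- The four blocks of the flow are `cos(t√A)`, `A^{-1/2} sin(t√A)`, `-A^{1/2} sin(t√A)` and
  -- `cos(t√A)`; each is a smooth amplitude times a bounded oscillation with bounded primitive.
  have h1 := key inl (posCoord j) (fun _ => 1) Real.cos Real.sin 1 zero_le_one contDiffOn_const
    (fun l => by simp) Real.hasDerivAt_sin Real.continuous_cos Real.abs_cos_le_one
    Real.abs_sin_le_one (fun t ht k => by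
      simp only [one_mul]
      exact (flow_single_pos hsymm hs hpos k ht j).1) x.1
  have h2 := key inr (posCoord j) (fun w => (√w)⁻¹) Real.sin (fun x => -Real.cos x) (√m)⁻¹
    (by positivity) (hcsqrt.inv fun w hw => hne0 w hw) hm' hsinΘ Real.continuous_sin
    Real.abs_sin_le_one hcos1 (fun t ht k => (flow_single_mom hsymm hs hpos k ht j).1) x.2
  have h3 := key inl (momCoord j) (fun w => -√w) Real.sin (fun x => -Real.cos x) (√M)
    (by positivity) hcsqrt.neg hM hsinΘ Real.continuous_sin
    Real.abs_sin_le_one hcos1 (fun t ht k => (flow_single_pos hsymm hs hpos k ht j).2) x.1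
  have h4 := key inr (momCoord j) (fun _ => 1) Real.cos Real.sin 1 zero_le_one contDiffOn_const
    (fun l => by simp) Real.hasDerivAt_sin Real.continuous_cos Real.abs_cos_le_one
    Real.abs_sin_le_one (fun t ht k => by
      simp only [one_mul]
      exact (flow_single_mom hsymm hs hpos k ht j).2) x.2
  constructor
  · have := h1.add h2
    rw [add_zero] at this
    exact this.congr fun t => (hadd (posCoord j) t).symm
  · have := h3.add h4
    rw [add_zero] at this
    exact this.congr fun t => (hadd (momCoord j) t).symm

end Decay

/-! ### Isometries between closed spans from equality of Gram matrices. -/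

section Gram

variable {ι V H : Type*} [NormedAddCommGroup V] [InnerProductSpace ℝ V] [CompleteSpace V]
  [NormedAddCommGroup H] [InnerProductSpace ℝ H]

omit [CompleteSpace V] in
theorem norm_linearCombination_eq {v : ι → V} {w : ι → H}
    (h : ∀ i j, inner ℝ (v i) (v j) = inner ℝ (w i) (w j)) (c : ι →₀ ℝ) :
    ‖Finsupp.linearCombination ℝ w c‖ = ‖Finsupp.linearCombination ℝ v c‖ := by
  have key : ‖Finsupp.linearCombination ℝ w c‖ ^ 2 = ‖Finsupp.linearCombination ℝ v c‖ ^ 2 := by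
    rw [← real_inner_self_eq_norm_sq, ← real_inner_self_eq_norm_sq]
    simp only [Finsupp.linearCombination_apply, Finsupp.sum, sum_inner, inner_sum,
      real_inner_smul_left, real_inner_smul_right, h]
  exact (sq_eq_sq₀ (norm_nonneg _) (norm_nonneg _)).1 key

/-- Two families of vectors with the same Gram matrix are related by an isometry between their
closed spans. -/
theorem exists_isometry_of_gram_eq [CompleteSpace H] {v : ι → V} {w : ι → H}
    (h : ∀ i j, inner ℝ (v i) (v j) = inner ℝ (w i) (w j)) :
    ∃ Φ : V →L[ℝ] H, (∀ i, Φ (v i) = w i) ∧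
      ∀ x ∈ (Submodule.span ℝ (range v)).topologicalClosure, ‖Φ x‖ = ‖x‖ := by
  set K := (Submodule.span ℝ (range v)).topologicalClosure with hK
  have hKc : IsClosed (K : Set V) := Submodule.isClosed_topologicalClosure _
  have : CompleteSpace K := hKc.completeSpace_coe
  have hmem : ∀ c, Finsupp.linearCombination ℝ v c ∈ K := fun c =>
    Submodule.le_topologicalClosure _ (by
      rw [← Finsupp.range_linearCombination]; exact LinearMap.mem_range_self _ c)
  let e : (ι →₀ ℝ) →ₗ[ℝ] K := (Finsupp.linearCombination ℝ v).codRestrict K hmem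
  let g : (ι →₀ ℝ) →ₗ[ℝ] H := Finsupp.linearCombination ℝ w
  have hdense : DenseRange e := by
    intro x
    have hx : (x : V) ∈ closure ((Submodule.span ℝ (range v) : Submodule ℝ V) : Set V) := x.2
    rw [Metric.mem_closure_iff] at hx ⊢
    intro ε hε
    obtain ⟨y, hy, hxy⟩ := hx ε hε
    rw [← Finsupp.range_linearCombination] at hy
    obtain ⟨c, rfl⟩ := hy
    exact ⟨e c, mem_range_self c, hxy⟩
  have hnorm : ∀ c, ‖g c‖ = ‖e c‖ := fun c => norm_linearCombination_eq h c
  have hex : ∃ C, ∀ c, ‖g c‖ ≤ C * ‖e c‖ := ⟨1, fun c => by rw [one_mul, hnorm]⟩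
  let Ψ : K →L[ℝ] H := g.extendOfNorm e
  have hΨ : ∀ c, Ψ (e c) = g c := fun c => LinearMap.extendOfNorm_eq hdense hex c
  have hΨn : ∀ x, ‖Ψ x‖ = ‖x‖ := fun x =>
    hdense.induction_on x (isClosed_eq Ψ.continuous.norm continuous_norm)
      fun c => by rw [hΨ, hnorm]
  have hproj : ∀ x : K, K.orthogonalProjectionOnto (x : V) = x := fun x =>
    Submodule.orthogonalProjectionOnto_mem_subspace_eq_self x
  -- The orthogonal projection extends the isometry to all of `V`; off the closed span it is only a
  -- contraction, hence the restricted norm statement.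
  refine ⟨Ψ.comp K.orthogonalProjectionOnto, fun i => ?_, fun x hx => ?_⟩
  · have h1 : ((e (Finsupp.single i 1) : K) : V) = v i := by simp [e]
    rw [← h1, ContinuousLinearMap.comp_apply, hproj, hΨ]
    simp [g]
  · rw [ContinuousLinearMap.comp_apply, hproj ⟨x, hx⟩, hΨn]
    rfl

omit [CompleteSpace V] in
theorem exists_seq_linearCombination {v : ι → V} {x : V}
    (hx : x ∈ (Submodule.span ℝ (range v)).topologicalClosure) :
    ∃ c : ℕ → ι →₀ ℝ, Tendsto (fun N => Finsupp.linearCombination ℝ v (c N)) atTop (𝓝 x) := by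
  have hx' : x ∈ closure ((Submodule.span ℝ (range v) : Submodule ℝ V) : Set V) := hx
  obtain ⟨y, hy, hlim⟩ := mem_closure_iff_seq_limit.1 hx'
  have : ∀ N, ∃ c, Finsupp.linearCombination ℝ v c = y N := fun N => by
    have := hy N
    rw [← Finsupp.range_linearCombination] at this
    exact this
  choose c hc using this
  exact ⟨c, by simpa only [hc] using hlim⟩

end Gram

/-! ### The one-sided spectral isometry and invariance of laws under time shifts. -/

section SpectralMap

/-- The character `x ↦ e^{itx}`. -/
def expChar (t x : ℝ) : ℂ := Complex.exp (Complex.I * (t : ℂ) * (x : ℂ))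

theorem expChar_eq (t x : ℝ) : expChar t x = Complex.exp ((t * x : ℝ) * Complex.I) := by
  rw [expChar]; congr 1; push_cast; ring

theorem norm_expChar (t x : ℝ) : ‖expChar t x‖ = 1 := by
  rw [expChar_eq, Complex.norm_exp_ofReal_mul_I]

theorem expChar_add (s t x : ℝ) : expChar (s + t) x = expChar s x * expChar t x := by
  rw [expChar_eq, expChar_eq, expChar_eq, ← Complex.exp_add]
  congr 1; push_cast; ring

theorem expChar_zero (x : ℝ) : expChar 0 x = 1 := by simp [expChar]

theorem continuous_expChar : Continuous fun z : ℝ × ℝ => expChar z.1 z.2 := by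
  unfold expChar; fun_prop

/-- The characters have modulus one, so only the time difference matters; this is where stationarity
of filter outputs comes from. -/
theorem inner_expChar_mul (s t x : ℝ) (z z' : ℂ) :
    inner ℝ (expChar s x * z) (expChar t x * z') = inner ℝ (expChar (s - t) x * z) z' := by
  have h : expChar s x = expChar t x * expChar (s - t) x := by
    rw [← expChar_add]; congr 1; ring
  have h1 : (starRingEnd ℂ) (expChar t x) * expChar t x = 1 := by
    rw [mul_comm, Complex.mul_conj, Complex.normSq_eq_norm_sq, norm_expChar]; simp
  rw [Complex.inner, Complex.inner, h]
  congr 1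
  simp only [map_mul]
  linear_combination (starRingEnd ℂ (expChar (s - t) x) * starRingEnd ℂ z * z') * h1

theorem memLp_of_ae_bound {m : Measure ℝ} [IsFiniteMeasure m] {g : ℝ → ℂ}
    (hg : AEStronglyMeasurable g m) {C : ℝ} (hC : ∀ᵐ x ∂m, ‖g x‖ ≤ C) : MemLp g 2 m :=
  MemLp.of_bound hg C hC

theorem aestronglyMeasurable_expChar (m : Measure ℝ) (t : ℝ) :
    AEStronglyMeasurable (expChar t) m :=
  (continuous_expChar.comp (Continuous.prodMk_right t)).aestronglyMeasurable

theorem memLp_expChar {m : Measure ℝ} [IsFiniteMeasure m] (t : ℝ) : MemLp (expChar t) 2 m :=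
  memLp_of_ae_bound (aestronglyMeasurable_expChar m t)
    (Eventually.of_forall fun x => (norm_expChar t x).le)

theorem memLp_expChar_mul {m : Measure ℝ} {g : ℝ → ℂ} (hg : MemLp g 2 m) (t : ℝ) :
    MemLp (fun x => expChar t x * g x) 2 m :=
  (memLp_congr_norm ((aestronglyMeasurable_expChar m t).mul hg.1) hg.1
    (Eventually.of_forall fun x => by
      rw [Pi.mul_apply, norm_mul, norm_expChar, one_mul])).2 hg

/-- The closed real-linear span in `L²(m)` of the characters `x ↦ e^{isx}`, `s ≥ 0`. -/
def futureSpan (m : Measure ℝ) : Submodule ℝ (Lp ℂ 2 m) :=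
  (Submodule.span ℝ (range fun s : ℝ≥0 => toL2 m (expChar s))).topologicalClosure

theorem isClosed_futureSpan (m : Measure ℝ) : IsClosed (futureSpan m : Set (Lp ℂ 2 m)) :=
  Submodule.isClosed_topologicalClosure _

theorem expChar_mem_futureSpan (m : Measure ℝ) {t : ℝ} (ht : 0 ≤ t) :
    toL2 m (expChar t) ∈ futureSpan m :=
  Submodule.le_topologicalClosure _ (Submodule.subset_span ⟨⟨t, ht⟩, rfl⟩)

variable {Ω : Type*} [MeasurableSpace Ω]

/-- `Φ` maps the character `e^{itx}`, `t ≥ 0`, to `f(t)` and is isometric on the closed span of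
these characters. -/
structure IsFutureIsometry (P : Measure Ω) (f : ℝ → Ω → ℝ) (m : Measure ℝ)
    (Φ : Lp ℂ 2 m →L[ℝ] Lp ℝ 2 P) : Prop where
  apply : ∀ t, 0 ≤ t → Φ (toL2 m (expChar t)) = toL2 P (f t)
  norm : ∀ x ∈ futureSpan m, ‖Φ x‖ = ‖x‖

variable {P : Measure Ω} {f : ℝ → Ω → ℝ} {m : Measure ℝ}

theorem inner_toL2 {α E : Type*} [MeasurableSpace α] [NormedAddCommGroup E]
    [InnerProductSpace ℝ E] {μ : Measure α} {X Y : α → E} (hX : MemLp X 2 μ) (hY : MemLp Y 2 μ) :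
    inner ℝ (toL2 μ X) (toL2 μ Y) = ∫ x, inner ℝ (X x) (Y x) ∂μ := by
  rw [L2.inner_def]
  refine integral_congr_ae ?_
  filter_upwards [coeFn_toL2 hX, coeFn_toL2 hY] with x h1 h2
  rw [h1, h2]

theorem norm_toL2_sq_eq {α E : Type*} [MeasurableSpace α] [NormedAddCommGroup E]
    [InnerProductSpace ℝ E] {μ : Measure α} {X : α → E} (hX : MemLp X 2 μ) :
    ‖toL2 μ X‖ ^ 2 = ∫ x, ‖X x‖ ^ 2 ∂μ := by
  rw [← real_inner_self_eq_norm_sq, inner_toL2 hX hX]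
  simp only [real_inner_self_eq_norm_sq]

theorem cov_eq_inner_of_centered [IsProbabilityMeasure P] {X Y : Ω → ℝ} (hX : MemLp X 2 P)
    (hY : MemLp Y 2 P) (hX0 : ∫ w, X w ∂P = 0) :
    cov[X, Y; P] = inner ℝ (toL2 P X) (toL2 P Y) := by
  rw [covariance_eq_sub hX hY, hX0, zero_mul, sub_zero, inner_toL2 hX hY]
  refine integral_congr_ae (Eventually.of_forall fun w => ?_)
  simp [mul_comm]

/-- The real inner product in `L²(m)` is the real part of `∫ e^{i(s-t)x} m(dx)`, which is the
covariance. The spectral formula is prescribed for nonnegative lags only, hence the reduction to `t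
≤ s`. -/
theorem inner_expChar_eq_inner [IsProbabilityMeasure P] [IsFiniteMeasure m]
    (hA1 : IsCenteredStationary P f) (hm : IsSpectralMeasure P f m) (s t : ℝ≥0) :
    inner ℝ (toL2 m (expChar s)) (toL2 m (expChar t))
      = inner ℝ (toL2 P (f s)) (toL2 P (f t)) := by
  wlog hst : t ≤ s generalizing s t with H
  · rw [real_inner_comm, H t s (le_of_not_ge hst), real_inner_comm]
  have hs : (0 : ℝ) ≤ s := s.2
  have ht : (0 : ℝ) ≤ t := t.2
  have hd : (0 : ℝ) ≤ s - t := sub_nonneg.2 hst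
  rw [← cov_eq_inner_of_centered (hA1.memLp s hs) (hA1.memLp t ht) (hA1.centered s hs),
    inner_toL2 (memLp_expChar _) (memLp_expChar _)]
  have h1 := hm.cov (s - t) t hd ht
  rw [add_sub_cancel] at h1
  rw [← Complex.ofReal_re (cov[f s, f t; P]), h1]
  have hint : Integrable (expChar ((s : ℝ) - t)) m :=
    (memLp_expChar (m := m) _).integrable (by norm_num)
  have h2 : ∫ x : ℝ, Complex.exp (Complex.I * (((s : ℝ) - (t : ℝ) : ℝ) : ℂ) * (x : ℂ)) ∂m
      = ∫ x, expChar ((s : ℝ) - t) x ∂m := rfl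
  have h3 : (∫ x, expChar ((s : ℝ) - t) x ∂m).re = ∫ x, (expChar ((s : ℝ) - t) x).re ∂m :=
    (integral_re hint).symm
  rw [h2, h3]
  refine integral_congr_ae (Eventually.of_forall fun x => ?_)
  have := inner_expChar_mul s t x 1 1
  simp only [mul_one] at this
  simp only [this, Complex.inner]
  simp

theorem exists_isFutureIsometry [IsProbabilityMeasure P] (hA1 : IsCenteredStationary P f)
    (hm : IsSpectralMeasure P f m) : ∃ Φ, IsFutureIsometry P f m Φ := by
  have := hm.finite
  obtain ⟨Φ, h1, h2⟩ := exists_isometry_of_gram_eq (inner_expChar_eq_inner hA1 hm)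
  exact ⟨Φ, fun t ht => h1 ⟨t, ht⟩, h2⟩

namespace IsFutureIsometry

variable {Φ : Lp ℂ 2 m →L[ℝ] Lp ℝ 2 P}

theorem map_linearCombination (hΦ : IsFutureIsometry P f m Φ) (c : ℝ≥0 →₀ ℝ) {h : ℝ}
    (hh : 0 ≤ h) :
    Φ (Finsupp.linearCombination ℝ (fun s : ℝ≥0 => toL2 m (expChar (s + h))) c)
      = Finsupp.linearCombination ℝ (fun s : ℝ≥0 => toL2 P (f (s + h))) c := by
  rw [Finsupp.linearCombination_apply, Finsupp.linearCombination_apply, Finsupp.sum, map_sum,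
    Finsupp.sum]
  refine Finset.sum_congr rfl fun s _ => ?_
  rw [map_smul, hΦ.apply _ (add_nonneg (NNReal.coe_nonneg s) hh)]

theorem inner_map (hΦ : IsFutureIsometry P f m Φ) {x y : Lp ℂ 2 m} (hx : x ∈ futureSpan m)
    (hy : y ∈ futureSpan m) : inner ℝ (Φ x) (Φ y) = inner ℝ x y := by
  rw [real_inner_eq_norm_add_mul_self_sub_norm_mul_self_sub_norm_mul_self_div_two,
    real_inner_eq_norm_add_mul_self_sub_norm_mul_self_sub_norm_mul_self_div_two, ← map_add,
    hΦ.norm _ hx, hΦ.norm _ hy, hΦ.norm _ (Submodule.add_mem _ hx hy)]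

/-- Expectation is the inner product with the constant `1`, hence continuous on `L²(P)`, and it
vanishes on every `f(s)`. -/
theorem integral_map_eq_zero [IsProbabilityMeasure P] (hΦ : IsFutureIsometry P f m Φ)
    (hA1 : IsCenteredStationary P f) {x : Lp ℂ 2 m} (hx : x ∈ futureSpan m) :
    ∫ w, Φ x w ∂P = 0 := by
  have hI : ∀ U : Lp ℝ 2 P, inner ℝ (indicatorConstLp 2 MeasurableSet.univ
      (measure_ne_top P univ) (1 : ℝ)) U = ∫ w, U w ∂P := fun U => by
    rw [L2.inner_indicatorConstLp_one, Measure.restrict_univ]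
  obtain ⟨c, hc⟩ := exists_seq_linearCombination hx
  have h1 : ∀ s : ℝ≥0, inner ℝ (indicatorConstLp 2 MeasurableSet.univ
      (measure_ne_top P univ) (1 : ℝ)) (toL2 P (f s)) = 0 := fun s => by
    rw [hI, integral_congr_ae (coeFn_toL2 (hA1.memLp s s.2)), hA1.centered s s.2]
  have h2 : ∀ N, inner ℝ (indicatorConstLp 2 MeasurableSet.univ (measure_ne_top P univ) (1 : ℝ))
      (Φ (Finsupp.linearCombination ℝ (fun s : ℝ≥0 => toL2 m (expChar s)) (c N))) = 0 := by
    intro N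
    have := hΦ.map_linearCombination (c N) le_rfl
    simp only [add_zero] at this
    rw [this, Finsupp.linearCombination_apply, Finsupp.sum, inner_sum]
    exact Finset.sum_eq_zero fun s _ => by rw [real_inner_smul_right, h1, mul_zero]
  rw [← hI]
  refine tendsto_nhds_unique ((continuous_const.inner Φ.continuous).tendsto x |>.comp hc) ?_
  simp only [Function.comp_def, h2]
  exact tendsto_const_nhds

end IsFutureIsometry

/-- Multiplication by `e^{ihx}` shifts every character by `h` and preserves norms, so the same
coefficients approximate the shifted function equally well. -/
theorem norm_linearCombination_shift_sub [IsFiniteMeasure m] (c : ℝ≥0 →₀ ℝ) {g : ℝ → ℂ}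
    (hg : MemLp g 2 m) (h : ℝ) :
    ‖Finsupp.linearCombination ℝ (fun s : ℝ≥0 => toL2 m (expChar (s + h))) c
        - toL2 m (fun x => expChar h x * g x)‖
      = ‖Finsupp.linearCombination ℝ (fun s : ℝ≥0 => toL2 m (expChar s)) c - toL2 m g‖ := by
  have hcoe : ∀ (u : ℝ), (Finsupp.linearCombination ℝ (fun s : ℝ≥0 => toL2 m (expChar (s + u))) c
      : Lp ℂ 2 m) =ᵐ[m] fun x => ∑ s ∈ c.support, c s • expChar (s + u) x := by
    intro u
    rw [Finsupp.linearCombination_apply, Finsupp.sum]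
    have h1 : ∀ᵐ x ∂m, ∀ s ∈ c.support,
        (c s • toL2 m (expChar ((s : ℝ) + u)) : Lp ℂ 2 m) x = c s • expChar (s + u) x := by
      rw [eventually_all_finset]
      intro s _
      filter_upwards [Lp.coeFn_smul (c s) (toL2 m (expChar ((s : ℝ) + u))),
        coeFn_toL2 (memLp_expChar (m := m) ((s : ℝ) + u))] with x h1 h2
      rw [h1, Pi.smul_apply, h2]
    filter_upwards [h1, Lp.coeFn_finsetSum c.support
      (fun s => c s • toL2 m (expChar ((s : ℝ) + u)))] with x h1 h2
    rw [h2, Finset.sum_apply]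
    exact Finset.sum_congr rfl h1
  have h0 := hcoe 0
  simp only [add_zero] at h0
  rw [Lp.norm_def, Lp.norm_def]
  congr 1
  refine eLpNorm_congr_norm_ae ?_
  filter_upwards [h0, hcoe h, coeFn_toL2 hg, coeFn_toL2 (memLp_expChar_mul hg h),
    Lp.coeFn_sub (Finsupp.linearCombination ℝ (fun s : ℝ≥0 => toL2 m (expChar (s + h))) c)
      (toL2 m (fun x => expChar h x * g x)),
    Lp.coeFn_sub (Finsupp.linearCombination ℝ (fun s : ℝ≥0 => toL2 m (expChar s)) c)
      (toL2 m g)] with x h0 hh hg hgh h1 h2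
  rw [h1, h2, Pi.sub_apply, Pi.sub_apply, h0, hh, hg, hgh]
  have : ∑ s ∈ c.support, c s • expChar (s + h) x - expChar h x * g x
      = expChar h x * (∑ s ∈ c.support, c s • expChar s x - g x) := by
    rw [mul_sub, Finset.mul_sum]
    congr 1
    refine Finset.sum_congr rfl fun s _ => ?_
    rw [expChar_add, mul_smul_comm, mul_comm]
  rw [this, norm_mul, norm_expChar, one_mul]

theorem tendsto_linearCombination_shift [IsFiniteMeasure m] {c : ℕ → ℝ≥0 →₀ ℝ} {g : ℝ → ℂ}
    (hg : MemLp g 2 m) (h : ℝ)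
    (hc : Tendsto (fun N => Finsupp.linearCombination ℝ (fun s : ℝ≥0 => toL2 m (expChar s)) (c N))
      atTop (𝓝 (toL2 m g))) :
    Tendsto (fun N =>
      Finsupp.linearCombination ℝ (fun s : ℝ≥0 => toL2 m (expChar (s + h))) (c N))
      atTop (𝓝 (toL2 m fun x => expChar h x * g x)) := by
  rw [tendsto_iff_norm_sub_tendsto_zero] at hc ⊢
  simpa only [norm_linearCombination_shift_sub _ hg] using hc

theorem expChar_mul_mem_futureSpan [IsFiniteMeasure m] {g : ℝ → ℂ} (hg : MemLp g 2 m)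
    (hgK : toL2 m g ∈ futureSpan m) {t : ℝ} (ht : 0 ≤ t) :
    toL2 m (fun x => expChar t x * g x) ∈ futureSpan m := by
  obtain ⟨c, hc⟩ := exists_seq_linearCombination hgK
  refine (isClosed_futureSpan m).mem_of_tendsto (tendsto_linearCombination_shift hg t hc)
    (Eventually.of_forall fun N => ?_)
  rw [Finsupp.linearCombination_apply, Finsupp.sum]
  exact Submodule.sum_mem _ fun s _ => Submodule.smul_mem _ _
    (expChar_mem_futureSpan m (add_nonneg s.2 ht))

/-- A finite combination is a measurable function of finitely many values of `f`, whose joint law is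
shift invariant. -/
theorem identDistrib_linearCombination [IsProbabilityMeasure P] (hA1 : IsCenteredStationary P f)
    (hf : IsStrictlyStationary P f) (c : ℝ≥0 →₀ ℝ) {h : ℝ} (hh : 0 ≤ h) :
    IdentDistrib (Finsupp.linearCombination ℝ (fun s : ℝ≥0 => toL2 P (f (s + h))) c : Lp ℝ 2 P)
      (Finsupp.linearCombination ℝ (fun s : ℝ≥0 => toL2 P (f s)) c : Lp ℝ 2 P) P P := by
  let e := c.support.equivFin
  have hst := hf c.support.card (fun i => ((e.symm i : ℝ≥0) : ℝ)) (fun i => NNReal.coe_nonneg _) h hh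
  let u : (Fin c.support.card → ℝ) → ℝ := fun y => ∑ i, c (e.symm i) * y i
  have hu : Measurable u := by fun_prop
  have hcoe : ∀ (u : ℝ), 0 ≤ u →
      (Finsupp.linearCombination ℝ (fun s : ℝ≥0 => toL2 P (f (s + u))) c
      : Lp ℝ 2 P) =ᵐ[P] fun w => ∑ i, c (e.symm i) * f ((e.symm i : ℝ≥0) + u) w := by
    intro u hu
    rw [Finsupp.linearCombination_apply, Finsupp.sum]
    have h1 : ∀ᵐ w ∂P, ∀ s ∈ c.support,
        (c s • toL2 P (f ((s : ℝ) + u)) : Lp ℝ 2 P) w = c s * f (s + u) w := by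
      rw [eventually_all_finset]
      intro s _
      filter_upwards [Lp.coeFn_smul (c s) (toL2 P (f ((s : ℝ) + u))),
        coeFn_toL2 (hA1.memLp ((s : ℝ) + u) (add_nonneg s.2 hu))] with x h1 h2
      rw [h1, Pi.smul_apply, h2, smul_eq_mul]
    filter_upwards [h1, Lp.coeFn_finsetSum c.support
      (fun s => c s • toL2 P (f ((s : ℝ) + u)))] with w h1 h2
    rw [h2, Finset.sum_apply, Finset.sum_congr rfl h1, ← Finset.sum_coe_sort]
    exact (Equiv.sum_comp e.symm fun s : c.support => c s * f ((s : ℝ≥0) + u) w).symm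
  have h0 := hcoe 0 le_rfl
  simp only [add_zero] at h0
  have key := hst.comp hu
  exact ((IdentDistrib.of_ae_eq (Lp.aestronglyMeasurable _).aemeasurable (hcoe h hh)).trans
    key).trans (IdentDistrib.of_ae_eq (Lp.aestronglyMeasurable _).aemeasurable h0).symm

theorem tendstoInDistribution_of_tendsto_Lp [IsProbabilityMeasure P] {S : ℕ → Lp ℝ 2 P}
    {U : Lp ℝ 2 P} (h : Tendsto S atTop (𝓝 U)) :
    TendstoInDistribution (fun N => (S N : Ω → ℝ)) atTop (U : Ω → ℝ) (fun _ => P) P :=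
  (tendstoInMeasure_of_tendsto_Lp h).tendstoInDistribution
    (fun _ => (Lp.aestronglyMeasurable _).aemeasurable)

/-- A strictly stationary input produces outputs with time invariant distributions. -/
theorem IsFutureIsometry.identDistrib [IsProbabilityMeasure P] [IsFiniteMeasure m]
    {Φ : Lp ℂ 2 m →L[ℝ] Lp ℝ 2 P} (hΦ : IsFutureIsometry P f m Φ)
    (hA1 : IsCenteredStationary P f) (hf : IsStrictlyStationary P f) {g : ℝ → ℂ}
    (hg : MemLp g 2 m) (hgK : toL2 m g ∈ futureSpan m) {t : ℝ} (ht : 0 ≤ t) :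
    IdentDistrib (Φ (toL2 m fun x => expChar t x * g x)) (Φ (toL2 m g)) P P := by
  obtain ⟨c, hc⟩ := exists_seq_linearCombination hgK
  have h1 := tendstoInDistribution_of_tendsto_Lp (Φ.continuous.tendsto _ |>.comp hc)
  have h2 := tendstoInDistribution_of_tendsto_Lp
    (Φ.continuous.tendsto _ |>.comp (tendsto_linearCombination_shift hg t hc))
  have hid : ∀ N, IdentDistrib
      (Φ (Finsupp.linearCombination ℝ (fun s : ℝ≥0 => toL2 m (expChar (s + t))) (c N)))
      (Φ (Finsupp.linearCombination ℝ (fun s : ℝ≥0 => toL2 m (expChar s)) (c N))) P P := by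
    intro N
    have e1 := hΦ.map_linearCombination (c N) ht
    have e2 := hΦ.map_linearCombination (c N) le_rfl
    simp only [add_zero] at e2
    rw [e1, e2]
    exact identDistrib_linearCombination hA1 hf (c N) ht
  -- The shifted and unshifted approximations have the same laws term by term, so the shifted ones
  -- also converge to the unshifted limit; uniqueness of limits in distribution concludes.
  have h3 : TendstoInDistribution (fun N =>
      ((Φ (Finsupp.linearCombination ℝ (fun s : ℝ≥0 => toL2 m (expChar (s + t))) (c N)) :
        Lp ℝ 2 P) : Ω → ℝ)) atTop (Φ (toL2 m g)) (fun _ => P) P := by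
    refine ⟨fun N => (hid N).aemeasurable_fst, h1.aemeasurable_limit, ?_⟩
    refine h1.tendsto.congr fun N => ?_
    exact Subtype.ext (hid N).map_eq.symm
  exact ⟨h2.aemeasurable_limit, h1.aemeasurable_limit, tendstoInDistribution_unique _ h2 h3⟩

end SpectralMap

/-! ### Dominated limits in `L²(m)` and time derivatives of modulated functions. -/

section L2Limits

variable {m : Measure ℝ} [IsFiniteMeasure m]

omit [IsFiniteMeasure m] in
theorem norm_sub_toL2_sq {g h : ℝ → ℂ} (hg : MemLp g 2 m) (hh : MemLp h 2 m) :
    ‖toL2 m g - toL2 m h‖ ^ 2 = ∫ x, ‖g x - h x‖ ^ 2 ∂m := by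
  rw [← toL2_sub hg hh]
  exact norm_toL2_sq_eq (hg.sub hh)

/-- Bounded pointwise convergence implies convergence in `L²` of a finite measure. -/
theorem tendsto_toL2_of_bounded {ι : Type*} {l : Filter ι} [l.IsCountablyGenerated]
    {G : ι → ℝ → ℂ} {g : ℝ → ℂ} {C : ℝ} (hG : ∀ i, AEStronglyMeasurable (G i) m)
    (hg : AEStronglyMeasurable g m) (hGC : ∀ i, ∀ᵐ x ∂m, ‖G i x‖ ≤ C)
    (hgC : ∀ᵐ x ∂m, ‖g x‖ ≤ C)
    (hlim : ∀ᵐ x ∂m, Tendsto (fun i => G i x) l (𝓝 (g x))) :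
    Tendsto (fun i => toL2 m (G i)) l (𝓝 (toL2 m g)) := by
  have hint : Tendsto (fun i => ∫ x, ‖G i x - g x‖ ^ 2 ∂m) l (𝓝 (∫ _, (0 : ℝ) ∂m)) := by
    refine tendsto_integral_filter_of_dominated_convergence (fun _ => (C + C) ^ 2)
      (Eventually.of_forall fun i => ((hG i).sub hg).norm.pow 2)
      (Eventually.of_forall fun i => ?_) (integrable_const _) ?_
    · filter_upwards [hGC i, hgC] with x h1 h2
      rw [norm_pow, norm_norm]
      gcongr
      exact (norm_sub_le _ _).trans (add_le_add h1 h2)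
    · filter_upwards [hlim] with x hx
      have := ((hx.sub_const (g x)).norm.pow 2)
      simpa using this
  rw [tendsto_iff_norm_sub_tendsto_zero]
  have := hint.sqrt
  rw [integral_zero, Real.sqrt_zero] at this
  refine this.congr fun i => ?_
  rw [← norm_sub_toL2_sq (memLp_of_ae_bound (hG i) (hGC i)) (memLp_of_ae_bound hg hgC),
    Real.sqrt_sq (norm_nonneg _)]

theorem norm_expChar_sub_le (s t x : ℝ) : ‖expChar s x - expChar t x‖ ≤ |x| * |s - t| := by
  have h1 : ∀ u, HasDerivAt (fun u => expChar u x) (Complex.I * x * expChar u x) u := by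
    intro u
    have h2 : HasDerivAt (fun u : ℝ => Complex.I * (u : ℂ) * (x : ℂ)) (Complex.I * x) u := by
      have := ((Complex.ofRealCLM.hasDerivAt (x := u)).const_mul Complex.I).mul_const (x : ℂ)
      simpa using this
    exact h2.cexp.congr_deriv (by rw [expChar]; ring)
  have := Convex.norm_image_sub_le_of_norm_hasDerivWithin_le (f := fun u => expChar u x)
    (f' := fun u => Complex.I * x * expChar u x) (C := |x|) (s := univ)
    (fun u _ => (h1 u).hasDerivWithinAt) (fun u _ => by
      rw [norm_mul, norm_expChar, mul_one, norm_mul, Complex.norm_I, one_mul, Complex.norm_real,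
        Real.norm_eq_abs]) convex_univ (mem_univ t) (mem_univ s)
  simpa using this

theorem hasDerivAt_expChar (t x : ℝ) :
    HasDerivAt (fun u => expChar u x) (Complex.I * x * expChar t x) t := by
  have h2 : HasDerivAt (fun u : ℝ => Complex.I * (u : ℂ) * (x : ℂ)) (Complex.I * x) t := by
    have := ((Complex.ofRealCLM.hasDerivAt (x := t)).const_mul Complex.I).mul_const (x : ℂ)
    simpa using this
  exact h2.cexp.congr_deriv (by rw [expChar]; ring)

theorem continuous_toL2_expChar_mul {g : ℝ → ℂ} (hg : AEStronglyMeasurable g m) {C : ℝ}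
    (hC : ∀ᵐ x ∂m, ‖g x‖ ≤ C) : Continuous fun t => toL2 m fun x => expChar t x * g x := by
  rw [continuous_iff_continuousAt]
  intro t
  have hb : ∀ t, ∀ᵐ x ∂m, ‖expChar t x * g x‖ ≤ C := fun t => by
    filter_upwards [hC] with x hx
    rw [norm_mul, norm_expChar, one_mul]; exact hx
  refine tendsto_toL2_of_bounded (fun s => (aestronglyMeasurable_expChar m s).mul hg)
    ((aestronglyMeasurable_expChar m t).mul hg) hb (hb t) (Eventually.of_forall fun x => ?_)
  exact ((hasDerivAt_expChar t x).continuousAt.tendsto).mul_const _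

/-- The difference quotients of `e^{itx}` are at most `|x|`, so boundedness of `x g(x)` provides the
domination; the support of `m` need not be bounded. -/
theorem hasDerivAt_toL2_expChar_mul {g : ℝ → ℂ} (hg : AEStronglyMeasurable g m) {C C' : ℝ}
    (hC : ∀ᵐ x ∂m, ‖g x‖ ≤ C) (hC' : ∀ᵐ x ∂m, ‖Complex.I * x * g x‖ ≤ C') (t : ℝ) :
    HasDerivAt (fun t => toL2 m fun x => expChar t x * g x)
      (toL2 m fun x => expChar t x * (Complex.I * x * g x)) t := by
  have hm : ∀ t, MemLp (fun x => expChar t x * g x) 2 m := fun t =>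
    memLp_expChar_mul (memLp_of_ae_bound hg hC) t
  have hIx : AEStronglyMeasurable (fun x : ℝ => Complex.I * (x : ℂ)) m :=
    (by fun_prop : Continuous fun x : ℝ => Complex.I * (x : ℂ)).aestronglyMeasurable
  rw [hasDerivAt_iff_tendsto_slope]
  have hslope : ∀ s, slope (fun t => toL2 m fun x => expChar t x * g x) t s
      = toL2 m fun x => (s - t)⁻¹ • (expChar s x * g x - expChar t x * g x) := by
    intro s
    have hd : MemLp (fun x => expChar s x * g x - expChar t x * g x) 2 m := (hm s).sub (hm t)
    rw [slope_def_module, toL2_const_smul hd, toL2_sub (hm s) (hm t)]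
  refine Tendsto.congr (fun s => (hslope s).symm) ?_
  refine tendsto_toL2_of_bounded (C := C')
    (fun s => (((hm s).1.sub (hm t).1).const_smul (s - t)⁻¹))
    ((aestronglyMeasurable_expChar m t).mul (hIx.mul hg)) (fun s => ?_) ?_ ?_
  · filter_upwards [hC'] with x hx
    rw [← sub_mul, norm_smul, norm_mul, Real.norm_eq_abs, abs_inv]
    rw [norm_mul, norm_mul, Complex.norm_I, one_mul, Complex.norm_real, Real.norm_eq_abs] at hx
    refine le_trans ?_ hx
    rcases eq_or_ne s t with rfl | hst
    · simp; positivity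
    · have hst' : 0 < |s - t| := abs_pos.2 (sub_ne_zero.2 hst)
      calc |s - t|⁻¹ * (‖expChar s x - expChar t x‖ * ‖g x‖)
          ≤ |s - t|⁻¹ * (|x| * |s - t| * ‖g x‖) := by
            gcongr; exact norm_expChar_sub_le s t x
        _ = |x| * ‖g x‖ := by field_simp
  · filter_upwards [hC'] with x hx
    rw [norm_mul, norm_expChar, one_mul]; exact hx
  · refine Eventually.of_forall fun x => ?_
    have := hasDerivAt_iff_tendsto_slope.1 ((hasDerivAt_expChar t x).mul_const (g x))
    refine (this.congr fun s => ?_).trans (le_of_eq ?_)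
    · rw [slope_def_module]
    · congr 1; ring

end L2Limits

/-! ### Resolvents as superpositions of future characters. -/

section Membership

variable {m : Measure ℝ} [IsFiniteMeasure m]

/-- The closed span of the future characters is stable under superposition. -/
theorem integral_mem_futureSpan {S : Type*} [MeasurableSpace S] {σ : Measure S} [SFinite σ]
    {G : S → ℝ → ℂ} (hG : AEStronglyMeasurable (fun z : ℝ × S => G z.2 z.1) (m.prod σ))
    {b : S → ℝ} (hb : Integrable b σ) (hGb : ∀ᵐ x ∂m, ∀ s, ‖G s x‖ ≤ b s)
    (hm : ∀ᵐ s ∂σ, MemLp (G s) 2 m ∧ toL2 m (G s) ∈ futureSpan m) :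
    toL2 m (fun x => ∫ s, G s x ∂σ) ∈ futureSpan m := by
  have : CompleteSpace (futureSpan m) := (isClosed_futureSpan m).completeSpace_coe
  have hGs : ∀ᵐ x ∂m, AEStronglyMeasurable (fun s => G s x) σ := hG.prodMk_left
  have hGi : ∀ᵐ x ∂m, Integrable (fun s => G s x) σ := by
    filter_upwards [hGs, hGb] with x h1 h2
    exact hb.mono' h1 (Eventually.of_forall h2)
  have hmeas : AEStronglyMeasurable (fun x => ∫ s, G s x ∂σ) m := hG.integral_prod_right'
  have hbd : ∀ᵐ x ∂m, ‖∫ s, G s x ∂σ‖ ≤ ∫ s, b s ∂σ := by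
    filter_upwards [hGb] with x h2
    exact norm_integral_le_of_norm_le hb (Eventually.of_forall h2)
  have hLp : MemLp (fun x => ∫ s, G s x ∂σ) 2 m := memLp_of_ae_bound hmeas hbd
  -- A closed subspace is its own double orthogonal complement, so membership is tested against
  -- orthogonal vectors, where Fubini reduces it to the single functions `G s`.
  rw [← Submodule.orthogonal_orthogonal (futureSpan m), Submodule.mem_orthogonal]
  intro y hy
  rw [Submodule.mem_orthogonal'] at hy
  have hyi : Integrable (y : ℝ → ℂ) m := (Lp.memLp y).integrable (by norm_num)
  have hint : Integrable (fun z : ℝ × S => inner ℝ (y z.1) (G z.2 z.1)) (m.prod σ) := by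
    have hms : AEStronglyMeasurable (fun z : ℝ × S => inner ℝ (y z.1) (G z.2 z.1)) (m.prod σ) :=
      ((Lp.aestronglyMeasurable y).comp_fst).inner hG
    refine (integrable_prod_iff hms).2 ⟨?_, ?_⟩
    · filter_upwards [hGi] with x hx
      exact hx.const_inner _
    · refine (hyi.norm.mul_const (∫ s, b s ∂σ)).mono' hms.norm.integral_prod_right' ?_
      filter_upwards [hGb] with x hx
      rw [← integral_const_mul]
      refine norm_integral_le_of_norm_le (hb.const_mul _) (Eventually.of_forall fun s => ?_)
      rw [norm_norm]
      exact (norm_inner_le_norm _ _).trans (mul_le_mul_of_nonneg_left (hx s) (norm_nonneg _))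
  have h1 : inner ℝ y (toL2 m fun x => ∫ s, G s x ∂σ)
      = ∫ x, ∫ s, inner ℝ (y x) (G s x) ∂σ ∂m := by
    rw [L2.inner_def]
    refine integral_congr_ae ?_
    filter_upwards [coeFn_toL2 hLp, hGi] with x h1 h2
    rw [h1, integral_inner h2]
  rw [h1, integral_integral_swap hint]
  refine integral_eq_zero_of_ae ?_
  filter_upwards [hm] with s hs
  have h2 := hy _ hs.2
  rw [L2.inner_def] at h2
  rw [Pi.zero_apply, ← h2]
  refine integral_congr_ae ?_
  filter_upwards [coeFn_toL2 hs.1] with x hx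
  rw [hx]

/-- The Fourier transform of the impulse response of a damped oscillator, obtained by splitting the
sine into two exponentials; the damping `ε` makes the integral converge absolutely. -/
theorem integral_exp_sin_expChar {ε ω : ℝ} (hε : 0 < ε) (hω : 0 < ω) (x : ℝ) :
    ∫ s in Ioi (0 : ℝ), ((Real.exp (-ε * s) * (Real.sin (ω * s) / ω) : ℝ) : ℂ) * expChar s x
      = ((ω : ℂ) ^ 2 + ((ε : ℂ) - Complex.I * x) ^ 2)⁻¹ := by
  have key : ∀ y : ℝ, IntegrableOn (fun s : ℝ => Complex.exp ((-(ε : ℂ) + Complex.I * y) * s))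
      (Ioi 0) ∧ ∫ s in Ioi (0 : ℝ), Complex.exp ((-(ε : ℂ) + Complex.I * y) * s)
        = ((ε : ℂ) - Complex.I * y)⁻¹ := by
    intro y
    have hre : (-(ε : ℂ) + Complex.I * y).re < 0 := by simpa using hε
    refine ⟨integrableOn_exp_mul_complex_Ioi hre 0, ?_⟩
    rw [integral_exp_mul_complex_Ioi hre 0]
    have : -(ε : ℂ) + Complex.I * y = -((ε : ℂ) - Complex.I * y) := by ring
    rw [this, Complex.ofReal_zero, mul_zero, Complex.exp_zero, neg_div_neg_eq, one_div]
  have hne : ∀ y : ℝ, (ε : ℂ) - Complex.I * y ≠ 0 := by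
    intro y h
    have := congrArg Complex.re h
    simp at this
    exact hε.ne' this
  have hω' : (ω : ℂ) ≠ 0 := by exact_mod_cast hω.ne'
  have hpt : ∀ s : ℝ, ((Real.exp (-ε * s) * (Real.sin (ω * s) / ω) : ℝ) : ℂ) * expChar s x
      = (2 * Complex.I * ω)⁻¹ * (Complex.exp ((-(ε : ℂ) + Complex.I * (x + ω : ℝ)) * s)
        - Complex.exp ((-(ε : ℂ) + Complex.I * (x - ω : ℝ)) * s)) := by
    intro s
    have e1 : Complex.exp ((-(ε : ℂ) + Complex.I * (x + ω : ℝ)) * s)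
        = Complex.exp (-ε * s) * Complex.exp (Complex.I * s * x)
          * Complex.exp (ω * s * Complex.I) := by
      rw [← Complex.exp_add, ← Complex.exp_add]; congr 1; push_cast; ring
    have e2 : Complex.exp ((-(ε : ℂ) + Complex.I * (x - ω : ℝ)) * s)
        = Complex.exp (-ε * s) * Complex.exp (Complex.I * s * x)
          * Complex.exp (-(ω * s) * Complex.I) := by
      rw [← Complex.exp_add, ← Complex.exp_add]; congr 1; push_cast; ring
    rw [e1, e2, expChar]
    push_cast
    rw [Complex.sin]
    have hI : Complex.I ^ 2 = -1 := Complex.I_sq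
    generalize Complex.exp (-(ω * s) * Complex.I) = A
    generalize Complex.exp (ω * s * Complex.I) = B
    field_simp
    linear_combination (A - B) * hI
  simp only [hpt]
  rw [integral_const_mul, integral_sub (key _).1 (key _).1, (key _).2, (key _).2]
  have h3 : (ω : ℂ) ^ 2 + ((ε : ℂ) - Complex.I * x) ^ 2
      = ((ε : ℂ) - Complex.I * (x + ω : ℝ)) * ((ε : ℂ) - Complex.I * (x - ω : ℝ)) := by
    push_cast
    have hI : Complex.I ^ 2 = -1 := Complex.I_sq
    linear_combination (ω : ℂ) ^ 2 * hI
  rw [h3, mul_inv, inv_sub_inv (hne _) (hne _)]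
  have h4 := hne (x + ω)
  have h5 := hne (x - ω)
  field_simp
  push_cast
  ring

/-- The denominator factors into `ε - i(x + ω)` and `ε - i(x - ω)`, each at least as large as its
imaginary part. The bound is therefore uniform in `ε`. -/
theorem norm_resolvent_le {ω δ x : ℝ} (hδ : 0 < δ) (h : δ ≤ |ω ^ 2 - x ^ 2|) (ε : ℝ) :
    ‖((ω : ℂ) ^ 2 + ((ε : ℂ) - Complex.I * x) ^ 2)⁻¹‖ ≤ δ⁻¹ := by
  have h3 : (ω : ℂ) ^ 2 + ((ε : ℂ) - Complex.I * x) ^ 2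
      = ((ε : ℂ) - Complex.I * (x + ω : ℝ)) * ((ε : ℂ) - Complex.I * (x - ω : ℝ)) := by
    push_cast
    have hI : Complex.I ^ 2 = -1 := Complex.I_sq
    linear_combination (ω : ℂ) ^ 2 * hI
  have h4 : ∀ y : ℝ, |y| ≤ ‖(ε : ℂ) - Complex.I * y‖ := fun y => by
    have := Complex.abs_im_le_norm ((ε : ℂ) - Complex.I * y)
    simpa using this
  rw [norm_inv, h3, norm_mul]
  refine inv_anti₀ hδ (h.trans ?_)
  calc |ω ^ 2 - x ^ 2| = |x + ω| * |x - ω| := by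
        rw [← abs_mul, ← abs_neg]; congr 1; ring
    _ ≤ _ := mul_le_mul (h4 _) (h4 _) (abs_nonneg _) (norm_nonneg _)

/-- The resolvent `(ω² - x²)⁻¹` at a frequency in a spectral gap belongs to the closed span of the
future characters. -/
theorem resolvent_mem_futureSpan {ω δ : ℝ} (hω : 0 < ω) (hδ : 0 < δ)
    (hgap : ∀ᵐ x ∂m, δ ≤ |ω ^ 2 - x ^ 2|) :
    toL2 m (fun x : ℝ => (((ω ^ 2 - x ^ 2)⁻¹ : ℝ) : ℂ)) ∈ futureSpan m := by
  set h : ℝ → ℝ → ℂ := fun ε x => ((ω : ℂ) ^ 2 + ((ε : ℂ) - Complex.I * x) ^ 2)⁻¹ with hh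
  have hmem : ∀ ε, 0 < ε → toL2 m (h ε) ∈ futureSpan m := by
    intro ε hε
    have := integral_mem_futureSpan (m := m) (σ := volume.restrict (Ioi (0 : ℝ)))
      (G := fun s x => ((Real.exp (-ε * s) * (Real.sin (ω * s) / ω) : ℝ) : ℂ) * expChar s x)
      (b := fun s => ω⁻¹ * Real.exp (-ε * s)) ?_ ?_ ?_ ?_
    · simpa only [integral_exp_sin_expChar hε hω] using this
    · refine Continuous.aestronglyMeasurable ?_
      refine Continuous.mul (by fun_prop) ?_
      exact continuous_expChar.comp (continuous_snd.prodMk continuous_fst)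
    · exact (integrableOn_exp_mul_Ioi (by linarith) 0).const_mul _
    · refine Eventually.of_forall fun x s => ?_
      rw [norm_mul, norm_expChar, mul_one, Complex.norm_real, Real.norm_eq_abs, abs_mul,
        abs_of_pos (Real.exp_pos _), abs_div, abs_of_pos hω, mul_comm, ← one_div]
      gcongr
      exact Real.abs_sin_le_one _
    · filter_upwards [ae_restrict_mem measurableSet_Ioi] with s hs
      have e1 : (fun x => ((Real.exp (-ε * s) * (Real.sin (ω * s) / ω) : ℝ) : ℂ) * expChar s x)
          = fun x => (Real.exp (-ε * s) * (Real.sin (ω * s) / ω)) • expChar s x := by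
        ext x; rw [Complex.real_smul]
      rw [e1]
      refine ⟨(memLp_expChar s).const_smul (Real.exp (-ε * s) * (Real.sin (ω * s) / ω)), ?_⟩
      rw [toL2_const_smul (memLp_expChar s)]
      exact Submodule.smul_mem _ _ (expChar_mem_futureSpan m (le_of_lt hs))
  have hmeas : ∀ ε, AEStronglyMeasurable (h ε) m := fun ε => by
    refine Measurable.aestronglyMeasurable ?_
    simp only [hh]
    fun_prop
  have h0 : ∀ x, h 0 x = (((ω ^ 2 - x ^ 2)⁻¹ : ℝ) : ℂ) := by
    intro x
    simp only [hh]
    push_cast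
    congr 1
    have hI : Complex.I ^ 2 = -1 := Complex.I_sq
    linear_combination (x : ℂ) ^ 2 * hI
  have hb : ∀ ε, ∀ᵐ x ∂m, ‖h ε x‖ ≤ δ⁻¹ := fun ε => by
    filter_upwards [hgap] with x hx
    exact norm_resolvent_le hδ hx ε
  -- The damping is removed along `ε = 1/(N+1)`, dominated by `δ⁻¹`.
  have hlim : Tendsto (fun N : ℕ => toL2 m (h (1 / ((N : ℝ) + 1)))) atTop (𝓝 (toL2 m (h 0))) := by
    refine tendsto_toL2_of_bounded (fun N => hmeas _) (hmeas 0) (fun N => hb _) (hb 0) ?_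
    filter_upwards [hgap] with x hx
    have hne : (ω : ℂ) ^ 2 + (((0 : ℝ) : ℂ) - Complex.I * x) ^ 2 ≠ 0 := by
      intro h
      have h2 := norm_resolvent_le hδ hx 0
      have h3 := h0 x
      simp only [hh, h, inv_zero] at h3
      have h4 : (ω ^ 2 - x ^ 2)⁻¹ = 0 := by exact_mod_cast h3.symm
      rw [inv_eq_zero] at h4
      rw [h4, abs_zero] at hx
      linarith
    have hc : ContinuousAt (fun ε : ℝ => h ε x) 0 := by
      simp only [hh]
      exact ContinuousAt.inv₀ (by fun_prop) hne
    exact hc.tendsto.comp tendsto_one_div_add_atTop_nhds_zero_nat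
  have e0 : (fun x : ℝ => (((ω ^ 2 - x ^ 2)⁻¹ : ℝ) : ℂ)) = h 0 := funext fun x => (h0 x).symm
  rw [e0]
  exact (isClosed_futureSpan m).mem_of_tendsto hlim
    (Eventually.of_forall fun N => hmem _ (by positivity))

end Membership

/-! ### The lattice resolvent: spectral gap, exponential decay, membership in the future span. -/

section Resolvent

variable {a : ℤ → ℝ} {s : Finset ℤ}

/-- The resonant set is compact, so `U` contains a uniform neighbourhood of it. A point outside `U`
is far from both `ω` and `-ω`, and the two distances multiply to `|ω² - x²|`; hence the squared
radius. -/
theorem exists_spectral_gap (hs : ∀ k, k ∉ s → a k = 0) (hpos : ∀ l, 0 < omegaSq a l) {U : Set ℝ}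
    (hU : IsOpen U) (hsub : {x : ℝ | x ^ 2 ∈ range (omegaSq a)} ⊆ U) :
    ∃ δ > 0, ∀ x, x ∉ U → ∀ l, δ ≤ |omegaSq a l - x ^ 2| := by
  obtain ⟨m, M, hm, hmM, hr⟩ := range_omegaSq_eq_Icc hs hpos
  have hcl : IsClosed {x : ℝ | x ^ 2 ∈ range (omegaSq a)} :=
    (isCompact_range_omegaSq hs).isClosed.preimage (continuous_pow 2)
  have hcomp : IsCompact {x : ℝ | x ^ 2 ∈ range (omegaSq a)} := by
    refine (isCompact_Icc (a := -(M + 1)) (b := M + 1)).of_isClosed_subset hcl fun x hx => ?_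
    have h2 : x ^ 2 ≤ M := (hr ▸ hx : x ^ 2 ∈ Icc m M).2
    exact abs_le.1 (abs_le_of_sq_le_sq (by nlinarith) (by linarith))
  obtain ⟨δ, hδ, hthick⟩ := hcomp.exists_thickening_subset_open hU hsub
  refine ⟨δ ^ 2, by positivity, fun x hx l => ?_⟩
  have hfar : ∀ y : ℝ, y ^ 2 ∈ range (omegaSq a) → δ ≤ |x - y| := by
    intro y hy
    by_contra hlt
    exact hx (hthick (Metric.mem_thickening_iff.2 ⟨y, hy, not_le.1 hlt⟩))
  have hsq := Real.sq_sqrt (hpos l).le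
  have h1 := hfar (√(omegaSq a l)) (by rw [hsq]; exact mem_range_self l)
  have h2 := hfar (-√(omegaSq a l)) (by rw [neg_sq, hsq]; exact mem_range_self l)
  calc δ ^ 2 = δ * δ := sq δ
    _ ≤ |x - √(omegaSq a l)| * |x - -√(omegaSq a l)| := mul_le_mul h1 h2 hδ.le (abs_nonneg _)
    _ = |omegaSq a l - x ^ 2| := by
        rw [← abs_mul, ← abs_neg]; congr 1
        linear_combination hsq

variable (a) in
/-- The kernel `(2π)⁻¹ ∫₀^{2π} cos(kλ) / (ω²(λ) - x²) dλ` of the resolvent of the coupling operator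
at `x²`. -/
def latticeResolvent (k : ℤ) (x : ℝ) : ℝ := funKernel a (fun w => (w - x ^ 2)⁻¹) k

theorem gap_ne_zero {δ x : ℝ} (hδ : 0 < δ) (hgap : ∀ l, δ ≤ |omegaSq a l - x ^ 2|) (l : ℝ) :
    omegaSq a l - x ^ 2 ≠ 0 := fun h => by
  have := hgap l
  rw [h, abs_zero] at this
  linarith

/-- From `w / (w - x²) = 1 + x² / (w - x²)`: the kernel is the resolvent of the coupling operator
applied to the unit vector at the origin. -/
theorem couple_latticeResolvent (hsymm : ∀ k, a (-k) = a k) (hs : ∀ k, k ∉ s → a k = 0) {δ x : ℝ}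
    (hδ : 0 < δ) (hgap : ∀ l, δ ≤ |omegaSq a l - x ^ 2|) (k : ℤ) :
    couple a s (fun i => latticeResolvent a i x) k
      = (if k = 0 then 1 else 0) + x ^ 2 * latticeResolvent a k x := by
  have hne := gap_ne_zero hδ hgap
  have hc : Continuous fun l => (omegaSq a l - x ^ 2)⁻¹ :=
    ((continuous_omegaSq hs).sub continuous_const).inv₀ hne
  have h1 := funKernel_id_mul hsymm hs (φ := fun w => (w - x ^ 2)⁻¹) hc k
  have h2 : couple a s (fun i => latticeResolvent a i x) k
      = couple a s (funKernel a fun w => (w - x ^ 2)⁻¹) k := rfl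
  rw [h2, ← h1, funKernel_congr (ψ := fun w => 1 + x ^ 2 * (w - x ^ 2)⁻¹) (fun l => by
    have := hne l
    field_simp
    ring), funKernel_add (φ := fun _ => 1) (ψ := fun w => x ^ 2 * (w - x ^ 2)⁻¹) (by fun_prop)
    (continuous_const.mul hc), funKernel_const, funKernel_const_mul]
  rfl

/-- Expanding `(w - x²)⁻¹` around `c` as a finite geometric series, the terms of degree `i < N` in
`w` have kernels of range `K * i` and do not reach `k`; only the remainder is left. -/
theorem latticeResolvent_eq_remainder (hsymm : ∀ k, a (-k) = a k) (hs : ∀ k, k ∉ s → a k = 0)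
    {K : ℕ} (hK : ∀ d ∈ s, |d| ≤ (K : ℤ)) {δ x c : ℝ} (hδ : 0 < δ)
    (hgap : ∀ l, δ ≤ |omegaSq a l - x ^ 2|) (hc : x ^ 2 - c ≠ 0) {k : ℤ} (N : ℕ)
    (hN : ∀ i < N, (K * i : ℤ) < |k|) :
    latticeResolvent a k x
      = funKernel a (fun w => ((w - c) / (x ^ 2 - c)) ^ N * (w - x ^ 2)⁻¹) k := by
  have hne := gap_ne_zero hδ hgap
  have hWc := continuous_omegaSq hs
  have hci : Continuous fun l => (omegaSq a l - x ^ 2)⁻¹ := (hWc.sub continuous_const).inv₀ hne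
  induction N with
  | zero => simp [latticeResolvent]
  | succ N ih =>
    rw [ih fun i hi => hN i (by omega),
      funKernel_congr (ψ := fun w => ((w - c) / (x ^ 2 - c)) ^ (N + 1) * (w - x ^ 2)⁻¹
        + (-((x ^ 2 - c) ^ (N + 1))⁻¹) * (w - c) ^ N) (fun l => by
        have := hne l
        rw [div_pow, div_pow]
        field_simp
        ring),
      funKernel_add (φ := fun w => ((w - c) / (x ^ 2 - c)) ^ (N + 1) * (w - x ^ 2)⁻¹)
        (ψ := fun w => (-((x ^ 2 - c) ^ (N + 1))⁻¹) * (w - c) ^ N)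
        ((by fun_prop : Continuous fun l => ((omegaSq a l - c) / (x ^ 2 - c)) ^ (N + 1)).mul hci)
        (by fun_prop),
      funKernel_const_mul, funKernel_sub_pow_eq_zero hsymm hs hK c N (hN N (by omega)), mul_zero,
      add_zero]

/-- The resolvent kernel decays exponentially, uniformly outside of a neighbourhood of the
spectrum. -/
theorem exists_latticeResolvent_le (ha : IsInteraction a) (hs : ∀ k, k ∉ s → a k = 0) {δ : ℝ}
    (hδ : 0 < δ) :
    ∃ C r : ℝ, 0 < C ∧ 0 < r ∧ r < 1 ∧ ∀ (k : ℤ) (x : ℝ), (∀ l, δ ≤ |omegaSq a l - x ^ 2|) →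
      (1 + x ^ 2) * |latticeResolvent a k x| ≤ C * r ^ k.natAbs := by
  obtain ⟨K, hK⟩ := ha.bounded_support
  have hKs : ∀ k, k ∉ s.filter (fun d => |d| ≤ (K : ℤ)) → a k = 0 := by
    intro k hk
    by_cases h : k ∈ s
    · exact hK k (not_le.1 fun h' => hk (Finset.mem_filter.2 ⟨h, h'⟩))
    · exact hs k h
  have hKd : ∀ d ∈ s.filter (fun d => |d| ≤ (K : ℤ)), |d| ≤ (K : ℤ) := fun d hd =>
    (Finset.mem_filter.1 hd).2
  obtain ⟨m, M, hm, hmM, hr⟩ := range_omegaSq_eq_Icc hs ha.pos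
  have hW : ∀ l, omegaSq a l ∈ Icc m M := fun l => hr ▸ mem_range_self l
  obtain ⟨lm, hlm⟩ : m ∈ range (omegaSq a) := hr ▸ left_mem_Icc.2 hmM
  obtain ⟨lM, hlM⟩ : M ∈ range (omegaSq a) := hr ▸ right_mem_Icc.2 hmM
  set D : ℝ := M - m + δ with hD
  have hD0 : 0 < D := by linarith
  -- The expansion ratio is at most `(M - m) / D`; adding `δ / 2` keeps `θ` positive even when the
  -- band is a point.
  set θ : ℝ := (M - m + δ / 2) / D with hθ
  have hθ0 : 0 < θ := by
    have : 0 < M - m + δ / 2 := by linarith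
    positivity
  have hθ1 : θ < 1 := by rw [hθ, div_lt_one hD0]; linarith
  -- One factor `θ` is gained per `K + 1` lattice sites; `K + 1` rather than `K` gives the strict
  -- inequality `K * i < |k|` and avoids `K = 0`.
  set r : ℝ := θ ^ (((K + 1 : ℕ) : ℝ)⁻¹) with hrdef
  have hr0 : 0 < r := Real.rpow_pos_of_pos hθ0 _
  have hr1 : r < 1 := Real.rpow_lt_one hθ0.le hθ1 (by positivity)
  have hrK : r ^ (K + 1) = θ := Real.rpow_inv_natCast_pow hθ0.le (by omega)
  -- Bounds `(1 + x²) / |ω² - x²|`, since `1 + x² ≤ (1 + M) + |ω² - x²|` and the denominator is at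
  -- least `δ`.
  set C0 : ℝ := 1 + (1 + M) / δ with hC0
  have hC0pos : 0 < C0 := by
    have : 0 < M := hm.trans_le hmM
    positivity
  -- The factor `θ⁻¹` pays for rounding `|k| / (K + 1)` down to the integer `N`.
  refine ⟨C0 * θ⁻¹, r, by positivity, hr0, hr1, fun k x hgap => ?_⟩
  have hne := gap_ne_zero hδ hgap
  -- the centre of the expansion is the end point of the band that is farther from `x²`
  obtain ⟨c, hcW, hcx⟩ : ∃ c, (∀ l, |omegaSq a l - c| ≤ M - m) ∧ D ≤ |x ^ 2 - c| := by
    by_cases hx : x ^ 2 < m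
    · refine ⟨M, fun l => ?_, ?_⟩
      · have := hW l
        rw [abs_le]; constructor <;> linarith [this.1, this.2]
      · have h1 := hgap lm
        rw [hlm, abs_of_pos (by linarith)] at h1
        rw [abs_of_neg (by linarith)]; linarith
    · have hxM : M < x ^ 2 := by
        by_contra h
        have hmem : x ^ 2 ∈ range (omegaSq a) := hr ▸ ⟨not_lt.1 hx, not_lt.1 h⟩
        obtain ⟨l, hl⟩ := hmem
        exact hne l (by rw [hl, sub_self])
      refine ⟨m, fun l => ?_, ?_⟩
      · have := hW l
        rw [abs_le]; constructor <;> linarith [this.1, this.2]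
      · have h1 := hgap lM
        rw [hlM, abs_of_neg (by linarith)] at h1
        rw [abs_of_pos (by linarith)]; linarith
  have hc0 : x ^ 2 - c ≠ 0 := fun h => by
    rw [h, abs_zero] at hcx; linarith
  set N : ℕ := k.natAbs / (K + 1) with hN
  have hNle : N * (K + 1) ≤ k.natAbs := Nat.div_mul_le_self _ _
  have hNlt : k.natAbs < (K + 1) * (N + 1) := by
    have := Nat.lt_div_mul_add (a := k.natAbs) (b := K + 1) (by omega)
    rw [← hN] at this
    nlinarith
  rw [latticeResolvent_eq_remainder ha.symm hKs hKd hδ hgap hc0 N fun i hi => by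
    have h1 : K * i < k.natAbs := by nlinarith
    have h2 : ((K * i : ℕ) : ℤ) < (k.natAbs : ℤ) := by exact_mod_cast h1
    rw [Int.natCast_natAbs] at h2
    exact_mod_cast h2]
  have hpoint : ∀ l, |(1 + x ^ 2) * (((omegaSq a l - c) / (x ^ 2 - c)) ^ N
      * (omegaSq a l - x ^ 2)⁻¹)| ≤ C0 * θ ^ N := by
    intro l
    have h1 : |(omegaSq a l - c) / (x ^ 2 - c)| ≤ θ := by
      rw [abs_div, hθ]
      calc _ ≤ (M - m) / D := div_le_div₀ (by linarith) (hcW l) hD0 hcx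
        _ ≤ _ := by gcongr; linarith
    have h2 : (1 + x ^ 2) * |(omegaSq a l - x ^ 2)⁻¹| ≤ C0 := by
      have hg := hgap l
      have hpos : 0 < |omegaSq a l - x ^ 2| := hδ.trans_le hg
      rw [abs_inv, ← div_eq_mul_inv, div_le_iff₀ hpos]
      have h3 : 1 + x ^ 2 ≤ (1 + M) + |omegaSq a l - x ^ 2| := by
        have := neg_abs_le (omegaSq a l - x ^ 2)
        linarith [(hW l).2]
      refine h3.trans ?_
      have h4 : 1 + M ≤ (1 + M) / δ * |omegaSq a l - x ^ 2| := by
        have hM : 0 < 1 + M := by linarith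
        rw [div_mul_eq_mul_div, le_div_iff₀ hδ]
        gcongr
      rw [hC0]; linarith
    rw [abs_mul, abs_mul, abs_pow, abs_of_pos (by positivity : 0 < 1 + x ^ 2)]
    calc (1 + x ^ 2) * (|(omegaSq a l - c) / (x ^ 2 - c)| ^ N * |(omegaSq a l - x ^ 2)⁻¹|)
        = ((1 + x ^ 2) * |(omegaSq a l - x ^ 2)⁻¹|)
          * |(omegaSq a l - c) / (x ^ 2 - c)| ^ N := by ring
      _ ≤ C0 * θ ^ N := by gcongr
  have hkey := abs_funKernel_le
    (φ := fun w => (1 + x ^ 2) * (((w - c) / (x ^ 2 - c)) ^ N * (w - x ^ 2)⁻¹)) hpoint k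
  rw [funKernel_const_mul, abs_mul, abs_of_pos (by positivity : 0 < 1 + x ^ 2)] at hkey
  refine hkey.trans ?_
  rw [mul_assoc]
  gcongr
  rw [inv_mul_eq_div, le_div_iff₀ hθ0, ← pow_succ, ← hrK, ← pow_mul]
  exact pow_le_pow_of_le_one hr0.le hr1.le hNlt.le

theorem measurable_latticeResolvent (hs : ∀ k, k ∉ s → a k = 0) (k : ℤ) :
    Measurable (latticeResolvent a k) := by
  have hWc := continuous_omegaSq hs
  have h : StronglyMeasurable (fun z : ℝ × ℝ => Real.cos (k * z.2) * (omegaSq a z.2 - z.1 ^ 2)⁻¹) :=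
    Measurable.stronglyMeasurable (by
      have := hWc.measurable
      fun_prop)
  have h2 := h.integral_prod_right' (ν := volume.restrict (Ioc 0 (2 * Real.pi)))
  have h3 : latticeResolvent a k = fun x => (2 * Real.pi)⁻¹ * ∫ l in Ioc 0 (2 * Real.pi),
      Real.cos (k * l) * (omegaSq a l - x ^ 2)⁻¹ := by
    funext x
    rw [latticeResolvent, funKernel, intervalIntegral.integral_of_le Real.two_pi_pos.le]
  rw [h3]
  exact h2.measurable.const_mul _

/-- The kernel is an average over `λ`, with real weights, of resolvents at the frequencies `√ω²(λ)`,
each of which lies in the span. -/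
theorem latticeResolvent_mem_futureSpan {m : Measure ℝ} [IsFiniteMeasure m]
    (hs : ∀ k, k ∉ s → a k = 0) (hpos : ∀ l, 0 < omegaSq a l) {δ : ℝ} (hδ : 0 < δ)
    (hgap : ∀ᵐ x ∂m, ∀ l, δ ≤ |omegaSq a l - x ^ 2|) (k : ℤ) :
    toL2 m (fun x => (latticeResolvent a k x : ℂ)) ∈ futureSpan m := by
  have hWc := continuous_omegaSq hs
  have hmem := integral_mem_futureSpan (m := m) (σ := volume.restrict (Ioc 0 (2 * Real.pi)))
    (G := fun l x => (((2 * Real.pi)⁻¹ * Real.cos (k * l) * (omegaSq a l - x ^ 2)⁻¹ : ℝ) : ℂ))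
    (b := fun _ => (2 * Real.pi)⁻¹ * δ⁻¹) ?_ (integrable_const _) ?_ ?_
  · have h3 : (fun x => (latticeResolvent a k x : ℂ)) = fun x => ∫ l in Ioc 0 (2 * Real.pi),
        (((2 * Real.pi)⁻¹ * Real.cos (k * l) * (omegaSq a l - x ^ 2)⁻¹ : ℝ) : ℂ) := by
      funext x
      rw [integral_complex_ofReal, latticeResolvent, funKernel,
        intervalIntegral.integral_of_le Real.two_pi_pos.le, ← integral_const_mul]
      simp only [mul_assoc]
    rw [h3]
    exact hmem
  · refine Measurable.aestronglyMeasurable ?_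
    have := hWc.measurable
    fun_prop
  · filter_upwards [hgap] with x hx l
    rw [Complex.norm_real, Real.norm_eq_abs, abs_mul, abs_mul, abs_of_pos (by positivity), abs_inv]
    calc (2 * Real.pi)⁻¹ * |Real.cos (k * l)| * |omegaSq a l - x ^ 2|⁻¹
        ≤ (2 * Real.pi)⁻¹ * 1 * δ⁻¹ := by
          gcongr
          · exact Real.abs_cos_le_one _
          · exact hx l
      _ = _ := by rw [mul_one]
  · refine Eventually.of_forall fun l => ?_
    have hgl : ∀ᵐ x ∂m, δ ≤ |√(omegaSq a l) ^ 2 - x ^ 2| := by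
      filter_upwards [hgap] with x hx
      rw [Real.sq_sqrt (hpos l).le]; exact hx l
    have h1 := resolvent_mem_futureSpan (m := m) (Real.sqrt_pos.2 (hpos l)) hδ hgl
    simp only [Real.sq_sqrt (hpos l).le] at h1 hgl
    have hLp : MemLp (fun x : ℝ => (((omegaSq a l - x ^ 2)⁻¹ : ℝ) : ℂ)) 2 m := by
      refine memLp_of_ae_bound (C := δ⁻¹) (Measurable.aestronglyMeasurable (by fun_prop)) ?_
      filter_upwards [hgl] with x hx
      rw [Complex.norm_real, Real.norm_eq_abs, abs_inv]
      exact inv_anti₀ hδ hx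
    have e1 : (fun x : ℝ => (((2 * Real.pi)⁻¹ * Real.cos (k * l) * (omegaSq a l - x ^ 2)⁻¹ : ℝ) : ℂ))
        = fun x => ((2 * Real.pi)⁻¹ * Real.cos (k * l)) • (((omegaSq a l - x ^ 2)⁻¹ : ℝ) : ℂ) := by
      ext x; rw [Complex.real_smul]; push_cast; ring
    rw [e1]
    refine ⟨hLp.const_smul ((2 * Real.pi)⁻¹ * Real.cos (k * l)), ?_⟩
    rw [toL2_const_smul hLp]
    exact Submodule.smul_mem _ _ h1

end Resolvent

/-! ### Filter outputs: smoothness, stationarity, variance. -/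

section Output

variable {Ω : Type*} [MeasurableSpace Ω] {P : Measure Ω} {f : ℝ → Ω → ℝ} {m : Measure ℝ}
  [IsFiniteMeasure m]

/-- The response of a filter with transfer function `g` to the input `f`. -/
def filterOutput (Φ : Lp ℂ 2 m →L[ℝ] Lp ℝ 2 P) (g : ℝ → ℂ) (t : ℝ) : Lp ℝ 2 P :=
  Φ (toL2 m fun x => expChar t x * g x)

variable {Φ : Lp ℂ 2 m →L[ℝ] Lp ℝ 2 P}

theorem hasDerivAt_filterOutput {g : ℝ → ℂ} (hg : AEStronglyMeasurable g m) {C C' : ℝ}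
    (hC : ∀ᵐ x ∂m, ‖g x‖ ≤ C) (hC' : ∀ᵐ x ∂m, ‖Complex.I * x * g x‖ ≤ C') (t : ℝ) :
    HasDerivAt (filterOutput Φ g) (filterOutput Φ (fun x => Complex.I * x * g x) t) t :=
  Φ.hasFDerivAt.comp_hasDerivAt t (hasDerivAt_toL2_expChar_mul hg hC hC' t)

theorem continuous_filterOutput {g : ℝ → ℂ} (hg : AEStronglyMeasurable g m) {C : ℝ}
    (hC : ∀ᵐ x ∂m, ‖g x‖ ≤ C) : Continuous (filterOutput Φ g) :=
  Φ.continuous.comp (continuous_toL2_expChar_mul hg hC)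

/-- `ix g` is the derivative of `e^{itx} g` at `0`. It is taken from the right, because the span is
stable only under shifts by nonnegative times. -/
theorem I_mul_mem_futureSpan {g : ℝ → ℂ} (hg : AEStronglyMeasurable g m) {C C' : ℝ}
    (hC : ∀ᵐ x ∂m, ‖g x‖ ≤ C) (hC' : ∀ᵐ x ∂m, ‖Complex.I * x * g x‖ ≤ C')
    (hgK : toL2 m g ∈ futureSpan m) :
    toL2 m (fun x => Complex.I * x * g x) ∈ futureSpan m := by
  have hd := (hasDerivAt_toL2_expChar_mul hg hC hC' 0).hasDerivWithinAt (s := Ioi 0)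
  rw [hasDerivWithinAt_iff_tendsto_slope' (by simp)] at hd
  simp only [expChar_zero, one_mul] at hd
  refine (isClosed_futureSpan m).mem_of_tendsto hd ?_
  filter_upwards [self_mem_nhdsWithin] with t ht
  have hm : MemLp g 2 m := memLp_of_ae_bound hg hC
  rw [slope_def_module]
  exact Submodule.smul_mem _ _ (Submodule.sub_mem _
    (expChar_mul_mem_futureSpan hm hgK (le_of_lt ht)) (expChar_mul_mem_futureSpan hm hgK le_rfl))

theorem norm_filterOutput (hΦ : IsFutureIsometry P f m Φ) {g : ℝ → ℂ} (hg : MemLp g 2 m)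
    (hgK : toL2 m g ∈ futureSpan m) {t : ℝ} (ht : 0 ≤ t) :
    ‖filterOutput Φ g t‖ = ‖toL2 m g‖ := by
  rw [filterOutput, hΦ.norm _ (expChar_mul_mem_futureSpan hg hgK ht)]
  have h1 := norm_toL2_sq_eq (memLp_expChar_mul hg t)
  have h2 := norm_toL2_sq_eq hg
  simp only [norm_mul, norm_expChar, one_mul] at h1
  exact (sq_eq_sq₀ (norm_nonneg _) (norm_nonneg _)).1 (h1.trans h2.symm)

/-- The isometry turns covariances into inner products in `L²(m)`, where the modulation makes sense
for negative lags too and supplies the covariance function on all of `ℝ`. -/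
theorem isCenteredStationary_filterOutput [IsProbabilityMeasure P] (hΦ : IsFutureIsometry P f m Φ)
    (hA1 : IsCenteredStationary P f) {g : ℝ → ℂ} (hg : AEStronglyMeasurable g m) {C : ℝ}
    (hC : ∀ᵐ x ∂m, ‖g x‖ ≤ C) (hgK : toL2 m g ∈ futureSpan m) :
    IsCenteredStationary P (fun t => filterOutput Φ g t) := by
  have hm : MemLp g 2 m := memLp_of_ae_bound hg hC
  have hK : ∀ t, 0 ≤ t → toL2 m (fun x => expChar t x * g x) ∈ futureSpan m := fun t ht =>
    expChar_mul_mem_futureSpan hm hgK ht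
  have h0 : ∀ t, 0 ≤ t → ∫ w, filterOutput Φ g t w ∂P = 0 := fun t ht =>
    hΦ.integral_map_eq_zero hA1 (hK t ht)
  refine ⟨fun t _ => Lp.memLp _, h0,
    fun u => inner ℝ (toL2 m fun x => expChar u x * g x) (toL2 m g), ?_, fun t u ht hu => ?_⟩
  · exact (continuous_toL2_expChar_mul hg hC).inner continuous_const
  · rw [cov_eq_inner_of_centered (Lp.memLp _) (Lp.memLp _) (h0 t ht), toL2_coeFn, toL2_coeFn,
      filterOutput, filterOutput, hΦ.inner_map (hK t ht) (hK u hu),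
      inner_toL2 (memLp_expChar_mul hm t) (memLp_expChar_mul hm u)]
    beta_reduce
    rw [inner_toL2 (memLp_expChar_mul hm (t - u)) hm]
    simp only [inner_expChar_mul]

theorem variance_filterOutput_le [IsProbabilityMeasure P] (hΦ : IsFutureIsometry P f m Φ)
    (hA1 : IsCenteredStationary P f) {g : ℝ → ℂ} (hg : AEStronglyMeasurable g m) {C : ℝ}
    (hC : ∀ᵐ x ∂m, ‖g x‖ ≤ C) (hgK : toL2 m g ∈ futureSpan m) {t : ℝ} (ht : 0 ≤ t) :
    Var[filterOutput Φ g t; P] = ‖filterOutput Φ g t‖ ^ 2 ∧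
      ‖filterOutput Φ g t‖ ^ 2 ≤ C ^ 2 * m.real univ := by
  have hm : MemLp g 2 m := memLp_of_ae_bound hg hC
  have hst := isCenteredStationary_filterOutput hΦ hA1 hg hC hgK
  constructor
  · rw [← covariance_self (Lp.aestronglyMeasurable _).aemeasurable,
      cov_eq_inner_of_centered (Lp.memLp _) (Lp.memLp _) (hst.centered t ht), toL2_coeFn,
      real_inner_self_eq_norm_sq]
  · rw [norm_filterOutput hΦ hm hgK ht, norm_toL2_sq_eq hm]
    have h1 : ∫ x, ‖g x‖ ^ 2 ∂m ≤ ∫ _, C ^ 2 ∂m := by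
      refine integral_mono_ae (by simpa using hm.integrable_norm_pow (by norm_num))
        (integrable_const _) ?_
      filter_upwards [hC] with x hx
      gcongr
    rw [integral_const, smul_eq_mul, mul_comm] at h1
    exact h1

end Output

/-! ### The stationary motion, and translation between the random system and curves in `L²(P)`. -/

section Systems

variable {Ω : Type*} [MeasurableSpace Ω] {P : Measure Ω} {a : ℤ → ℝ} {s : Finset ℤ} {n : ℤ}
  {f : ℝ → Ω → ℝ}

theorem isSolution_of_hasDerivWithinAt [IsProbabilityMeasure P] (hs : ∀ k, k ∉ s → a k = 0)
    (hf : ∀ t, 0 ≤ t → MemLp (f t) 2 P) {Q R A : ℤ → ℝ → Lp ℝ 2 P}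
    (hQ : ∀ j t, 0 ≤ t → HasDerivWithinAt (Q j) (R j t) (Ici 0) t)
    (hR : ∀ j t, 0 ≤ t → HasDerivWithinAt (R j) (A j t) (Ici 0) t)
    (hA : ∀ j, ContinuousOn (A j) (Ici 0))
    (heq : ∀ j t, 0 ≤ t → A j t
      = -couple a s (fun i => Q i t) j + if j = n then toL2 P (f t) else 0) :
    IsSolution a n P f (fun j t => Q j t) (fun j t => R j t) := by
  refine ⟨fun j t => R j t, fun j t => A j t, fun j => hasContMSDeriv_of_hasDerivWithinAt (hQ j)
    fun t ht => (hR j t ht).continuousWithinAt, fun j => hasContMSDeriv_of_hasDerivWithinAt (hR j)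
    (hA j), fun j t ht => ⟨Eventually.of_forall fun _ => rfl, ?_⟩⟩
  beta_reduce
  rw [heq j t ht]
  filter_upwards [Lp.coeFn_add (-couple a s (fun i => Q i t) j)
      (if j = n then toL2 P (f t) else 0), Lp.coeFn_neg (couple a s (fun i => Q i t) j),
    coeFn_couple a s (fun i => Q i t) j, coeFn_toL2 (hf t ht),
    Lp.coeFn_zero ℝ 2 P] with w h1 h2 h3 h4 h5
  rw [h1, Pi.add_apply, h2, Pi.neg_apply, h3, tsum_eq_couple hs]
  congr 1
  split_ifs
  · rw [h4, mul_one]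
  · rw [h5, Pi.zero_apply, mul_zero]

theorem IsSolution.hasDerivWithinAt_pos {q p : ℤ → ℝ → Ω → ℝ} (h : IsSolution a n P f q p) (j : ℤ)
    {t : ℝ} (ht : 0 ≤ t) :
    HasDerivWithinAt (fun t => toL2 P (q j t)) (toL2 P (p j t)) (Ici 0) t := by
  obtain ⟨q', p', hq, hp, heq⟩ := h
  rw [← toL2_congr ((hq j).memLp' t ht) (heq j t ht).1]
  exact (hq j).hasDerivWithinAt ht

theorem IsSolution.memLp {q p : ℤ → ℝ → Ω → ℝ} (h : IsSolution a n P f q p) (j : ℤ)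
    {t : ℝ} (ht : 0 ≤ t) : MemLp (q j t) 2 P ∧ MemLp (p j t) 2 P := by
  obtain ⟨q', p', hq, hp, heq⟩ := h
  exact ⟨(hq j).memLp t ht, (hp j).memLp t ht⟩

theorem IsSolution.hasDerivWithinAt_mom {q p : ℤ → ℝ → Ω → ℝ} (h : IsSolution a n P f q p)
    (hs : ∀ k, k ∉ s → a k = 0) (hf : ∀ t, 0 ≤ t → MemLp (f t) 2 P) (j : ℤ) {t : ℝ}
    (ht : 0 ≤ t) :
    HasDerivWithinAt (fun t => toL2 P (p j t)) (-couple a s (fun i => toL2 P (q i t)) j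
      + if j = n then toL2 P (f t) else 0) (Ici 0) t := by
  have hmem := fun i => (h.memLp i ht).1
  obtain ⟨q', p', hq, hp, heq⟩ := h
  have key : toL2 P (p' j t) = -couple a s (fun i => toL2 P (q i t)) j
      + if j = n then toL2 P (f t) else 0 := by
    refine Lp.ext ?_
    have hall : ∀ᵐ w ∂P, ∀ i, toL2 P (q i t) w = q i t w :=
      ae_all_iff.2 fun i => coeFn_toL2 (hmem i)
    filter_upwards [Lp.coeFn_add (-couple a s (fun i => toL2 P (q i t)) j)
        (if j = n then toL2 P (f t) else 0),
      Lp.coeFn_neg (couple a s (fun i => toL2 P (q i t)) j),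
      coeFn_couple a s (fun i => toL2 P (q i t)) j, coeFn_toL2 (hf t ht), Lp.coeFn_zero ℝ 2 P,
      (heq j t ht).2, coeFn_toL2 ((hp j).memLp' t ht), hall] with w h1 h2 h3 h4 h5 h6 h7 h8
    rw [h7, h6, h1, Pi.add_apply, h2, Pi.neg_apply, h3, tsum_eq_couple hs]
    simp only [h8]
    congr 1
    split_ifs
    · rw [h4, mul_one]
    · rw [h5, Pi.zero_apply, mul_zero]
  rw [← key]
  exact (hp j).hasDerivWithinAt ht

theorem summable_pow_natAbs {r : ℝ} (h0 : 0 < r) (h1 : r < 1) (n : ℤ) :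
    Summable fun k : ℤ => r ^ (n - k).natAbs := by
  have h : Summable fun k : ℤ => r ^ k.natAbs := by
    refine Summable.of_nat_of_neg ?_ ?_ <;>
      simpa using summable_geometric_of_lt_one h0.le h1
  exact (Equiv.subLeft n).summable_iff (f := fun k : ℤ => r ^ k.natAbs) |>.2 h

/-- The stationary motion as a family of curves in `L²(P)`. -/
theorem exists_stationary_curves [IsProbabilityMeasure P] (ha : IsInteraction a)
    (hs : ∀ k, k ∉ s → a k = 0) (n : ℤ) (hA1 : IsCenteredStationary P f)
    (hA2 : SpectrumIsolated a P f) (hf : IsStrictlyStationary P f) :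
    ∃ Q R A : ℤ → ℝ → Lp ℝ 2 P,
      (∀ j t, HasDerivAt (Q j) (R j t) t) ∧ (∀ j t, HasDerivAt (R j) (A j t) t) ∧
      (∀ j, Continuous (A j)) ∧
      (∀ j t, 0 ≤ t → A j t
        = -couple a s (fun i => Q i t) j + if j = n then toL2 P (f t) else 0) ∧
      (∀ j, IsCenteredStationary P (fun t => Q j t) ∧ IsCenteredStationary P (fun t => R j t)) ∧
      (∃ c r : ℝ, 0 < c ∧ 0 < r ∧ r < 1 ∧ ∀ j t, 0 ≤ t →
        (Var[Q j t; P] = ‖Q j t‖ ^ 2 ∧ ‖Q j t‖ ^ 2 ≤ c * r ^ (n - j).natAbs) ∧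
        (Var[R j t; P] = ‖R j t‖ ^ 2 ∧ ‖R j t‖ ^ 2 ≤ c * r ^ (n - j).natAbs)) ∧
      ∀ j t, 0 ≤ t → IdentDistrib (Q j t) (Q j 0) P P ∧ IdentDistrib (R j t) (R j 0) P P := by
  obtain ⟨m, hm, U, hU, hsub, hUm⟩ := hA2
  have := hm.finite
  obtain ⟨Φ, hΦ⟩ := exists_isFutureIsometry hA1 hm
  obtain ⟨δ, hδ, hgapU⟩ := exists_spectral_gap hs ha.pos hU hsub
  have hgap : ∀ᵐ x ∂m, ∀ l, δ ≤ |omegaSq a l - x ^ 2| := by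
    filter_upwards [measure_eq_zero_iff_ae_notMem.1 hUm] with x hx
    exact hgapU x hx
  obtain ⟨C, r, hC0, hr0, hr1, hdec⟩ := exists_latticeResolvent_le ha hs hδ
  -- The transfer function from `f` to the `j`-th position: it solves `-x² g_j = -(A g)_j +
  -- δ_{j,n}`.
  let g : ℤ → ℝ → ℂ := fun j x => (latticeResolvent a (j - n) x : ℂ)
  let B : ℤ → ℝ := fun j => C * r ^ (n - j).natAbs
  have hB : ∀ j x, (∀ l, δ ≤ |omegaSq a l - x ^ 2|) →
      (1 + x ^ 2) * |latticeResolvent a (j - n) x| ≤ B j := by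
    intro j x hx
    have := hdec (j - n) x hx
    rwa [← Int.natAbs_neg, neg_sub] at this
  have hgm : ∀ j, AEStronglyMeasurable (g j) m := fun j =>
    (Complex.measurable_ofReal.comp (measurable_latticeResolvent hs _)).aestronglyMeasurable
  have hIx : AEStronglyMeasurable (fun x : ℝ => Complex.I * (x : ℂ)) m :=
    (by fun_prop : Continuous fun x : ℝ => Complex.I * (x : ℂ)).aestronglyMeasurable
  have hgm1 : ∀ j, AEStronglyMeasurable (fun x => Complex.I * x * g j x) m := fun j =>
    hIx.mul (hgm j)
  have hgm2 : ∀ j, AEStronglyMeasurable (fun x => Complex.I * x * (Complex.I * x * g j x)) m :=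
    fun j => hIx.mul (hgm1 j)
  -- The weight `1 + x²` dominates `1`, `|x|` and `x²`, so the single bound `B j` serves position,
  -- momentum and acceleration.
  have hb0 : ∀ j, ∀ᵐ x ∂m, ‖g j x‖ ≤ B j := fun j => by
    filter_upwards [hgap] with x hx
    refine le_trans ?_ (hB j x hx)
    rw [Complex.norm_real, Real.norm_eq_abs]
    nlinarith [sq_nonneg x, abs_nonneg (latticeResolvent a (j - n) x)]
  have hb1 : ∀ j, ∀ᵐ x ∂m, ‖Complex.I * x * g j x‖ ≤ B j := fun j => by
    filter_upwards [hgap] with x hx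
    refine le_trans ?_ (hB j x hx)
    rw [norm_mul, norm_mul, Complex.norm_I, one_mul, Complex.norm_real, Complex.norm_real,
      Real.norm_eq_abs, Real.norm_eq_abs]
    gcongr
    nlinarith [sq_abs x, sq_nonneg (|x| - 1)]
  have hb2 : ∀ j, ∀ᵐ x ∂m, ‖Complex.I * x * (Complex.I * x * g j x)‖ ≤ B j := fun j => by
    filter_upwards [hgap] with x hx
    refine le_trans ?_ (hB j x hx)
    rw [norm_mul, norm_mul, norm_mul, norm_mul, Complex.norm_I, one_mul, Complex.norm_real,
      Complex.norm_real, Real.norm_eq_abs, Real.norm_eq_abs, ← mul_assoc]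
    gcongr
    nlinarith [sq_abs x]
  have hK0 : ∀ j, toL2 m (g j) ∈ futureSpan m := fun j =>
    latticeResolvent_mem_futureSpan hs ha.pos hδ hgap _
  have hK1 : ∀ j, toL2 m (fun x => Complex.I * x * g j x) ∈ futureSpan m := fun j =>
    I_mul_mem_futureSpan (hgm j) (hb0 j) (hb1 j) (hK0 j)
  refine ⟨fun j => filterOutput Φ (g j), fun j => filterOutput Φ fun x => Complex.I * x * g j x,
    fun j => filterOutput Φ fun x => Complex.I * x * (Complex.I * x * g j x),
    fun j t => hasDerivAt_filterOutput (hgm j) (hb0 j) (hb1 j) t,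
    fun j t => hasDerivAt_filterOutput (hgm1 j) (hb1 j) (hb2 j) t,
    fun j => continuous_filterOutput (hgm2 j) (hb2 j), fun j t ht => ?_,
    fun j => ⟨isCenteredStationary_filterOutput hΦ hA1 (hgm j) (hb0 j) (hK0 j),
      isCenteredStationary_filterOutput hΦ hA1 (hgm1 j) (hb1 j) (hK1 j)⟩,
    -- The `1` keeps the constant positive even if `m` vanishes; the squared rate in the variance is
    -- weakened to `r`.
    ⟨C ^ 2 * m.real univ + 1, r, by positivity, hr0, hr1, fun j t ht => ?_⟩,
    fun j t ht => ?_⟩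
  -- The equation of motion is checked for transfer functions pointwise in `x`, using `(ix)² = -x²`
  -- and the resolvent identity, and then carried over by `Φ`.
  · have hsplit : toL2 m (fun x => expChar t x * (Complex.I * x * (Complex.I * x * g j x)))
        = -couple a s (fun i => toL2 m fun x => expChar t x * g i x) j
          + if j = n then toL2 m (expChar t) else 0 := by
      refine Lp.ext ?_
      have hall : ∀ᵐ x ∂m, ∀ i,
          toL2 m (fun x => expChar t x * g i x) x = expChar t x * g i x :=
        ae_all_iff.2 fun i => coeFn_toL2 (memLp_expChar_mul (memLp_of_ae_bound (hgm i) (hb0 i)) t)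
      have hsmul : ∀ᵐ x ∂m, ∀ d : ℤ, (a d • toL2 m (fun x => expChar t x * g (j + d) x) :
          Lp ℂ 2 m) x = a d • (toL2 m fun x => expChar t x * g (j + d) x) x :=
        ae_all_iff.2 fun d => Lp.coeFn_smul _ _
      filter_upwards [Lp.coeFn_add (-couple a s (fun i => toL2 m fun x => expChar t x * g i x) j)
          (if j = n then toL2 m (expChar t) else 0),
        Lp.coeFn_neg (couple a s (fun i => toL2 m fun x => expChar t x * g i x) j),
        Lp.coeFn_finsetSum s (fun d => a d • toL2 m (fun x => expChar t x * g (j + d) x)),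
        coeFn_toL2 (memLp_expChar (m := m) t), Lp.coeFn_zero ℂ 2 m,
        coeFn_toL2 (memLp_expChar_mul (memLp_of_ae_bound (hgm2 j) (hb2 j)) t), hall, hsmul, hgap]
        with x h1 h2 h3 h4 h5 h6 h7 h8 h9
      rw [h6, h1, Pi.add_apply, h2, Pi.neg_apply, couple, h3, Finset.sum_apply]
      simp only [h8, h7]
      have hres := couple_latticeResolvent ha.symm hs hδ h9 (j - n)
      have hres' : ∑ d ∈ s, a d • (expChar t x * g (j + d) x)
          = expChar t x * ((if j - n = 0 then 1 else 0) + x ^ 2 * g j x) := by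
        have : ∑ d ∈ s, a d • (expChar t x * g (j + d) x) = expChar t x *
            ((couple a s (fun i => latticeResolvent a i x) (j - n) : ℝ) : ℂ) := by
          rw [couple, Complex.ofReal_sum, Finset.mul_sum]
          refine Finset.sum_congr rfl fun d _ => ?_
          simp only [g]
          rw [show j + d - n = j - n + d by ring, Complex.real_smul, smul_eq_mul]
          push_cast
          ring
        rw [this, hres]
        push_cast
        congr 2
        split_ifs <;> simp
      rw [hres']
      have hI : Complex.I ^ 2 = -1 := Complex.I_sq
      by_cases hjn : j = n
      · rw [if_pos hjn, h4, if_pos (by omega)]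
        linear_combination (expChar t x * x ^ 2 * g j x) * hI
      · rw [if_neg hjn, h5, if_neg (by omega), Pi.zero_apply]
        linear_combination (expChar t x * x ^ 2 * g j x) * hI
    change Φ _ = -couple a s (fun i => Φ _) j + _
    rw [hsplit, map_add, map_neg, couple, map_sum, couple]
    simp only [map_smul]
    congr 1
    split_ifs
    · exact hΦ.apply t ht
    · exact map_zero _
  · have hle : (B j) ^ 2 * m.real univ
        ≤ (C ^ 2 * m.real univ + 1) * r ^ (n - j).natAbs := by
      have h1 : 0 ≤ r ^ (n - j).natAbs := by positivity
      have h2 : r ^ (n - j).natAbs ≤ 1 := pow_le_one₀ hr0.le hr1.le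
      have h3 : (r ^ (n - j).natAbs) ^ 2 ≤ r ^ (n - j).natAbs := by
        rw [sq]; exact mul_le_of_le_one_right h1 h2
      calc (B j) ^ 2 * m.real univ = C ^ 2 * m.real univ * (r ^ (n - j).natAbs) ^ 2 := by
            simp only [B]; ring
        _ ≤ C ^ 2 * m.real univ * r ^ (n - j).natAbs := by gcongr
        _ ≤ _ := by rw [add_mul]; linarith
    have hv0 := variance_filterOutput_le hΦ hA1 (hgm j) (hb0 j) (hK0 j) ht
    have hv1 := variance_filterOutput_le hΦ hA1 (hgm1 j) (hb1 j) (hK1 j) ht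
    exact ⟨⟨hv0.1, hv0.2.trans hle⟩, ⟨hv1.1, hv1.2.trans hle⟩⟩
  · have hid : ∀ {h : ℝ → ℂ}, MemLp h 2 m → toL2 m h ∈ futureSpan m →
        IdentDistrib (filterOutput Φ h t) (filterOutput Φ h 0) P P := by
      intro h hh hhK
      have h0 : filterOutput Φ h 0 = Φ (toL2 m h) := by
        simp only [filterOutput, expChar_zero, one_mul]
      rw [h0]
      exact hΦ.identDistrib hA1 hf hh hhK ht
    exact ⟨hid (memLp_of_ae_bound (hgm j) (hb0 j)) (hK0 j),
      hid (memLp_of_ae_bound (hgm1 j) (hb1 j)) (hK1 j)⟩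

/-- Convergence as `t → ∞` is tested along sequences, where almost sure convergence implies
convergence in measure. -/
theorem tendstoInMeasure_of_tendsto_ae_atTop [IsFiniteMeasure P] {Y : ℝ≥0 → Ω → ℝ}
    (hY : ∀ t, AEStronglyMeasurable (Y t) P)
    (h : ∀ᵐ w ∂P, Tendsto (fun t => Y t w) atTop (𝓝 0)) :
    TendstoInMeasure P Y atTop 0 := by
  intro ε hε
  refine tendsto_of_seq_tendsto fun u hu => ?_
  exact tendstoInMeasure_of_tendsto_ae (g := 0) (fun N => hY (u N))
    (h.mono fun w hw => hw.comp hu) ε hε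

/-- A process that differs from a process with time invariant one-dimensional distributions by a
process vanishing almost surely at infinity converges in distribution. -/
theorem VanishesSmoothly.tendstoInDistribution [IsProbabilityMeasure P] {X Z : ℝ → Ω → ℝ}
    (h : VanishesSmoothly P fun t w => X t w - Z t w) (hX : ∀ t, 0 ≤ t → MemLp (X t) 2 P)
    (hZ : ∀ t, 0 ≤ t → IdentDistrib (Z t) (Z 0) P P) :
    TendstoInDistribution (fun t : ℝ≥0 => X t) atTop (Z 0) (fun _ => P) P := by
  obtain ⟨Y, hXY, hY⟩ := h
  have hZm : ∀ t : ℝ≥0, AEMeasurable (Z t) P := fun t => (hZ t t.2).aemeasurable_fst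
  have hYm : ∀ t : ℝ≥0, AEStronglyMeasurable (Y t) P := fun t =>
    (((hX t t.2).1.aemeasurable.sub (hZm t)).congr (hXY t t.2)).aestronglyMeasurable
  -- Slutsky's theorem: the laws of `Z(t)` are constant, and `X(t) - Z(t)` tends to zero in measure.
  refine tendstoInDistribution_of_tendstoInMeasure_sub (X := fun t : ℝ≥0 => Z t) _ _
    (tendstoInDistribution_of_identDistrib 0
      (fun t => (hZ _ (NNReal.coe_nonneg 0)).trans (hZ t t.2).symm)
      (hZ _ (NNReal.coe_nonneg 0))) ?_ fun t => (hX t t.2).1.aemeasurable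
  have hY' : ∀ t : ℝ≥0, Y t =ᵐ[P] ((fun t : ℝ≥0 => X t) - fun t : ℝ≥0 => Z t) t := fun t => by
    filter_upwards [hXY t t.2] with w hw
    exact hw.symm
  refine TendstoInMeasure.congr_left hY' (tendstoInMeasure_of_tendsto_ae_atTop hYm ?_)
  filter_upwards [hY] with w hw
  exact hw.2.comp (NNReal.tendsto_coe_atTop.2 tendsto_id)

end Systems

theorem staysInL_of_memℓp {Ω : Type*} [MeasurableSpace Ω] {P : Measure Ω}
    {Q R : ℤ → ℝ → Lp ℝ 2 P} (hQ : ∀ t, 0 ≤ t → Memℓp (fun j => Q j t) 2)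
    (hR : ∀ t, 0 ≤ t → Memℓp (fun j => R j t) 2) :
    StaysInL P (fun j t => Q j t) (fun j t => R j t) := fun t ht =>
  (ae_memℓp (memℓp_two_iff.1 (hQ t ht))).and (ae_memℓp (memℓp_two_iff.1 (hR t ht)))

/-! ### Every motion is the stationary motion plus a homogeneous one. -/

section Motions

variable {Ω : Type*} [MeasurableSpace Ω] {P : Measure Ω} {a : ℤ → ℝ}
  {s : Finset ℤ} {n : ℤ} {f : ℝ → Ω → ℝ} {Q R A : ℤ → ℝ → Lp ℝ 2 P}

/-- A forced motion plus a homogeneous one is a forced motion. -/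
theorem isMotion_add_flow [IsProbabilityMeasure P] (hs : ∀ k, k ∉ s → a k = 0) (hf : ∀ t, 0 ≤ t → MemLp (f t) 2 P)
    (hQ : ∀ j t, HasDerivAt (Q j) (R j t) t) (hR : ∀ j t, HasDerivAt (R j) (A j t) t)
    (hA : ∀ j, Continuous (A j))
    (heq : ∀ j t, 0 ≤ t → A j t
      = -couple a s (fun i => Q i t) j + if j = n then toL2 P (f t) else 0)
    (hQL : ∀ t, 0 ≤ t → Memℓp (fun j => Q j t) 2) (hRL : ∀ t, 0 ≤ t → Memℓp (fun j => R j t) 2)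
    {B : ℝ} (hB : ∀ j t, 0 ≤ t → ‖Q j t‖ ≤ B ∧ ‖R j t‖ ≤ B) {q₀ p₀ : ℤ → ℝ} (x : Phase (Lp ℝ 2 P))
    (hx₁ : ∀ j, x.1 j = toL2 P (fun _ => q₀ j) - Q j 0)
    (hx₂ : ∀ j, x.2 j = toL2 P (fun _ => p₀ j) - R j 0) :
    IsMotion a n P f q₀ p₀ (fun j t => (Q j t + (flow a s x t).1 j : Lp ℝ 2 P))
      (fun j t => (R j t + (flow a s x t).2 j : Lp ℝ 2 P)) where
  isSolution := by
    refine isSolution_of_hasDerivWithinAt (s := s)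
      (A := fun j t => A j t + -couple a s (fun i => (flow a s x t).1 i) j) hs hf
      (fun j t _ => ((hQ j t).add (hasDerivAt_flow_fst a s x j t)).hasDerivWithinAt)
      (fun j t _ => ((hR j t).add (hasDerivAt_flow_snd a s x j t)).hasDerivWithinAt)
      (fun j => ((hA j).add (Continuous.neg ?_)).continuousOn) fun j t ht => ?_
    · exact continuous_finsetSum _ fun d _ =>
        (contDiff_flow_fst a s x (j + d) 0).continuous.const_smul (a d)
    · rw [heq j t ht, couple_add]
      abel
  staysInL := staysInL_of_memℓp (fun t ht => (hQL t ht).add (lp.memℓp _))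
    fun t ht => (hRL t ht).add (lp.memℓp _)
  moments T := by
    obtain ⟨C, hC⟩ := norm_flow_coord_le a s x T
    refine ⟨(B + C) ^ 2, fun t ht htT j => ?_⟩
    rw [integral_coeFn_sq, integral_coeFn_sq]
    exact ⟨pow_le_pow_left₀ (norm_nonneg _)
        ((norm_add_le _ _).trans (add_le_add (hB j t ht).1 (hC t ht htT j).1)) 2,
      pow_le_pow_left₀ (norm_nonneg _)
        ((norm_add_le _ _).trans (add_le_add (hB j t ht).2 (hC t ht htT j).2)) 2⟩
  initial j := by
    rw [flow_zero, hx₁, hx₂, add_sub_cancel, add_sub_cancel]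
    exact ⟨coeFn_toL2 (memLp_const (q₀ j)), coeFn_toL2 (memLp_const (p₀ j))⟩

/-- Every motion differs from a given bounded forced motion by a homogeneous one. -/
theorem IsMotion.toL2_sub_eq_flow (hs : ∀ k, k ∉ s → a k = 0)
    (hf : ∀ t, 0 ≤ t → MemLp (f t) 2 P)
    (hQ : ∀ j t, HasDerivAt (Q j) (R j t) t) (hR : ∀ j t, HasDerivAt (R j) (A j t) t)
    (heq : ∀ j t, 0 ≤ t → A j t
      = -couple a s (fun i => Q i t) j + if j = n then toL2 P (f t) else 0)
    {B : ℝ} (hB : ∀ j t, 0 ≤ t → ‖Q j t‖ ≤ B ∧ ‖R j t‖ ≤ B) {q₀ p₀ : ℤ → ℝ} (x : Phase (Lp ℝ 2 P))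
    (hx₁ : ∀ j, x.1 j = toL2 P (fun _ => q₀ j) - Q j 0)
    (hx₂ : ∀ j, x.2 j = toL2 P (fun _ => p₀ j) - R j 0) {q p : ℤ → ℝ → Ω → ℝ}
    (h : IsMotion a n P f q₀ p₀ q p) {t : ℝ} (ht : 0 ≤ t) (j : ℤ) :
    toL2 P (q j t) - Q j t = (flow a s x t).1 j ∧ toL2 P (p j t) - R j t = (flow a s x t).2 j := by
  refine eq_flow_of_homogeneous a s (q := fun j t => toL2 P (q j t) - Q j t)
    (p := fun j t => toL2 P (p j t) - R j t)
    (fun j t ht => (h.isSolution.hasDerivWithinAt_pos j ht).sub (hQ j t).hasDerivWithinAt)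
    (fun j t ht => ?_) (fun T => ?_) x (fun j => ?_) (fun j => ?_) ht j
  · have := (h.isSolution.hasDerivWithinAt_mom hs hf j ht).sub (hR j t).hasDerivWithinAt
    rw [heq j t ht, add_sub_add_right_eq_sub, ← neg_sub', ← couple_sub] at this
    exact this
  · obtain ⟨C, hC⟩ := h.moments T
    refine ⟨√C + B, fun t ht htT j => ?_⟩
    have hmem := h.isSolution.memLp j ht
    exact ⟨(norm_sub_le _ _).trans (add_le_add (Real.le_sqrt_of_sq_le
        ((norm_toL2_sq hmem.1).trans_le (hC t ht htT j).1)) (hB j t ht).1),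
      (norm_sub_le _ _).trans (add_le_add (Real.le_sqrt_of_sq_le
        ((norm_toL2_sq hmem.2).trans_le (hC t ht htT j).2)) (hB j t ht).2)⟩
  · rw [hx₁, toL2_congr (h.isSolution.memLp j le_rfl).1 (h.initial j).1]
  · rw [hx₂, toL2_congr (h.isSolution.memLp j le_rfl).2 (h.initial j).2]

/-- The version is the deterministic flow of the initial values at `w`. It agrees with the
difference almost surely at each fixed time, and smoothness and decay hold on every path. -/
theorem vanishesSmoothly_of_toL2_sub_eq_flow [IsFiniteMeasure P] (ha : IsInteraction a)
    (hs : ∀ k, k ∉ s → a k = 0)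
    (hne : ∃ k : ℤ, k ≠ 0 ∧ a k ≠ 0) (x : Phase (Lp ℝ 2 P)) {q p : ℤ → ℝ → Ω → ℝ} {k : ℤ}
    (hmem : ∀ t, 0 ≤ t → MemLp (q k t) 2 P ∧ MemLp (p k t) 2 P)
    (h : ∀ t, 0 ≤ t → toL2 P (q k t) - Q k t = (flow a s x t).1 k ∧
      toL2 P (p k t) - R k t = (flow a s x t).2 k) :
    VanishesSmoothly P (fun t w => q k t w - Q k t w) ∧
      VanishesSmoothly P (fun t w => p k t w - R k t w) := by
  refine ⟨⟨fun t w => (flow a s (pathPoint x.1 w, pathPoint x.2 w) t).1 k, fun t ht => ?_,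
      Eventually.of_forall fun w => ⟨(contDiff_flow_fst a s _ k _).contDiffOn,
        (tendsto_flow_zero ha.symm hs ha.pos hne _ k).1⟩⟩,
    ⟨fun t w => (flow a s (pathPoint x.1 w, pathPoint x.2 w) t).2 k, fun t ht => ?_,
      Eventually.of_forall fun w => ⟨(contDiff_flow_snd a s _ k _).contDiffOn,
        (tendsto_flow_zero ha.symm hs ha.pos hne _ k).2⟩⟩⟩
  · filter_upwards [(ae_flow_eq a s x t k).1, coeFn_toL2 (hmem t ht).1,
      Lp.coeFn_sub (toL2 P (q k t)) (Q k t)] with w h1 h2 h3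
    rw [← h1, ← (h t ht).1, h3, Pi.sub_apply, h2]
  · filter_upwards [(ae_flow_eq a s x t k).2, coeFn_toL2 (hmem t ht).2,
      Lp.coeFn_sub (toL2 P (p k t)) (R k t)] with w h1 h2 h3
    rw [← h1, ← (h t ht).2, h3, Pi.sub_apply, h2]

end Motions

end

/-! ### The main theorem. -/

theorem theorem2 {Ω : Type*} [MeasurableSpace Ω] (P : Measure Ω) [IsProbabilityMeasure P]
    (a : ℤ → ℝ) (ha : IsInteraction a) (hne : ∃ k : ℤ, k ≠ 0 ∧ a k ≠ 0) (n : ℤ)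
    (f : ℝ → Ω → ℝ) (hA1 : IsCenteredStationary P f) (hA2 : SpectrumIsolated a P f)
    (hf : IsStrictlyStationary P f) :
    ∃ qInf pInf : ℤ → ℝ → Ω → ℝ, IsStationaryMotion a n P f qInf pInf ∧
      ∀ q₀ p₀ : ℤ → ℝ, Memℓp q₀ 2 → Memℓp p₀ 2 →
        (∃ q p : ℤ → ℝ → Ω → ℝ, IsMotion a n P f q₀ p₀ q p) ∧
        ∀ q p : ℤ → ℝ → Ω → ℝ, IsMotion a n P f q₀ p₀ q p → ∀ k : ℤ,
          (VanishesSmoothly P (fun t w => q k t w - qInf k t w) ∧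
            VanishesSmoothly P (fun t w => p k t w - pInf k t w)) ∧
          TendstoInDistribution (fun (t : ℝ≥0) => q k t) atTop (qInf k 0) (fun _ => P) P ∧
          TendstoInDistribution (fun (t : ℝ≥0) => p k t) atTop (pInf k 0) (fun _ => P) P := by
  obtain ⟨s, hs⟩ : ∃ s : Finset ℤ, ∀ k, k ∉ s → a k = 0 := by
    obtain ⟨K, hK⟩ := ha.bounded_support
    refine ⟨Finset.Icc (-K) K, fun k hk => hK k ?_⟩
    rw [Finset.mem_Icc, ← abs_le] at hk
    exact not_le.1 hk
  obtain ⟨Q, R, A, hQ, hR, hA, heq, hst, ⟨c, r, hc, hr0, hr1, hdec⟩, hid⟩ :=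
    exists_stationary_curves ha hs n hA1 hA2 hf
  have hsum := (summable_pow_natAbs hr0 hr1 n).mul_left c
  have hQL : ∀ t, 0 ≤ t → Memℓp (fun j => Q j t) 2 := fun t ht => memℓp_two_iff.2
    (hsum.of_nonneg_of_le (fun _ => by positivity) fun j => (hdec j t ht).1.2)
  have hRL : ∀ t, 0 ≤ t → Memℓp (fun j => R j t) 2 := fun t ht => memℓp_two_iff.2
    (hsum.of_nonneg_of_le (fun _ => by positivity) fun j => (hdec j t ht).2.2)
  have hB : ∀ j t, 0 ≤ t → ‖Q j t‖ ≤ √c ∧ ‖R j t‖ ≤ √c := fun j t ht => by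
    have hle : c * r ^ (n - j).natAbs ≤ c :=
      mul_le_of_le_one_right hc.le (pow_le_one₀ hr0.le hr1.le)
    exact ⟨Real.le_sqrt_of_sq_le ((hdec j t ht).1.2.trans hle),
      Real.le_sqrt_of_sq_le ((hdec j t ht).2.2.trans hle)⟩
  refine ⟨fun j t => Q j t, fun j t => R j t, ⟨isSolution_of_hasDerivWithinAt hs hA1.memLp
    (fun j t _ => (hQ j t).hasDerivWithinAt) (fun j t _ => (hR j t).hasDerivWithinAt)
    (fun j => (hA j).continuousOn) heq, staysInL_of_memℓp hQL hRL, hst,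
    ⟨c, c, r, hc, hc, hr0, hr1, fun k => ⟨(hdec k 0 le_rfl).1.1.trans_le (hdec k 0 le_rfl).1.2,
      (hdec k 0 le_rfl).2.1.trans_le (hdec k 0 le_rfl).2.2⟩⟩⟩, fun q₀ p₀ hq₀ hp₀ => ?_⟩
  have hconst : ∀ {u : ℤ → ℝ}, Memℓp u 2 → Memℓp (fun j => toL2 P fun _ => u j) 2 := fun hu =>
    memℓp_two_iff.2 (by simpa only [norm_toL2_const] using memℓp_two_iff.1 hu)
  -- The initial difference `ψ(0) - η(0)`; it is in `ℓ²(ℤ; L²(P))` because constants keep their norm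
  -- in `L²(P)` and the variances of `η(0)` are summable.
  let x : Phase (Lp ℝ 2 P) := (⟨fun j => toL2 P (fun _ => q₀ j) - Q j 0,
    (hconst hq₀).sub (hQL 0 le_rfl)⟩, ⟨fun j => toL2 P (fun _ => p₀ j) - R j 0,
    (hconst hp₀).sub (hRL 0 le_rfl)⟩)
  refine ⟨⟨_, _, isMotion_add_flow hs hA1.memLp hQ hR hA heq hQL hRL hB x (fun _ => rfl)
    fun _ => rfl⟩, fun q p h k => ?_⟩
  have hmem := fun t ht => h.isSolution.memLp k (t := t) ht
  have hvan := vanishesSmoothly_of_toL2_sub_eq_flow ha hs hne x hmem fun t ht =>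
    h.toL2_sub_eq_flow hs hA1.memLp hQ hR heq hB x (fun _ => rfl) (fun _ => rfl) ht k
  exact ⟨hvan,
    hvan.1.tendstoInDistribution (fun t ht => (hmem t ht).1) fun t ht => (hid k t ht).1,
    hvan.2.tendstoInDistribution (fun t ht => (hmem t ht).2) fun t ht => (hid k t ht).2⟩
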